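/- **Diagrams.** An abstract Gauss diagram consists of two finite families $\mathcal M^+,\mathcal M^-$ of disjoint oriented circles (with $g^+$ and $g^-$ elements, not necessarily equal; circles without chords are allowed) and finitely many chords, each joining a circle of $\mathcal M^+$ to a circle of $\mathcal M^-$ and carrying a sign $\pm1$. Contracting every chord to a point and thickening gives an oriented ribbon graph, in which the circles are immersed curves crossing at the chords, the frame (direction of the $\mathcal M^+$-circle, direction of the $\mathcal M^-$-circle) at a crossing being positive exactly for a positive chord. An edge is an arc of a circle between consecutive chord ends, or a whole circle without chords. The boundary components of the ribbon graph are called cycles (a circle without chords is an annulus and gives two cycles); each edge has a right and a left side, each lying on a cycle. The diagram is decorated if every cycle is given a color from a finite set all of whose elements are used. The side of an edge has the color of its cycle. The closed oriented surface $S(G)$ is obtained from the ribbon graph by gluing to it, for each color, a sphere with holes along all the cycles of that color. **The numbers $\partial g^\pm$.** Let $H^\pm$ be obtained from $S(G)\times[-1,1]$ by attaching 2-handles along the circles of $\mathcal M^\pm$ on one end and filling all resulting spherical boundary components by balls. The inner boundary $\partial^-H^\pm$ is thus obtained from $S(G)$ by surgery along the curves of $\mathcal M^\pm$ (cut along each curve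 and cap both copies with discs) and removal of the spheres. Let $\partial g^\pm$ be the sum of the genera of the components of $\partial^-H^\pm$. **Moves** (up to renaming circles, chords and colors). * *$R$-move.* Choose an edge $e^+$ of $\mathcal M^+$ and an edge $e^-$ of $\mathcal M^-$, and a side of each, on cycles of the same color $c$. Add a positive chord $p$ and a negative chord $m$, both joining $e^+$ to $e^-$: along $e^+$, $m$ precedes $p$ if the chosen side of $e^-$ is the right one, and $p$ precedes $m$ otherwise; along $e^-$, $p$ precedes $m$ if the chosen side of $e^+$ is the right one, and $m$ precedes $p$ otherwise. The cycle formed by the two edges between $p$ and $m$ gets a new color of its own. If the chosen sides lay on different cycles, these merge into one cycle, and the other colors are unchanged. If they lay on the same cycle, it is cut into two cycles; $c$ is replaced by two colors, which these two cycles get respectively, and each further cycle of color $c$ gets either one of the two; the other colors are unchanged. * *$H$-move.* Choose edges $e_1,e$ of two different circles $\mu_1\ne\mu_2$ of the same family, and a side of each, on cycles of the same color $c$. Replace $\mu_2$ by its band sum, along an arc joining these sides inside the region of color $c$, with a parallel copy of $\mu_1$ pushed off to the chosen side. Thus every chord of $\mu_1$ is duplicated; the copies are inserted in $e$ on $\mu_2$,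 and each copy is placed next to the original chord on the circle of the other family, on the chosen side of $\mu_1$. If the chosen sides are both right or both left, the copy of $\mu_1$ is run through in the direction of $\mu_1$ and the copied chords keep their signs; otherwise it is run through in the opposite direction and the copied chords get the opposite signs. The four-edged cycle between each edge of $\mu_1$ other than $e_1$ and its copy gets a new color of its own; the outer side of the copy gets the former color of that side of the edge. The chosen side of $e_1$ gets the color of the side of $e$ that was not chosen. If the chosen sides lay on the same cycle, it is cut into two cycles and $c$ is replaced by two colors as in an $R$-move; otherwise the remaining colors are unchanged. * *$S$-move.* Add one circle to each family, joined to each other by one chord of arbitrary sign and to nothing else; the single new cycle gets an existing color. * *$B$-move.* Add a circle without chords to one of the families; one of its two cycles gets a new color and the other one an existing color. Two decorated Gauss diagrams are called equivalent if one can be obtained from the other by a finite sequence of $R$-, $H$-, $S$- and $B$-moves and their opposites. **Proposition.** The numbers $\partial g^+$ and $\partial g^-$ are invariants of the equivalence classes of abstract decorated Gauss diagrams: if $G$ and $G'$ are equivalent, then $\partial g^+(G)=\partial g^+(G')$ and $\partial g^-(G)=\partial g^-(G')$. -/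

import Mathlib

/-! # Decorated Gauss diagrams, their moves, and the genera of the inner boundaries -/

/-- The two families of circles: `plus` stands for `M⁺` and `minus` for `M⁻`. -/
inductive Family where
  | plus
  | minus
  deriving DecidableEq

/-- The two sides of an oriented curve on an oriented surface. -/
inductive Side where
  | right
  | left
  deriving DecidableEq

namespace Family

instance : Fintype Family := ⟨{plus, minus}, fun s => by cases s <;> simp⟩

/-- The other family. -/
def other : Family → Family
  | plus => minus
  | minus => plus

/-- `+1` for `M⁺` and `-1` for `M⁻`. -/
def sgn : Family → ℤˣ
  | plus => 1
  | minus => -1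

end Family

namespace Side

instance : Fintype Side := ⟨{right, left}, fun s => by cases s <;> simp⟩

/-- The other side. -/
def opp : Side → Side
  | right => left
  | left => right

/-- `+1` for the right side and `-1` for the left side. -/
def sgn : Side → ℤˣ
  | right => 1
  | left => -1

end Side

/-- An abstract (undecorated) Gauss diagram: two finite families of oriented circles, of
arbitrary and possibly different sizes, and finitely many signed chords, each of which joins a
circle of `M⁺` to a circle of `M⁻`.  Circles without chords are allowed. -/
structure GaussDiagram where
  /-- the circles of each family -/
  Circ : Family → Type
  /-- the chords -/
  Chord : Type
  finite_circ : ∀ s, Finite (Circ s)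
  finite_chord : Finite Chord
  /-- the circle of the family `s` on which the chord `x` ends -/
  circ : ∀ s, Chord → Circ s
  /-- the chord met next after `x`, going along the oriented circle `circ s x` -/
  next : Family → Equiv.Perm Chord
  /-- the chords ending on a circle are ordered cyclically by `next` -/
  next_cyclic : ∀ s x y, circ s x = circ s y ↔ (next s).SameCycle x y
  /-- the signs of the chords -/
  sign : Chord → ℤˣ

namespace GaussDiagram

attribute [instance] GaussDiagram.finite_circ GaussDiagram.finite_chord

variable (G : GaussDiagram)

/-- The circles of the family `s` that carry no chord. -/
abbrev FreeCircle (s : Family) : Type := {μ : G.Circ s // ∀ x, G.circ s x ≠ μ}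

/-- The arcs of the family `s`.  `Sum.inl x` is the edge that starts at the chord `x` and ends at
the chord `next s x`; `Sum.inr μ` is the whole circle `μ`, if it carries no chord. -/
abbrev Arc (s : Family) : Type := G.Chord ⊕ G.FreeCircle s

/-- The circle that contains an arc. -/
def arcCirc (s : Family) : G.Arc s → G.Circ s
  | .inl x => G.circ s x
  | .inr μ => μ.1

/-- The sides of the arcs, that is, the boundary arcs of the ribbon graph.  On the right side one
travels along the arc, on the left side one travels against it.  Thus the right and the left side
correspond to the first and the second entry of the coloring of an edge. -/
abbrev Dart : Type := Σ s : Family, G.Arc s × Side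

/-- The right turn rule for the boundary components of the ribbon graph.  A chord `p` is positive
if the frame (direction of `M⁺`, direction of `M⁻`) at `p` is positive.  Arriving at `p` along an
arc of the family `s`, one turns right into the other family: either backwards into its incoming
arc at `p` or forwards into its outgoing arc at `p`. -/
def turn : G.Dart → G.Dart
  | ⟨s, .inl x, k⟩ =>
      let p : G.Chord := match k with
        | .right => G.next s x
        | .left => x
      if s.sgn * G.sign p * k.sgn = 1 then
        ⟨s.other, .inl ((G.next s.other).symm p), .left⟩
      else
        ⟨s.other, .inl p, .right⟩
  | ⟨s, .inr μ, k⟩ => ⟨s, .inr μ, k⟩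

/-- The cycles of the diagram: the boundary components of its ribbon graph.  A circle without
chords contributes an annulus, hence two cycles. -/
def Cycle : Type := Quot fun d d' : G.Dart => G.turn d = d'

/-- The cycle that contains the side `k` of the arc `a` of the family `s`. -/
def cycle (s : Family) (a : G.Arc s) (k : Side) : G.Cycle := Quot.mk _ ⟨s, a, k⟩

instance : Finite G.Cycle := by
  unfold Cycle; infer_instance

/-- The chords that end on the circle `μ`. -/
abbrev OnCircle (s : Family) (μ : G.Circ s) : Type := {x : G.Chord // G.circ s x = μ}

theorem circ_next (s : Family) (x : G.Chord) : G.circ s (G.next s x) = G.circ s x :=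
  (G.next_cyclic s _ _).2 (Equiv.Perm.sameCycle_apply_left.2 (Equiv.Perm.SameCycle.refl _ _))

/-- The cyclic order of the chords on the circle `μ`. -/
def nextOn (s : Family) (μ : G.Circ s) : Equiv.Perm (G.OnCircle s μ) :=
  (G.next s).subtypePerm fun x => by rw [G.circ_next s x]

end GaussDiagram

/-- An abstract decorated Gauss diagram: every cycle has a color, and every color is used.
The surface `S` associated to it is obtained from the ribbon graph by gluing to it, for each
color, a sphere with holes along all the cycles of this color. -/
structure DecoratedGaussDiagram extends GaussDiagram where
  /-- the colors -/
  Color : Type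
  finite_color : Finite Color
  /-- the coloring of the cycles -/
  color : toGaussDiagram.Cycle → Color
  color_surjective : Function.Surjective color

namespace DecoratedGaussDiagram

attribute [instance] DecoratedGaussDiagram.finite_color

section Boundary

variable (G : DecoratedGaussDiagram)

/-- The color of the cycle that contains the side `k` of the arc `a` of the family `s`. -/
def col (s : Family) (a : G.Arc s) (k : Side) : G.Color := G.color (G.cycle s a k)

/-- The pieces of the closed surface obtained from the surface `S` by surgery along the circles of
the family `s`: cut `S` along these circles and glue a disc to each of the two copies of each of
them.  The pieces are the open regions of the complement of all circles in `S`, one for each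
color; the open arcs of the other family; and the closed capping discs, one for each side of each
circle of the family `s`. -/
abbrev Piece (s : Family) : Type := G.Color ⊕ G.Arc s.other ⊕ (G.Circ s × Side)

/-- The Euler characteristics of the pieces.  They are additive, being taken with compact
supports: an open sphere with `m` holes has `2 - m`, an open interval has `-1`, a circle has `0`,
and a closed disc has `1`. -/
noncomputable def pieceEuler (s : Family) : G.Piece s → ℤ
  | .inl c => 2 - (Nat.card {z : G.Cycle // G.color z = c} : ℤ)
  | .inr (.inl (.inl _)) => -1
  | .inr (.inl (.inr _)) => 0
  | .inr (.inr _) => 1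

/-- Incidence of the pieces: a region is incident with the arcs of the other family on its
boundary, and with the capping disc on the side of a circle where the region lies. -/
inductive Incident (s : Family) : G.Piece s → G.Piece s → Prop
  | arc (a : G.Arc s.other) (k : Side) :
      Incident s (.inl (G.col s.other a k)) (.inr (.inl a))
  | cap (a : G.Arc s) (k : Side) :
      Incident s (.inl (G.col s a k)) (.inr (.inr (G.arcCirc s a, k)))

/-- The connected components of the surface obtained by surgery along the family `s`. -/
def Component (s : Family) : Type := Quot (G.Incident s)

instance (s : Family) : Finite (G.Component s) := by
  unfold Component; infer_instance

/-- The Euler characteristic of a component. -/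
noncomputable def componentEuler (s : Family) (K : G.Component s) : ℤ :=
  ∑ᶠ p : {p : G.Piece s // Quot.mk (G.Incident s) p = K}, G.pieceEuler s p.1

/-- The genus of a component, a closed connected oriented surface: its Euler characteristic is
`2 - 2 * genus`. -/
noncomputable def componentGenus (s : Family) (K : G.Component s) : ℚ :=
  1 - (G.componentEuler s K : ℚ) / 2

/-- The number `∂g⁺` (for `s = plus`) or `∂g⁻` (for `s = minus`): the sum of the genera of the
components of the inner boundary of the compression body obtained from `S × [-1,1]` by attaching
2-handles along the circles of the family `s` and filling the spherical boundary components by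
balls.  Before the filling, this inner boundary is the surface obtained by surgery; the filled
spheres have genus zero and do not contribute. -/
noncomputable def boundaryGenus (s : Family) : ℚ :=
  ∑ᶠ K : G.Component s, G.componentGenus s K

end Boundary

section Moves

/-- The data of an `R`-move from `G` to `G'`: a pair of cancelling chords is created between an
arc of `M⁺` and an arc of `M⁻`, whose chosen sides lie on cycles of the same color. -/
structure RMove (G G' : DecoratedGaussDiagram) where
  /-- the two arcs `e⁺` and `e⁻` -/
  arc : ∀ s, G.Arc s
  /-- the sides of these arcs that meet -/
  side : Family → Side
  same_color : G.col .plus (arc .plus) (side .plus) = G.col .minus (arc .minus) (side .minus)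
  circle : ∀ s, G.Circ s ≃ G'.Circ s
  /-- the chords of `G`, as chords of `G'` -/
  old : G.Chord → G'.Chord
  /-- the two new chords; `new 1` is positive and `new (-1)` is negative -/
  new : ℤˣ → G'.Chord
  chords : Function.Bijective (Sum.elim old new)
  sign_old : ∀ x, G'.sign (old x) = G.sign x
  sign_new : ∀ ε, G'.sign (new ε) = ε
  circ_old : ∀ s x, G'.circ s (old x) = circle s (G.circ s x)
  circ_new : ∀ s ε, G'.circ s (new ε) = circle s (G.arcCirc s (arc s))
  /-- the first of the two new chords along the arc `arc s` -/
  fst : Family → G'.Chord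
  /-- the second of the two new chords along the arc `arc s` -/
  snd : Family → G'.Chord
  /-- The order of the new chords.  On `e⁺`, the negative chord comes first if the right side of
  `e⁻` takes part, and second otherwise; on `e⁻`, the positive chord comes first if the right side
  of `e⁺` takes part, and second otherwise. -/
  fst_eq : ∀ s, fst s = new (-(s.sgn * (side s.other).sgn))
  snd_eq : ∀ s, snd s = new (s.sgn * (side s.other).sgn)
  next_fst : ∀ s, G'.next s (fst s) = snd s
  next_snd : ∀ s, G'.next s (snd s) =
    match arc s with
    | .inl x => old (G.next s x)
    | .inr _ => fst s
  next_arc : ∀ s x, arc s = .inl x → G'.next s (old x) = fst s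
  next_old : ∀ s x, arc s ≠ .inl x → G'.next s (old x) = old (G.next s x)
  /-- sends a color of `G'` to the color of `G` it comes from, and the new color to `none` -/
  colorMap : G'.Color → Option G.Color
  /-- The cycle between the two middle edges is the only one that has the new color. -/
  color_new : ∀ z : G'.Cycle, colorMap (G'.color z) = none ↔
    z = G'.cycle .plus (.inl (fst .plus)) (side .plus).opp
  color_old : ∀ s x k, colorMap (G'.col s (.inl (old x)) k) = some (G.col s (.inl x) k)
  color_snd : ∀ s k, colorMap (G'.col s (.inl (snd s)) k) = some (G.col s (arc s) k)
  color_free : ∀ s (μ : G.FreeCircle s) (ν : G'.FreeCircle s) k, ν.1 = circle s μ.1 →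
    colorMap (G'.col s (.inr ν) k) = some (G.col s (.inr μ) k)
  /-- If the chosen sides lie on one cycle, its color is replaced by two colors; in all other
  cases the old colors persist. -/
  color_count : ∀ c : G.Color,
    (G.cycle .plus (arc .plus) (side .plus) = G.cycle .minus (arc .minus) (side .minus) ∧
        c = G.col .plus (arc .plus) (side .plus) →
      Nat.card {c' : G'.Color // colorMap c' = some c} = 2) ∧
    (¬(G.cycle .plus (arc .plus) (side .plus) = G.cycle .minus (arc .minus) (side .minus) ∧
        c = G.col .plus (arc .plus) (side .plus)) →
      Nat.card {c' : G'.Color // colorMap c' = some c} = 1)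
  /-- If the chosen sides lie on one cycle, the two cycles into which it is cut, one containing
  the first and the other one the third part of `e⁺`, have different colors. -/
  color_split :
    G.cycle .plus (arc .plus) (side .plus) = G.cycle .minus (arc .minus) (side .minus) →
    ∀ x, arc .plus = .inl x →
      G'.col .plus (.inl (old x)) (side .plus) ≠ G'.col .plus (.inl (snd .plus)) (side .plus)

/-- During a handle slide along the circle `μ`, the slid circle receives a parallel copy of `μ`.
The copy runs in the direction of `μ` if and only if the band joins equal sides of the two
circles.  This is the order in which the copies of the chords of `μ` are met. -/
def slideStep (G : DecoratedGaussDiagram) (s : Family) (μ : G.Circ s) (j i : Side) :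
    Equiv.Perm (G.OnCircle s μ) :=
  if j = i then G.nextOn s μ else (G.nextOn s μ)⁻¹

/-- If the copy of `μ` is cut open along the edge from `x` to the next chord of `μ`, the copy of
this chord is the last one that is met. -/
def slideLast (G : DecoratedGaussDiagram) (s : Family) (μ : G.Circ s) (j i : Side)
    (x : G.OnCircle s μ) : G.OnCircle s μ :=
  if j = i then x else G.nextOn s μ x

open Classical in
/-- The copy of `μ` is pushed off to the side `i` of `μ`.  The crossing of `μ` at the chord `x`
thus becomes a pair of crossings on the curve of the other family.  This is the first of the two
(or `x` itself, if `x` does not end on `μ`). -/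
noncomputable def pairFst (G : DecoratedGaussDiagram) {X : Type} (s : Family) (μ : G.Circ s)
    (i : Side) (old : G.Chord → X) (copy : G.OnCircle s μ → X) (x : G.Chord) : X :=
  if h : G.circ s x = μ ∧ s.sgn * G.sign x * i.sgn = 1 then copy ⟨x, h.1⟩ else old x

open Classical in
/-- The second of the two crossings described for `pairFst`. -/
noncomputable def pairSnd (G : DecoratedGaussDiagram) {X : Type} (s : Family) (μ : G.Circ s)
    (i : Side) (old : G.Chord → X) (copy : G.OnCircle s μ → X) (x : G.Chord) : X :=
  if h : G.circ s x = μ ∧ s.sgn * G.sign x * i.sgn = -1 then copy ⟨x, h.1⟩ else old x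

/-- The data of an `H`-move from `G` to `G'`: a circle slides along another circle `μ` of the same
family.  The band joins the side `slidSide` of the arc `slid` of the first circle to the side
`baseSide` of the arc `base` of `μ`; these sides lie on cycles of the same color. -/
structure HMove (G G' : DecoratedGaussDiagram) where
  /-- the family in which the slide takes place -/
  s : Family
  slid : G.Arc s
  slidSide : Side
  base : G.Arc s
  baseSide : Side
  /-- the circle along which one slides -/
  μ : G.Circ s
  base_circ : G.arcCirc s base = μ
  slid_circ : G.arcCirc s slid ≠ μ
  same_color : G.col s slid slidSide = G.col s base baseSide
  circle : ∀ t, G.Circ t ≃ G'.Circ t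
  /-- the chords of `G`, as chords of `G'` -/
  old : G.Chord → G'.Chord
  /-- the copies of the chords that end on `μ` -/
  copy : G.OnCircle s μ → G'.Chord
  chords : Function.Bijective (Sum.elim old copy)
  sign_old : ∀ x, G'.sign (old x) = G.sign x
  sign_copy : ∀ x : G.OnCircle s μ,
    G'.sign (copy x) = if slidSide = baseSide then G.sign x.1 else -G.sign x.1
  circ_old : ∀ t x, G'.circ t (old x) = circle t (G.circ t x)
  circ_copy : ∀ x, G'.circ s (copy x) = circle s (G.arcCirc s slid)
  circ_copy_other : ∀ x : G.OnCircle s μ,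
    G'.circ s.other (copy x) = circle s.other (G.circ s.other x.1)
  /-- the order of the chords on the circles of the family `s`: the copies of the chords of `μ`
  are inserted in the arc `slid`, in the order given by `slideStep` -/
  next_old : ∀ z, (∀ u : G.OnCircle s μ, base = .inl u.1 → slid ≠ .inl z) →
    G'.next s (old z) = old (G.next s z)
  next_copy : ∀ x,
    (∀ u : G.OnCircle s μ, ∀ z, base = .inl u.1 → slid = .inl z →
      x ≠ G.slideLast s μ slidSide baseSide u) →
    G'.next s (copy x) = copy (G.slideStep s μ slidSide baseSide x)
  next_slid : ∀ u : G.OnCircle s μ, ∀ z, base = .inl u.1 → slid = .inl z →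
    G'.next s (old z) =
      copy (G.slideStep s μ slidSide baseSide (G.slideLast s μ slidSide baseSide u))
  next_last : ∀ u : G.OnCircle s μ, ∀ z, base = .inl u.1 → slid = .inl z →
    G'.next s (copy (G.slideLast s μ slidSide baseSide u)) = old (G.next s z)
  /-- the order of the chords on the circles of the other family: the copy of a chord of `μ` is
  next to this chord -/
  next_pair : ∀ x : G.OnCircle s μ,
    G'.next s.other (G.pairFst s μ baseSide old copy x.1) = G.pairSnd s μ baseSide old copy x.1
  next_link : ∀ x : G.Chord,
    G'.next s.other (G.pairSnd s μ baseSide old copy x) =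
      G.pairFst s μ baseSide old copy (G.next s.other x)
  /-- sends a color of `G'` to the color of `G` it comes from, and the new colors to `none` -/
  colorMap : G'.Color → Option G.Color
  /-- The cycles with new colors are the small cycles between the edges of `μ`, save `base`, and
  their copies. -/
  color_new : ∀ z : G'.Cycle, colorMap (G'.color z) = none ↔
    ∃ x : G.OnCircle s μ, base ≠ .inl x.1 ∧ z = G'.cycle s (.inl (old x.1)) baseSide
  /-- Each of the small cycles has a separate color. -/
  color_new_inj : ∀ z z' : G'.Cycle, colorMap (G'.color z) = none → G'.color z = G'.color z' →
    z = z'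
  color_old : ∀ x k, ¬(G.circ s x = μ ∧ k = baseSide) →
    colorMap (G'.col s (.inl (old x)) k) = some (G.col s (.inl x) k)
  color_old_other : ∀ x k,
    colorMap (G'.col s.other (.inl (G.pairSnd s μ baseSide old copy x)) k) =
      some (G.col s.other (.inl x) k)
  color_free : ∀ (m : G.FreeCircle s) (ν : G'.FreeCircle s) k, ν.1 = circle s m.1 →
    ¬(m.1 = μ ∧ k = baseSide) → colorMap (G'.col s (.inr ν) k) = some (G.col s (.inr m) k)
  color_free_other : ∀ (m : G.FreeCircle s.other) (ν : G'.FreeCircle s.other) k,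
    ν.1 = circle s.other m.1 →
    colorMap (G'.col s.other (.inr ν) k) = some (G.col s.other (.inr m) k)
  /-- The chosen side of `base` receives the color from the far side of `slid`. -/
  color_base : ∀ u : G.OnCircle s μ, base = .inl u.1 →
    colorMap (G'.col s (.inl (old u.1)) baseSide) = some (G.col s slid slidSide.opp)
  color_base_free : ∀ ν : G'.FreeCircle s, ν.1 = circle s μ →
    colorMap (G'.col s (.inr ν) baseSide) = some (G.col s slid slidSide.opp)
  /-- The outer side of the copy of an edge of `μ` has the color of the edge.  The copy of `base`
  is the part of `slid` that follows the inserted chords. -/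
  color_copy : ∀ x : G.OnCircle s μ,
    colorMap (G'.col s (.inl (copy (G.slideLast s μ slidSide baseSide x))) slidSide) =
      some (G.col s (.inl x.1) baseSide)
  color_slid_far : ∀ u : G.OnCircle s μ, base = .inl u.1 →
    colorMap (G'.col s (.inl (copy (G.slideLast s μ slidSide baseSide u))) slidSide.opp) =
      some (G.col s slid slidSide.opp)
  /-- If the band joins a cycle to itself, its color is replaced by two colors; in all other cases
  the old colors persist. -/
  color_count : ∀ c : G.Color,
    (G.cycle s slid slidSide = G.cycle s base baseSide ∧ c = G.col s slid slidSide →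
      Nat.card {c' : G'.Color // colorMap c' = some c} = 2) ∧
    (¬(G.cycle s slid slidSide = G.cycle s base baseSide ∧ c = G.col s slid slidSide) →
      Nat.card {c' : G'.Color // colorMap c' = some c} = 1)
  /-- If the band joins a cycle to itself, the two cycles into which it is cut, each containing
  one of the two remaining parts of `slid`, have different colors. -/
  color_split : G.cycle s slid slidSide = G.cycle s base baseSide →
    ∀ (u : G.OnCircle s μ) (z : G.Chord), base = .inl u.1 → slid = .inl z →
      G'.col s (.inl (old z)) slidSide ≠
        G'.col s (.inl (copy (G.slideLast s μ slidSide baseSide u))) slidSide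

/-- The data of an `S`-move (stabilization) from `G` to `G'`: each family gets one more circle, the
two new circles are joined to each other by one chord of arbitrary sign and to nothing else, and
the single cycle that they produce has one of the existing colors. -/
structure SMove (G G' : DecoratedGaussDiagram) where
  /-- the existing color given to the new cycle -/
  c : G.Color
  /-- `none` stands for the new circle -/
  circle : ∀ s, Option (G.Circ s) ≃ G'.Circ s
  /-- `none` stands for the new chord -/
  chord : Option G.Chord ≃ G'.Chord
  colors : G.Color ≃ G'.Color
  sign_old : ∀ x, G'.sign (chord (some x)) = G.sign x
  circ_old : ∀ s x, G'.circ s (chord (some x)) = circle s (some (G.circ s x))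
  circ_new : ∀ s, G'.circ s (chord none) = circle s none
  next_old : ∀ s x, G'.next s (chord (some x)) = chord (some (G.next s x))
  color_old : ∀ s x k, G'.col s (.inl (chord (some x))) k = colors (G.col s (.inl x) k)
  color_free : ∀ s (μ : G.FreeCircle s) (ν : G'.FreeCircle s) k, ν.1 = circle s (some μ.1) →
    G'.col s (.inr ν) k = colors (G.col s (.inr μ) k)
  color_new : ∀ s k, G'.col s (.inl (chord none)) k = colors c

/-- The data of a `B`-move (bubble move) from `G` to `G'`: one of the families gets one more circle,
without chords; one of its two cycles has a new color and the other one an existing color. -/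
structure BMove (G G' : DecoratedGaussDiagram) where
  /-- the family of the bubble -/
  s : Family
  /-- the side of the bubble that gets the new color -/
  side : Side
  /-- the existing color given to the other side -/
  c : G.Color
  /-- `none` stands for the bubble -/
  circle : Option (G.Circ s) ≃ G'.Circ s
  circleOther : G.Circ s.other ≃ G'.Circ s.other
  chord : G.Chord ≃ G'.Chord
  /-- `none` stands for the new color -/
  colors : Option G.Color ≃ G'.Color
  sign_old : ∀ x, G'.sign (chord x) = G.sign x
  circ_old : ∀ x, G'.circ s (chord x) = circle (some (G.circ s x))
  circ_old_other : ∀ x, G'.circ s.other (chord x) = circleOther (G.circ s.other x)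
  next_old : ∀ t x, G'.next t (chord x) = chord (G.next t x)
  color_old : ∀ t x k, G'.col t (.inl (chord x)) k = colors (some (G.col t (.inl x) k))
  color_free : ∀ (μ : G.FreeCircle s) (ν : G'.FreeCircle s) k, ν.1 = circle (some μ.1) →
    G'.col s (.inr ν) k = colors (some (G.col s (.inr μ) k))
  color_free_other : ∀ (μ : G.FreeCircle s.other) (ν : G'.FreeCircle s.other) k,
    ν.1 = circleOther μ.1 → G'.col s.other (.inr ν) k = colors (some (G.col s.other (.inr μ) k))
  color_bubble_new : ∀ ν : G'.FreeCircle s, ν.1 = circle none →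
    G'.col s (.inr ν) side = colors none
  color_bubble_old : ∀ ν : G'.FreeCircle s, ν.1 = circle none →
    G'.col s (.inr ν) side.opp = colors (some c)

/-- `G'` is obtained from `G` by an `R`-, `H`-, `S`- or `B`-move (up to renaming the circles, the
chords and the colors of `G'`). -/
def Move (G G' : DecoratedGaussDiagram) : Prop :=
  Nonempty (RMove G G') ∨ Nonempty (HMove G G') ∨ Nonempty (SMove G G') ∨ Nonempty (BMove G G')

/-- Two diagrams are equivalent if one can be obtained from the other by a finite sequence of
`R`-, `H`-, `S`- and `B`-moves and their opposites. -/
def Equivalent (G G' : DecoratedGaussDiagram) : Prop := Relation.EqvGen Move G G'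

end Moves

end DecoratedGaussDiagram

/-! ### Counting -/

/-! The surface left by surgery is cut into pieces, and additivity of the Euler characteristic turns
the sum of the genera into a count (`DecoratedGaussDiagram.boundaryGenus_eq`): components - colors +
(cycles + chords)/2 - circles of the family. It suffices to follow these numbers through each move.

An R-move adds 2 chords. It adds 1 color and no cycle if the chosen sides lie on different cycles,
and 2 colors and 2 cycles otherwise. An H-move along a circle with n > 0 chords adds n chords. It
adds n - 1 colors and n - 2 cycles if the band joins different cycles, and n of each otherwise; for
n = 0 no count changes. In these cases the number of components is constant. An S-move adds a chord,
a cycle and a circle to each family. A B-move adds a circle, two cycles and a color; surgery along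
the family of the bubble splits off one more sphere, while for the other family the components
persist. In every case the sum does not change.

Two counts need an argument. Cycles: following boundary curves through a move would require global
case distinctions. Instead the two cycles at the ends of the band are identified before the move,
and the two cycles along it after the move. The quotients then correspond up to an explicit set of
small new cycles (`RMove.card_glued'`, `HMove.exists_glued_equiv`). Each identification loses at
most one cycle, so the change is known up to one unit, and parity decides
(`GaussDiagram.card_cycle_mod_two`): the turn rule permutes an even number of sides with sign
(-1)^chords, hence cycles and chords have equal parity. This parity is that of the Euler
characteristic of a closed oriented surface.

Components: they are classes of colors under crossing arcs of the other family and moving along one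
side of a circle of the surgered family (`card_component`). The colors into which an old color
splits stay in one class (`class_eq_of_colorMap_eq`), and each new region created by an R- or H-move
can be reached from an old one. Thus maps between colors in both directions descend to inverse
bijections of classes. -/

theorem Quot.mk_perm_eq_iff {α : Type*} [Finite α] (σ : Equiv.Perm α) (x y : α) :
    Quot.mk (fun x y => σ x = y) x = Quot.mk _ y ↔ σ.SameCycle x y := by
  constructor
  · intro h
    have h' := Quot.eqvGen_exact h
    clear h
    induction h' with
    | rel a b hab => exact hab ▸ (Equiv.Perm.sameCycle_apply_right.2 (.refl σ a))
    | refl a => exact .refl σ a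
    | symm a b _ ih => exact ih.symm
    | trans a b c _ _ ih1 ih2 => exact ih1.trans ih2
  · intro h
    obtain ⟨n, -, rfl⟩ := h.exists_pow_eq'
    clear h
    induction n with
    | zero => rfl
    | succ n ih => rw [ih, pow_succ', Equiv.Perm.mul_apply]; exact Quot.sound rfl

/-- The parity of the number of orbits of a permutation. -/
theorem neg_one_pow_card_orbits {α : Type*} [Fintype α] [DecidableEq α] (σ : Equiv.Perm α) :
    (-1 : ℤˣ) ^ Nat.card (Quot fun x y => σ x = y) =
      Equiv.Perm.sign σ * (-1) ^ Fintype.card α := by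
  classical
  -- An orbit is either a nontrivial cycle factor of `σ` or a fixed point.
  let g : α → ↥σ.cycleFactorsFinset ⊕ Function.fixedPoints σ := fun x =>
    if h : σ x = x then .inr ⟨x, h⟩
    else .inl ⟨σ.cycleOf x, Equiv.Perm.cycleOf_mem_cycleFactorsFinset_iff.2
      (Equiv.Perm.mem_support.2 h)⟩
  have hg : ∀ x y, g x = g y ↔ σ.SameCycle x y := by
    intro x y
    by_cases hx : σ x = x <;> by_cases hy : σ y = y
    · simp only [g, hx, hy, dif_pos, Sum.inr.injEq]
      exact ⟨fun h => (congrArg Subtype.val h).sameCycle σ,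
        fun h => Subtype.ext (h.eq_of_left hx)⟩
    · simp only [g, hx, hy, dif_pos, dif_neg, not_false_eq_true, reduceCtorEq, false_iff]
      exact fun h => hy (h.apply_eq_self_iff.1 hx)
    · simp only [g, hx, hy, dif_pos, dif_neg, not_false_eq_true, reduceCtorEq, false_iff]
      exact fun h => hx (h.apply_eq_self_iff.2 hy)
    · simp only [g, hx, hy, dif_neg, not_false_eq_true, Sum.inl.injEq, Subtype.mk.injEq]
      exact (Equiv.Perm.sameCycle_iff_cycleOf_eq_of_mem_support (Equiv.Perm.mem_support.2 hx)
        (Equiv.Perm.mem_support.2 hy)).symm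
  have hbij : Function.Bijective
      (Quot.lift g (fun x y h => (hg x y).2 (h ▸ Equiv.Perm.sameCycle_apply_right.2 (.refl σ x))) :
        (Quot fun x y => σ x = y) → _) := by
    constructor
    · rintro ⟨x⟩ ⟨y⟩ h
      exact (Quot.mk_perm_eq_iff σ x y).2 ((hg x y).1 h)
    · rintro (⟨c, hc⟩ | ⟨x, hx⟩)
      · obtain ⟨x, hx⟩ := (Equiv.Perm.mem_cycleFactorsFinset_iff.1 hc).1.nonempty_support
        refine ⟨Quot.mk _ x, ?_⟩
        have hx' : σ x ≠ x :=
          Equiv.Perm.mem_support.1 (Equiv.Perm.mem_cycleFactorsFinset_support_le hc hx)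
        simp only [g, hx', dif_neg, not_false_eq_true, Sum.inl.injEq, Subtype.mk.injEq]
        exact (Equiv.Perm.cycle_is_cycleOf hx hc).symm
      · exact ⟨Quot.mk _ x, dif_pos hx⟩
  rw [Nat.card_congr (Equiv.ofBijective _ hbij), Nat.card_sum, Nat.card_eq_fintype_card,
    Nat.card_eq_fintype_card, Equiv.Perm.sign_of_cycleType, Equiv.Perm.card_fixedPoints,
    Equiv.Perm.sum_cycleType, Fintype.card_coe]
  have h1 : Multiset.card σ.cycleType = σ.cycleFactorsFinset.card := by
    rw [Equiv.Perm.cycleType_def, Multiset.card_map]; rfl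
  have h2 := σ.sum_cycleType_le
  rw [Equiv.Perm.sum_cycleType] at h2
  -- Here `m` is the number of fixed points; the exponents on the two sides differ by twice the size
  -- of the support.
  obtain ⟨m, hm⟩ := Nat.exists_eq_add_of_le h2
  rw [h1, hm, Nat.add_sub_cancel_left, ← pow_add, show σ.support.card + σ.cycleFactorsFinset.card +
    (σ.support.card + m) = 2 * σ.support.card + (σ.cycleFactorsFinset.card + m) by ring,
    pow_add _ (2 * _), pow_mul]
  simp

/-- The quotient of a type by the identification of two elements. -/
abbrev Glue {X : Type*} (a b : X) : Type _ := Quot fun x y : X => x = a ∧ y = b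

theorem Glue.mk_eq_iff {X : Type*} {a b x y : X} :
    (Quot.mk _ x : Glue a b) = Quot.mk _ y ↔ x = y ∨ (x = a ∧ y = b) ∨ (x = b ∧ y = a) := by
  constructor
  · intro h
    have h' := Quot.eqvGen_exact h
    clear h
    induction h' <;> grind
  · rintro (rfl | ⟨rfl, rfl⟩ | ⟨rfl, rfl⟩)
    · rfl
    · exact Quot.sound ⟨rfl, rfl⟩
    · exact (Quot.sound ⟨rfl, rfl⟩).symm

-- An identification loses one element, or none if the two were already equal. This is the unit that
-- parity later decides.
open Classical in
theorem Glue.card {X : Type*} [Finite X] (a b : X) :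
    Nat.card X = Nat.card (Glue a b) + if a = b then 0 else 1 := by
  split_ifs with h
  · subst h
    refine Nat.card_congr (Equiv.ofBijective (Quot.mk _) ⟨fun x y hxy => ?_, Quot.mk_surjective⟩)
    have := Glue.mk_eq_iff.1 hxy
    grind
  · have : Function.Bijective fun x : {x // x ≠ a} => (Quot.mk _ x.1 : Glue a b) := by
      constructor
      · intro x y hxy
        have := Glue.mk_eq_iff.1 hxy
        have := x.2
        have := y.2
        grind
      · rintro ⟨x⟩
        by_cases hx : x = a
        · exact ⟨⟨b, Ne.symm h⟩, by subst hx; exact (Quot.sound ⟨rfl, rfl⟩).symm⟩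
        · exact ⟨⟨x, hx⟩, rfl⟩
    rw [← Nat.card_congr (Equiv.ofBijective _ this)]
    have := Nat.card_congr (Equiv.optionSubtypeNe a)
    rw [← this, Finite.card_option]

/-- Counting a type through the fibers of a map. -/
theorem Nat.card_eq_sum_card_fiber {X Y : Type*} [Finite X] [Fintype Y] (f : X → Y) :
    Nat.card X = ∑ y, Nat.card {x // f x = y} := by
  rw [← Nat.card_sigma, Nat.card_congr (Equiv.sigmaFiberEquiv f)]

/-- Both maps take representatives to classes, so that no choice of representative in the target has
to be compatible with anything. -/
theorem Nat.card_congr_of_quot {X Y : Type*} {r : X → X → Prop} {r' : Y → Y → Prop}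
    (g : Y → Quot r) (h : X → Quot r') (hg : ∀ y y', r' y y' → g y = g y')
    (hh : ∀ x x', r x x' → h x = h x')
    (hgh : ∀ x, Quot.lift g hg (h x) = Quot.mk _ x)
    (hhg : ∀ y, Quot.lift h hh (g y) = Quot.mk _ y) : Nat.card (Quot r) = Nat.card (Quot r') :=
  Nat.card_congr ⟨Quot.lift h hh, Quot.lift g hg, by rintro ⟨x⟩; exact hgh x,
    by rintro ⟨y⟩; exact hhg y⟩

theorem eq_of_card_subtype_eq_one {X : Type*} {P : X → Prop} (h : Nat.card {x // P x} = 1)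
    {a b : X} (ha : P a) (hb : P b) : a = b := by
  have := (Nat.card_eq_one_iff_unique.1 h).1
  exact congrArg Subtype.val (Subsingleton.elim (⟨a, ha⟩ : {x // P x}) ⟨b, hb⟩)

theorem eq_or_eq_of_card_subtype_eq_two {X : Type*} {P : X → Prop}
    (h : Nat.card {x // P x} = 2) {a b d : X} (ha : P a) (hb : P b) (hab : a ≠ b) (hd : P d) :
    d = a ∨ d = b := by
  obtain ⟨y, -, hy⟩ := (Nat.card_eq_two_iff' ⟨a, ha⟩).1 h
  by_cases hda : d = a
  · exact .inl hda
  · have e1 := hy ⟨d, hd⟩ fun h => hda (congrArg Subtype.val h)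
    have e2 := hy ⟨b, hb⟩ fun h => hab (congrArg Subtype.val h).symm
    exact .inr (congrArg Subtype.val (e1.trans e2.symm))

/-! ### Signs of sides and families -/

theorem Side.sgn_opp (k : Side) : k.opp.sgn = -k.sgn := by cases k <;> rfl

theorem Side.opp_ne (k : Side) : k.opp ≠ k := by cases k <;> decide

theorem Side.ne_iff (k l : Side) : k ≠ l ↔ k = l.opp := by cases k <;> cases l <;> decide

theorem Family.sgn_other (s : Family) : s.other.sgn = -s.sgn := by cases s <;> rfl

theorem Family.other_ne (s : Family) : s.other ≠ s := by cases s <;> decide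

theorem Family.ne_iff (s t : Family) : t ≠ s ↔ t = s.other := by cases s <;> cases t <;> decide

theorem Family.eq_or_eq_other (s t : Family) : t = s ∨ t = s.other := by
  cases s <;> cases t <;> decide

namespace GaussDiagram

variable (G : GaussDiagram)

/-! ### The parity of the number of cycles -/

section Parity

/-- The turn from an incoming (`right`) or outgoing (`left`) half of a circle of one family at a
chord of sign `ε` to a half of a circle of the other family. -/
def turnAt (ε : ℤˣ) : Equiv.Perm (Family × Side) where
  toFun a := (a.1.other, if a.1.sgn * ε * a.2.sgn = 1 then .left else .right)
  invFun a := (a.1.other, if a.1.sgn * ε * a.2.sgn = 1 then .right else .left)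
  left_inv := by revert ε; decide
  right_inv := by revert ε; decide

/-- The turn changes the family, so it has no fixed point on the four half-strands at a crossing; it
is a 4-cycle, hence odd. -/
theorem sign_turnAt (ε : ℤˣ) : Equiv.Perm.sign (turnAt ε) = -1 := by
  revert ε; decide

/-- The turn rule on the sides of the arcs between chords. -/
def turnChord : Equiv.Perm (G.Chord × (Family × Side)) :=
  -- From the last factor to the first: pass to the chord of arrival, turn there, and rename the new
  -- arc by the chord at which it starts.
  Equiv.prodCongrLeft (fun b => if b.2 = .left then (G.next b.1)⁻¹ else 1) *
  Equiv.prodCongrRight (fun p => turnAt (G.sign p)) *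
  Equiv.prodCongrLeft (fun b => if b.2 = .right then G.next b.1 else 1)

/-- The two relabelings use `next` once for each family on the right sides and its inverse once for
each family on the left sides, so their signs cancel. What remains is one odd turn for each chord.
-/
theorem sign_turnChord [Fintype G.Chord] [DecidableEq G.Chord] :
    Equiv.Perm.sign G.turnChord = (-1) ^ Fintype.card G.Chord := by
  simp only [turnChord, Equiv.Perm.sign_mul, Equiv.Perm.sign_prodCongrLeft,
    Equiv.Perm.sign_prodCongrRight, sign_turnAt, Finset.prod_const, Finset.card_univ,
    Fintype.prod_prod_type]
  have h : ∀ f : Family → Side → ℤˣ, ∏ s, ∏ k, f s k =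
      f .plus .right * f .plus .left * (f .minus .right * f .minus .left) := fun f => by
    simp [Finset.univ, Fintype.elems]
  simp only [h]
  simp only [if_true, reduceCtorEq, if_false, Equiv.Perm.sign_inv, Equiv.Perm.sign_one, one_mul,
    mul_one]
  rw [mul_right_comm, Int.units_mul_self, one_mul]

/-- The sides of the arcs, sorted by whether the arc has chords. -/
def dartEquiv : (G.Chord × (Family × Side)) ⊕ (Σ s, G.FreeCircle s × Side) ≃ G.Dart where
  toFun
    | .inl (x, s, k) => ⟨s, .inl x, k⟩
    | .inr ⟨s, μ, k⟩ => ⟨s, .inr μ, k⟩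
  invFun
    | ⟨s, .inl x, k⟩ => .inl (x, s, k)
    | ⟨s, .inr μ, k⟩ => .inr ⟨s, μ, k⟩
  left_inv := by rintro (⟨x, s, k⟩ | ⟨s, μ, k⟩) <;> rfl
  right_inv := by rintro ⟨s, x | μ, k⟩ <;> rfl

/-- The turn rule as a permutation. -/
def turnPerm : Equiv.Perm G.Dart :=
  G.dartEquiv.permCongr (Equiv.Perm.sumCongr G.turnChord 1)

theorem turnPerm_apply (d : G.Dart) : G.turnPerm d = G.turn d := by
  obtain ⟨s, x | μ, k⟩ := d
  · cases k <;>
    · simp only [turnPerm, turnChord, Equiv.permCongr_apply, dartEquiv, turn, Equiv.coe_fn_symm_mk,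
        Equiv.coe_fn_mk, Equiv.Perm.sumCongr_apply, Sum.map_inl, Equiv.Perm.mul_apply,
        Equiv.prodCongrLeft_apply, Equiv.prodCongrRight_apply, turnAt, if_true,
        reduceCtorEq, if_false, Equiv.Perm.one_apply]
      split_ifs <;> first | rfl | (exfalso; simp_all)
  · rfl

/-- The numbers of cycles and of chords have the same parity. -/
theorem neg_one_pow_card_cycle :
    (-1 : ℤˣ) ^ Nat.card G.Cycle = (-1) ^ Nat.card G.Chord := by
  classical
  have := Fintype.ofFinite G.Chord
  have := fun s => Fintype.ofFinite (G.FreeCircle s)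
  have h1 : G.Cycle = Quot fun d d' : G.Dart => G.turnPerm d = d' := by
    simp only [turnPerm_apply]; rfl
  -- Every arc has two sides, so the number of sides is even and does not affect the parity.
  have h2 : Fintype.card G.Dart = 2 * ∑ s, Fintype.card (G.Arc s) := by
    rw [Fintype.card_sigma, Finset.mul_sum]
    refine Finset.sum_congr rfl fun s _ => ?_
    rw [Fintype.card_prod, mul_comm]; rfl
  rw [h1, neg_one_pow_card_orbits, h2, pow_mul, Int.units_sq, one_pow, mul_one, turnPerm,
    Equiv.Perm.sign_permCongr, Equiv.Perm.sign_sumCongr, sign_turnChord, Equiv.Perm.sign_one,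
    mul_one, Nat.card_eq_fintype_card]

theorem card_cycle_mod_two : Nat.card G.Cycle % 2 = Nat.card G.Chord % 2 := by
  have h := G.neg_one_pow_card_cycle
  rcases Nat.even_or_odd (Nat.card G.Cycle) with h1 | h1 <;>
  rcases Nat.even_or_odd (Nat.card G.Chord) with h2 | h2 <;>
  rw [h1.neg_one_pow, h2.neg_one_pow] at h <;>
  first | exact absurd h (by decide) | skip
  · rw [Nat.even_iff.1 h1, Nat.even_iff.1 h2]
  · rw [Nat.odd_iff.1 h1, Nat.odd_iff.1 h2]

end Parity

/-! ### Cycles as classes of corners -/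

section Corner

/-- The arc of the family `s` leaving (`ε = 1`) or entering (`ε = -1`) the chord `p`. -/
def arcAt (s : Family) (p : G.Chord) (ε : ℤˣ) : G.Chord :=
  if ε = 1 then p else (G.next s).symm p

theorem arcAt_one (s : Family) (p : G.Chord) : G.arcAt s p 1 = p := rfl

theorem arcAt_neg_one (s : Family) (p : G.Chord) : G.arcAt s p (-1) = (G.next s).symm p := rfl

theorem circ_symm (s : Family) (p : G.Chord) : G.circ s ((G.next s).symm p) = G.circ s p := by
  rw [← G.circ_next s, Equiv.apply_symm_apply]

theorem circ_arcAt (s : Family) (p : G.Chord) (ε : ℤˣ) : G.circ s (G.arcAt s p ε) = G.circ s p := by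
  unfold arcAt
  split_ifs
  · rfl
  · exact G.circ_symm s p

/-- The two sides of strands that meet in a corner are consecutive on the boundary; which of them
comes first depends on the direction of travel. -/
theorem turn_corner (p : G.Chord) (i j : Side) :
    G.turn ⟨.plus, .inl (G.arcAt .plus p (G.sign p * j.sgn)), i⟩ =
        ⟨.minus, .inl (G.arcAt .minus p (-G.sign p * i.sgn)), j⟩ ∨
      G.turn ⟨.minus, .inl (G.arcAt .minus p (-G.sign p * i.sgn)), j⟩ =
        ⟨.plus, .inl (G.arcAt .plus p (G.sign p * j.sgn)), i⟩ := by
  rcases Int.units_eq_one_or (G.sign p) with h | h <;> cases i <;> cases j <;>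
    simp [turn, arcAt, Family.sgn, Family.other, Side.sgn, h]

/-- Conversely, every turn at a chord is the turn around one of its four corners. -/
theorem turn_inl (t : Family) (x : G.Chord) (k : Side) : ∃ p i j,
    (⟨t, .inl x, k⟩ = (⟨.plus, .inl (G.arcAt .plus p (G.sign p * j.sgn)), i⟩ : G.Dart) ∧
      G.turn ⟨t, .inl x, k⟩ = ⟨.minus, .inl (G.arcAt .minus p (-G.sign p * i.sgn)), j⟩) ∨
    (⟨t, .inl x, k⟩ = (⟨.minus, .inl (G.arcAt .minus p (-G.sign p * i.sgn)), j⟩ : G.Dart) ∧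
      G.turn ⟨t, .inl x, k⟩ = ⟨.plus, .inl (G.arcAt .plus p (G.sign p * j.sgn)), i⟩) := by
  have key : ∀ p : G.Chord, p = (match k with | .right => G.next t x | .left => x) → ∃ i j,
    (⟨t, .inl x, k⟩ = (⟨.plus, .inl (G.arcAt .plus p (G.sign p * j.sgn)), i⟩ : G.Dart) ∧
      G.turn ⟨t, .inl x, k⟩ = ⟨.minus, .inl (G.arcAt .minus p (-G.sign p * i.sgn)), j⟩) ∨
    (⟨t, .inl x, k⟩ = (⟨.minus, .inl (G.arcAt .minus p (-G.sign p * i.sgn)), j⟩ : G.Dart) ∧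
      G.turn ⟨t, .inl x, k⟩ = ⟨.plus, .inl (G.arcAt .plus p (G.sign p * j.sgn)), i⟩) := by
    rintro p rfl
    cases t
    · refine ⟨k, ?_⟩
      cases k <;> simp only
      · rcases Int.units_eq_one_or (G.sign (G.next .plus x)) with h | h
        · exact ⟨.left, by simp [turn, arcAt, Family.sgn, Family.other, Side.sgn, h]⟩
        · exact ⟨.right, by simp [turn, arcAt, Family.sgn, Family.other, Side.sgn, h]⟩
      · rcases Int.units_eq_one_or (G.sign x) with h | h
        · exact ⟨.right, by simp [turn, arcAt, Family.sgn, Family.other, Side.sgn, h]⟩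
        · exact ⟨.left, by simp [turn, arcAt, Family.sgn, Family.other, Side.sgn, h]⟩
    · rw [exists_comm]
      refine ⟨k, ?_⟩
      cases k <;> simp only
      · rcases Int.units_eq_one_or (G.sign (G.next .minus x)) with h | h
        · exact ⟨.right, by simp [turn, arcAt, Family.sgn, Family.other, Side.sgn, h]⟩
        · exact ⟨.left, by simp [turn, arcAt, Family.sgn, Family.other, Side.sgn, h]⟩
      · rcases Int.units_eq_one_or (G.sign x) with h | h
        · exact ⟨.left, by simp [turn, arcAt, Family.sgn, Family.other, Side.sgn, h]⟩
        · exact ⟨.right, by simp [turn, arcAt, Family.sgn, Family.other, Side.sgn, h]⟩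
  exact ⟨_, key _ rfl⟩

/-- At each chord, the two strands form four corners.  The corner on the side `i` of the strand of
the family `s` and the side `j` of the other strand lies on one cycle. -/
theorem cycle_corner (s : Family) (p : G.Chord) (i j : Side) :
    G.cycle s (.inl (G.arcAt s p (s.sgn * G.sign p * j.sgn))) i =
      G.cycle s.other (.inl (G.arcAt s.other p (s.other.sgn * G.sign p * i.sgn))) j := by
  have h : ∀ i j, G.cycle .plus (.inl (G.arcAt .plus p (G.sign p * j.sgn))) i =
      G.cycle .minus (.inl (G.arcAt .minus p (-G.sign p * i.sgn))) j := by
    intro i j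
    rcases G.turn_corner p i j with h | h
    · exact Quot.sound h
    · symm; exact Quot.sound h
  cases s
  · simpa [Family.sgn, Family.other] using h i j
  · simpa [Family.sgn, Family.other] using (h j i).symm

/-- A function on the sides of the arcs that agrees at all corners is a function on cycles. -/
theorem exists_cycle_lift {X : Type*} (s : Family) (f : G.Arc s → Side → X)
    (g : G.Arc s.other → Side → X)
    (h : ∀ p i j, f (.inl (G.arcAt s p (s.sgn * G.sign p * j.sgn))) i =
      g (.inl (G.arcAt s.other p (s.other.sgn * G.sign p * i.sgn))) j) :
    ∃ F : G.Cycle → X, (∀ a k, F (G.cycle s a k) = f a k) ∧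
      ∀ a k, F (G.cycle s.other a k) = g a k := by
  have key : ∀ F : ∀ s, G.Arc s → Side → X,
      (∀ p i j, F .plus (.inl (G.arcAt .plus p (G.sign p * j.sgn))) i =
        F .minus (.inl (G.arcAt .minus p (-G.sign p * i.sgn))) j) →
      ∃ F' : G.Cycle → X, ∀ s a k, F' (G.cycle s a k) = F s a k := by
    intro F hF
    refine ⟨Quot.lift (fun d => F d.1 d.2.1 d.2.2) ?_, fun _ _ _ => rfl⟩
    rintro ⟨t, x | μ, k⟩ _ rfl
    · obtain ⟨p, i, j, ⟨h1, h2⟩ | ⟨h1, h2⟩⟩ := G.turn_inl t x k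
      · rw [h2, h1]; exact hF p i j
      · rw [h2, h1]; exact (hF p i j).symm
    · rfl
  cases s
  · obtain ⟨F, hF⟩ := key (fun t => match t with | .plus => f | .minus => g)
      (fun p i j => by simpa [Family.sgn, Family.other] using h p i j)
    exact ⟨F, fun a k => hF .plus a k, fun a k => hF .minus a k⟩
  · obtain ⟨F, hF⟩ := key (fun t => match t with | .plus => g | .minus => f)
      (fun p i j => by simpa [Family.sgn, Family.other] using (h p j i).symm)
    exact ⟨F, fun a k => hF .minus a k, fun a k => hF .plus a k⟩

theorem cycle_ind {P : G.Cycle → Prop} (h : ∀ t a k, P (G.cycle t a k)) (z : G.Cycle) : P z := by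
  obtain ⟨t, a, k⟩ := z
  exact h t a k

/-- The side of a circle without chords is a cycle by itself. -/
theorem dart_eq_of_cycle_free_eq {s t : Family} {μ : G.FreeCircle s} {k l : Side} {a : G.Arc t}
    (h : G.cycle s (.inr μ) k = G.cycle t a l) : (⟨t, a, l⟩ : G.Dart) = ⟨s, .inr μ, k⟩ := by
  -- Being this particular side is invariant under `turn`: the side is fixed, and an arc between
  -- chords always leads to another such arc.
  let P : G.Cycle → Prop := Quot.lift (fun d => d = ⟨s, .inr μ, k⟩) (by
    rintro ⟨t, x | ν, l⟩ _ rfl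
    · have h1 : ∀ b : G.Dart, (∃ u y j, b = ⟨u, .inl y, j⟩) → b ≠ ⟨s, .inr μ, k⟩ := by
        rintro _ ⟨u, y, j, rfl⟩ h
        cases h
      refine propext (iff_of_false (h1 _ ⟨_, _, _, rfl⟩) (h1 _ ?_))
      simp only [turn]
      split_ifs <;> exact ⟨_, _, _, rfl⟩
    · rfl)
  have h1 : P (G.cycle s (.inr μ) k) := rfl
  rw [h] at h1
  exact h1

end Corner

end GaussDiagram

/-! ### Components as classes of colors, and the genus formula -/

namespace DecoratedGaussDiagram

variable (G : DecoratedGaussDiagram)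

/-- The colors of the regions that are joined when the surface is cut along the family `s` and
capped: the two sides of an arc of the other family, and the regions on one side of a circle. -/
inductive ColorRel (s : Family) : G.Color → G.Color → Prop
  | arc (t : Family) (ht : t ≠ s) (a : G.Arc t) (k l : Side) :
      ColorRel s (G.col t a k) (G.col t a l)
  | cap (a b : G.Arc s) (k : Side) (h : G.arcCirc s a = G.arcCirc s b) :
      ColorRel s (G.col s a k) (G.col s b k)

/-- The class of a color in the surface obtained by surgery. -/
abbrev ColorClass (s : Family) : Type := Quot (G.ColorRel s)

theorem _root_.GaussDiagram.exists_arc (G : GaussDiagram) (s : Family) (μ : G.Circ s) :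
    ∃ a : G.Arc s, G.arcCirc s a = μ := by
  by_cases h : ∃ x, G.circ s x = μ
  · obtain ⟨x, hx⟩ := h
    exact ⟨.inl x, hx⟩
  · push Not at h
    exact ⟨.inr ⟨μ, h⟩, rfl⟩

/-- Every arc and every capping disc is incident with a region, so it can be eliminated: an arc
joins the regions on its two sides, and a disc joins all regions along one side of its circle. -/
theorem card_component (s : Family) : Nat.card (G.Component s) = Nat.card (G.ColorClass s) := by
  choose A hA using G.toGaussDiagram.exists_arc s
  refine Nat.card_congr_of_quot (r := G.Incident s) (r' := G.ColorRel s)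
    (fun c => Quot.mk _ (.inl c))
    (fun p => match p with
      | .inl c => Quot.mk _ c
      | .inr (.inl a) => Quot.mk _ (G.col s.other a .right)
      | .inr (.inr (μ, k)) => Quot.mk _ (G.col s (A μ) k)) ?_ ?_ ?_ ?_
  · rintro _ _ (⟨t, ht, a, k, l⟩ | ⟨a, b, k, h⟩)
    · obtain rfl := (s.ne_iff t).1 ht
      exact (Quot.sound (.arc a k)).trans (Quot.sound (.arc a l)).symm
    · refine (Quot.sound (.cap a k)).trans ?_
      rw [h]
      exact (Quot.sound (.cap b k)).symm
  · rintro _ _ (⟨a, k⟩ | ⟨a, k⟩)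
    · exact Quot.sound (.arc _ s.other_ne _ _ _)
    · exact Quot.sound (.cap _ _ _ (hA _).symm)
  · rintro (c | a | ⟨μ, k⟩)
    · rfl
    · exact Quot.sound (.arc a .right)
    · have := Quot.sound (r := G.Incident s) (.cap (A μ) k)
      rwa [hA] at this
  · intro c
    rfl

/-- The genus in terms of the numbers of components, colors, cycles, chords and circles. -/
theorem boundaryGenus_eq (s : Family) :
    G.boundaryGenus s = Nat.card (G.ColorClass s) - Nat.card G.Color +
      (Nat.card G.Cycle + Nat.card G.Chord : ℚ) / 2 - Nat.card (G.Circ s) := by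
  classical
  have := Fintype.ofFinite (G.Component s)
  have := Fintype.ofFinite G.Color
  have := Fintype.ofFinite G.Chord
  have := fun t => Fintype.ofFinite (G.FreeCircle t)
  have := Fintype.ofFinite (G.Circ s)
  have h1 : ∑ K, G.componentEuler s K = ∑ p, G.pieceEuler s p := by
    let q : G.Piece s → G.Component s := Quot.mk (G.Incident s)
    rw [← Finset.sum_fiberwise Finset.univ q]
    refine Finset.sum_congr rfl fun K _ => ?_
    rw [componentEuler, finsum_eq_sum_of_fintype]
    exact (Finset.sum_subtype _ (fun _ => by simp only [Finset.mem_filter_univ]; rfl) _).symm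
  -- Regions give twice the colors minus the cycles, open arcs of the other family give minus the
  -- chords, and each circle has two capping discs.
  have h2 : ∑ p, G.pieceEuler s p = 2 * Nat.card G.Color - Nat.card G.Cycle - Nat.card G.Chord +
      2 * Nat.card (G.Circ s) := by
    rw [Nat.card_eq_sum_card_fiber G.color]
    simp only [Fintype.sum_sum_type, pieceEuler]
    simp
    rw [show Fintype.card Side = 2 from rfl]
    push_cast
    ring
  rw [boundaryGenus, finsum_eq_sum_of_fintype]
  simp only [componentGenus]
  rw [Finset.sum_sub_distrib, ← Finset.sum_div, ← Int.cast_sum, h1, h2, Finset.sum_const,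
    Finset.card_univ, ← Nat.card_eq_fintype_card, card_component]
  push_cast
  simp
  ring

end DecoratedGaussDiagram

/-! ### R-move: arcs and corners -/

namespace DecoratedGaussDiagram

namespace RMove

variable {G G' : DecoratedGaussDiagram} (m : RMove G G')

/-- The sign of the second new chord along the circle of the family `t`. -/
def sndSign (t : Family) : ℤˣ := t.sgn * (m.side t.other).sgn

theorem fst_eq' (t : Family) : m.fst t = m.new (-m.sndSign t) := m.fst_eq t

theorem snd_eq' (t : Family) : m.snd t = m.new (m.sndSign t) := m.snd_eq t

theorem new_inj {ε η : ℤˣ} : m.new ε = m.new η ↔ ε = η :=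
  ⟨fun h => Sum.inr_injective (m.chords.1 (a₁ := .inr ε) (a₂ := .inr η) h), fun h => h ▸ rfl⟩

theorem old_ne_new (x : G.Chord) (ε : ℤˣ) : m.old x ≠ m.new ε :=
  fun h => Sum.inl_ne_inr (m.chords.1 (a₁ := .inl x) (a₂ := .inr ε) h)

theorem snd_ne_fst (t : Family) : m.snd t ≠ m.fst t := by
  rw [fst_eq', snd_eq', Ne, new_inj]
  exact units_ne_neg_self _

theorem exists_old_or_new (q : G'.Chord) : (∃ x, q = m.old x) ∨ ∃ ε, q = m.new ε := by
  obtain ⟨x | ε, rfl⟩ := m.chords.2 q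
  exacts [.inl ⟨x, rfl⟩, .inr ⟨ε, rfl⟩]

theorem exists_old_or_fst_or_snd (t : Family) (q : G'.Chord) :
    (∃ x, q = m.old x) ∨ q = m.fst t ∨ q = m.snd t := by
  rw [fst_eq', snd_eq']
  obtain h | ⟨ε, rfl⟩ := m.exists_old_or_new q
  · exact .inl h
  · right
    rw [new_inj, new_inj]
    rcases Int.units_eq_one_or ε with rfl | rfl <;>
      rcases Int.units_eq_one_or (m.sndSign t) with h | h <;> simp [h]

/-- The arc of `G` from which an arc of `G'` comes. -/
noncomputable def origin (t : Family) : G'.Arc t → G.Arc t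
  | .inl q => match (Equiv.ofBijective _ m.chords).symm q with
    | .inl x => .inl x
    | .inr _ => m.arc t
  | .inr ν => .inr ⟨(m.circle t).symm ν.1, fun x h => ν.2 (m.old x) (by
      rw [m.circ_old, h, Equiv.apply_symm_apply])⟩

theorem origin_old (t : Family) (x : G.Chord) : m.origin t (.inl (m.old x)) = .inl x := by
  have : (Equiv.ofBijective _ m.chords).symm (m.old x) = .inl x :=
    (Equiv.symm_apply_eq _).2 rfl
  simp only [origin, this]

theorem origin_new (t : Family) (ε : ℤˣ) : m.origin t (.inl (m.new ε)) = m.arc t := by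
  have : (Equiv.ofBijective _ m.chords).symm (m.new ε) = .inr ε :=
    (Equiv.symm_apply_eq _).2 rfl
  simp only [origin, this]

open Classical in
/-- An arc of `G'` that lies on an arc of `G`. -/
noncomputable def lift (t : Family) : G.Arc t → G'.Arc t
  | .inl x => .inl (m.old x)
  -- A circle without chords is cut into the middle edge `fst` and the outer part `snd`; the latter
  -- represents it.
  | .inr μ => if h : m.arc t = .inr μ then .inl (m.snd t) else
      .inr ⟨m.circle t μ.1, fun q hq => by
        obtain ⟨x, rfl⟩ | ⟨ε, rfl⟩ := m.exists_old_or_new q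
        · rw [m.circ_old, (m.circle t).apply_eq_iff_eq] at hq
          exact μ.2 x hq
        · rw [m.circ_new, (m.circle t).apply_eq_iff_eq] at hq
          rcases h' : m.arc t with x | ν
          · exact μ.2 x (by rw [← hq, h']; rfl)
          · exact h (by rw [h'] at hq ⊢; exact congrArg _ (Subtype.ext hq))⟩

theorem origin_lift (t : Family) (a : G.Arc t) : m.origin t (m.lift t a) = a := by
  rcases a with x | μ
  · exact m.origin_old t x
  · simp only [lift]
    split_ifs with h
    · rw [snd_eq', origin_new, h]
    · simp [origin]

theorem lift_ne_fst (t : Family) (a : G.Arc t) : m.lift t a ≠ .inl (m.fst t) := by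
  rw [fst_eq']
  rcases a with x | μ
  · exact fun h => m.old_ne_new _ _ (Sum.inl_injective h)
  · simp only [lift]
    split_ifs with h
    · rw [← fst_eq']
      exact fun h => m.snd_ne_fst _ (Sum.inl_injective h)
    · exact Sum.inr_ne_inl

theorem arcCirc_origin (t : Family) (a : G'.Arc t) :
    G'.arcCirc t a = m.circle t (G.arcCirc t (m.origin t a)) := by
  rcases a with q | ν
  · obtain ⟨x, rfl⟩ | ⟨ε, rfl⟩ := m.exists_old_or_new q
    · rw [origin_old]; exact m.circ_old t x
    · rw [origin_new]; exact m.circ_new t ε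
  · simp [origin, GaussDiagram.arcCirc]

/-- The middle edge is excluded: one of its sides faces the bigon, and the other one lies beyond the
other arc. -/
theorem color_origin (t : Family) (a : G'.Arc t) (h : a ≠ .inl (m.fst t)) (k : Side) :
    m.colorMap (G'.col t a k) = some (G.col t (m.origin t a) k) := by
  rcases a with q | ν
  · obtain ⟨x, rfl⟩ | rfl | rfl := m.exists_old_or_fst_or_snd t q
    · rw [origin_old]; exact m.color_old t x k
    · exact absurd rfl h
    · rw [m.color_snd, snd_eq', origin_new]
  · exact m.color_free t _ ν k (by simp)

/-- The outer part of the arc `arc t` at the new chord of sign `ε`. -/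
def outer (t : Family) (ε : ℤˣ) : G'.Chord :=
  G'.arcAt t (m.new ε) (t.sgn * ε * (m.side t.other).sgn)

theorem outer_sndSign (t : Family) : m.outer t (m.sndSign t) = m.snd t := by
  rw [outer, snd_eq', sndSign]
  rw [show t.sgn * (t.sgn * (m.side t.other).sgn) * (m.side t.other).sgn = 1 by
    rw [← mul_assoc, Int.units_mul_self, one_mul, Int.units_mul_self]]
  rfl

theorem outer_neg_sndSign (t : Family) :
    m.outer t (-m.sndSign t) = (G'.next t).symm (m.fst t) := by
  rw [outer, fst_eq', sndSign]
  rw [show t.sgn * -(t.sgn * (m.side t.other).sgn) * (m.side t.other).sgn = -1 by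
    rw [mul_neg, neg_mul, ← mul_assoc, Int.units_mul_self, one_mul, Int.units_mul_self]]
  rfl

theorem symm_fst_inl {t : Family} {x : G.Chord} (h : m.arc t = .inl x) :
    (G'.next t).symm (m.fst t) = m.old x := by
  rw [Equiv.symm_apply_eq, m.next_arc t x h]

theorem symm_fst_inr {t : Family} {μ} (h : m.arc t = .inr μ) :
    (G'.next t).symm (m.fst t) = m.snd t := by
  rw [Equiv.symm_apply_eq, m.next_snd, h]

theorem eq_sndSign_or (t : Family) (ε : ℤˣ) : ε = m.sndSign t ∨ ε = -m.sndSign t := by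
  rcases Int.units_eq_one_or ε with rfl | rfl <;>
    rcases Int.units_eq_one_or (m.sndSign t) with h | h <;> simp [h]

/-- The finger has crossed the other arc, so at both new chords the half-strand on the side that was
not chosen is the middle edge. -/
theorem arcAt_new_opp (t : Family) (ε : ℤˣ) :
    G'.arcAt t (m.new ε) (t.sgn * ε * (m.side t.other).opp.sgn) = m.fst t := by
  rw [Side.sgn_opp]
  rcases m.eq_sndSign_or t ε with rfl | rfl
  · rw [sndSign, show t.sgn * (t.sgn * (m.side t.other).sgn) * -(m.side t.other).sgn = -1 by
      rw [mul_neg, ← mul_assoc, Int.units_mul_self, one_mul, Int.units_mul_self]]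
    rw [GaussDiagram.arcAt_neg_one, Equiv.symm_apply_eq, m.next_fst, snd_eq', sndSign]
  · rw [sndSign, show t.sgn * -(t.sgn * (m.side t.other).sgn) * -(m.side t.other).sgn = 1 by
      rw [mul_neg, mul_neg, neg_mul, neg_neg, ← mul_assoc, Int.units_mul_self, one_mul,
          Int.units_mul_self]]
    rw [GaussDiagram.arcAt_one, fst_eq', sndSign]

theorem outer_ne_fst (t : Family) (ε : ℤˣ) : m.outer t ε ≠ m.fst t := by
  rcases m.eq_sndSign_or t ε with rfl | rfl
  · rw [outer_sndSign]; exact m.snd_ne_fst t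
  · rw [outer_neg_sndSign]
    rcases h : m.arc t with x | μ
    · rw [m.symm_fst_inl h, fst_eq']; exact m.old_ne_new _ _
    · rw [m.symm_fst_inr h]; exact m.snd_ne_fst t

theorem origin_outer (t : Family) (ε : ℤˣ) : m.origin t (.inl (m.outer t ε)) = m.arc t := by
  rcases m.eq_sndSign_or t ε with rfl | rfl
  · rw [outer_sndSign, snd_eq', origin_new]
  · rw [outer_neg_sndSign]
    rcases h : m.arc t with x | μ
    · rw [m.symm_fst_inl h, origin_old]
    · rw [m.symm_fst_inr h, snd_eq', origin_new, h]

theorem symm_old (t : Family) (x : G.Chord) :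
    (m.arc t = .inl x ∧ (G'.next t).symm (m.old (G.next t x)) = m.snd t) ∨
      (G'.next t).symm (m.old (G.next t x)) = m.old x := by
  simp only [Equiv.symm_apply_eq]
  by_cases h : m.arc t = .inl x
  · left
    rw [m.next_snd, h]
    exact ⟨rfl, rfl⟩
  · right
    rw [m.next_old t x h]

theorem arcAt_old_ne_fst (t : Family) (p : G.Chord) (ε : ℤˣ) :
    G'.arcAt t (m.old p) ε ≠ m.fst t := by
  unfold GaussDiagram.arcAt
  split_ifs
  · rw [fst_eq']; exact m.old_ne_new _ _
  · obtain ⟨x, rfl⟩ := (G.next t).surjective p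
    obtain ⟨-, h⟩ | h := m.symm_old t x
    · rw [h]; exact m.snd_ne_fst t
    · rw [h, fst_eq']; exact m.old_ne_new _ _

theorem origin_arcAt_old (t : Family) (p : G.Chord) (ε : ℤˣ) :
    m.origin t (.inl (G'.arcAt t (m.old p) ε)) = .inl (G.arcAt t p ε) := by
  unfold GaussDiagram.arcAt
  split_ifs
  · exact m.origin_old t p
  · obtain ⟨x, rfl⟩ := (G.next t).surjective p
    rw [Equiv.symm_apply_apply]
    obtain ⟨h', h⟩ | h := m.symm_old t x
    · rw [h, snd_eq', origin_new, h']
    · rw [h, origin_old]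

/-- At each new chord, the four corners are of three kinds. In this one the two chosen sides meet
outside the finger. -/
theorem corner_outer (t : Family) (ε : ℤˣ) :
    G'.cycle t (.inl (m.outer t ε)) (m.side t) =
      G'.cycle t.other (.inl (m.outer t.other ε)) (m.side t.other) := by
  have h := G'.cycle_corner t (m.new ε) (m.side t) (m.side t.other)
  rw [m.sign_new] at h
  rw [outer, h, outer]
  cases t <;> rfl

/-- In the mixed corners, the chosen side of one middle edge continues the far side of the other
arc. -/
theorem corner_far (t : Family) (ε : ℤˣ) :
    G'.cycle t (.inl (m.outer t ε)) (m.side t).opp =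
      G'.cycle t.other (.inl (m.fst t.other)) (m.side t.other) := by
  have h := G'.cycle_corner t (m.new ε) (m.side t).opp (m.side t.other)
  rw [m.sign_new] at h
  rw [outer, h, ← m.arcAt_new_opp t.other ε]
  cases t <;> rfl

/-- The last corner belongs to the bigon between the two middle edges. -/
theorem corner_middle (t : Family) :
    G'.cycle t (.inl (m.fst t)) (m.side t).opp =
      G'.cycle t.other (.inl (m.fst t.other)) (m.side t.other).opp := by
  have h := G'.cycle_corner t (m.new 1) (m.side t).opp (m.side t.other).opp
  rw [m.sign_new, arcAt_new_opp] at h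
  rw [h, ← m.arcAt_new_opp t.other 1]
  cases t <;> rfl

end RMove

end DecoratedGaussDiagram

/-! ### R-move: the number of cycles -/

namespace DecoratedGaussDiagram

namespace RMove

variable {G G' : DecoratedGaussDiagram} (m : RMove G G')

/-- The cycles of `G`, with the two cycles at the chosen sides identified. -/
abbrev Glued : Type :=
  Glue (G.cycle .plus (m.arc .plus) (m.side .plus)) (G.cycle .minus (m.arc .minus) (m.side .minus))

/-- The cycles of `G'`, with the cycles at the two outer parts of `e⁺` identified. -/
abbrev Glued' : Type :=
  Glue (G'.cycle .plus (.inl (m.outer .plus 1)) (m.side .plus))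
    (G'.cycle .plus (.inl (m.outer .plus (-1))) (m.side .plus))

theorem glued_arc (t : Family) :
    (Quot.mk _ (G.cycle t (m.arc t) (m.side t)) : m.Glued) =
      Quot.mk _ (G.cycle .plus (m.arc .plus) (m.side .plus)) := by
  cases t
  · rfl
  · exact (Quot.sound ⟨rfl, rfl⟩).symm

/-- On the chosen side this is the identification itself, carried to the other arc by
`corner_outer`. On the far side both outer parts already lie on the cycle along the middle edge of
the other arc. -/
theorem glued'_outer (t : Family) (ε η : ℤˣ) (k : Side) :
    (Quot.mk _ (G'.cycle t (.inl (m.outer t ε)) k) : m.Glued') =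
      Quot.mk _ (G'.cycle t (.inl (m.outer t η)) k) := by
  by_cases hk : k = m.side t
  · subst hk
    have h : ∀ ε, (Quot.mk _ (G'.cycle .plus (.inl (m.outer .plus ε)) (m.side .plus)) : m.Glued') =
        Quot.mk _ (G'.cycle .plus (.inl (m.outer .plus (-1))) (m.side .plus)) := by
      intro ε
      rcases Int.units_eq_one_or ε with rfl | rfl
      · exact Quot.sound ⟨rfl, rfl⟩
      · rfl
    cases t
    · rw [h ε, h η]
    · rw [m.corner_outer .minus, m.corner_outer .minus]
      exact (h ε).trans (h η).symm
  · rw [← ne_eq, Side.ne_iff] at hk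
    subst hk
    rw [m.corner_far, m.corner_far]

/-- `lift` represents the arc by one of its outer parts; after the identification it does not matter
by which one. -/
theorem glued'_lift_arc (t : Family) (ε : ℤˣ) (k : Side) :
    (Quot.mk _ (G'.cycle t (m.lift t (m.arc t)) k) : m.Glued') =
      Quot.mk _ (G'.cycle t (.inl (m.outer t ε)) k) := by
  rcases h : m.arc t with x | μ
  · rw [m.glued'_outer t ε (-m.sndSign t), outer_neg_sndSign, m.symm_fst_inl h]
    rfl
  · rw [m.glued'_outer t ε (m.sndSign t), outer_sndSign, lift, dif_pos h]

theorem glued'_lift_origin (t : Family) (a : G'.Arc t) (h : a ≠ .inl (m.fst t)) (k : Side) :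
    (Quot.mk _ (G'.cycle t (m.lift t (m.origin t a)) k) : m.Glued') =
      Quot.mk _ (G'.cycle t a k) := by
  rcases a with q | ν
  · obtain ⟨x, rfl⟩ | rfl | rfl := m.exists_old_or_fst_or_snd t q
    · rw [origin_old]; rfl
    · exact absurd rfl h
    · rw [snd_eq', origin_new, m.glued'_lift_arc t (m.sndSign t), outer_sndSign, snd_eq']
  · have h' : m.arc t ≠ m.origin t (.inr ν) := by
      intro h'
      refine ν.2 (m.new 1) ?_
      rw [m.circ_new, h', ← arcCirc_origin]
      rfl
    simp only [origin] at h' ⊢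
    rw [lift, dif_neg h']
    simp

theorem glued'_lift_arcAt (t : Family) (p : G.Chord) (ε : ℤˣ) (k : Side) :
    (Quot.mk _ (G'.cycle t (m.lift t (.inl (G.arcAt t p ε))) k) : m.Glued') =
      Quot.mk _ (G'.cycle t (.inl (G'.arcAt t (m.old p) ε)) k) := by
  rw [← m.glued'_lift_origin t _ (fun h => m.arcAt_old_ne_fst t p ε (Sum.inl_injective h)),
    origin_arcAt_old]

/-- Once the outer parts of the arcs are identified, the only cycle without a counterpart in `G` is
the bigon. Maps both ways are built from their values on sides of arcs, checked at corners. -/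
theorem card_glued' : Nat.card m.Glued' = Nat.card m.Glued + 1 := by
  obtain ⟨F, hF, hF'⟩ := G.exists_cycle_lift .plus
    (fun a k => (Quot.mk _ (G'.cycle .plus (m.lift .plus a) k) : m.Glued'))
    (fun a k => Quot.mk _ (G'.cycle .minus (m.lift .minus a) k)) (by
      intro p i j
      refine (m.glued'_lift_arcAt .plus p _ i).trans ?_
      refine .trans ?_ (m.glued'_lift_arcAt .minus p _ j).symm
      rw [← m.sign_old, G'.cycle_corner]
      rfl)
  have hF : ∀ t a k, F (G.cycle t a k) = Quot.mk _ (G'.cycle t (m.lift t a) k) := by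
    rintro (_ | _)
    exacts [hF, hF']
  have hFg : F (G.cycle .plus (m.arc .plus) (m.side .plus)) =
      F (G.cycle .minus (m.arc .minus) (m.side .minus)) := by
    rw [hF, hF, m.glued'_lift_arc _ 1, m.glued'_lift_arc _ 1, m.corner_outer .plus]
    rfl
  classical
  -- The value `none` is reserved for the bigon; the other side of a middle edge goes to the far
  -- side of the opposite arc.
  let f : ∀ t, G'.Arc t → Side → Option m.Glued := fun t a k =>
    if a = .inl (m.fst t) then
      if k = m.side t then
        some (Quot.mk _ (G.cycle t.other (m.arc t.other) (m.side t.other).opp))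
      else none
    else some (Quot.mk _ (G.cycle t (m.origin t a) k))
  have hf0 : ∀ t a k, a ≠ .inl (m.fst t) →
      f t a k = some (Quot.mk _ (G.cycle t (m.origin t a) k)) := fun t a k h => if_neg h
  have hf1 : ∀ t, f t (.inl (m.fst t)) (m.side t) =
      some (Quot.mk _ (G.cycle t.other (m.arc t.other) (m.side t.other).opp)) :=
    fun t => (if_pos rfl).trans (if_pos rfl)
  have hf2 : ∀ t, f t (.inl (m.fst t)) (m.side t).opp = none :=
    fun t => (if_pos rfl).trans (if_neg (Side.opp_ne _))
  have hfo : ∀ t ε k, f t (.inl (m.outer t ε)) k = some (Quot.mk _ (G.cycle t (m.arc t) k)) := by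
    intro t ε k
    rw [hf0 _ _ _ (fun h => m.outer_ne_fst t ε (Sum.inl_injective h)), origin_outer]
  obtain ⟨H, hH, hH'⟩ := G'.exists_cycle_lift .plus (f .plus) (f .minus) (by
    intro q i j
    obtain ⟨p, rfl⟩ | ⟨ε, rfl⟩ := m.exists_old_or_new q
    · rw [hf0 _ _ _ (fun h => m.arcAt_old_ne_fst _ _ _ (Sum.inl_injective h)), origin_arcAt_old,
        m.sign_old, G.cycle_corner]
      refine .trans ?_
        (hf0 .minus _ _ (fun h => m.arcAt_old_ne_fst .minus p _ (Sum.inl_injective h))).symm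
      rw [origin_arcAt_old]
      rfl
    · rw [m.sign_new]
      have hj : j = m.side .minus ∨ j = (m.side .minus).opp := by
        rw [← Side.ne_iff]; exact em _
      have hi : i = m.side .plus ∨ i = (m.side .plus).opp := by
        rw [← Side.ne_iff]; exact em _
      have e1 := m.arcAt_new_opp .plus ε
      have e2 := m.arcAt_new_opp .minus ε
      have g1 : G'.arcAt .plus (m.new ε) (Family.plus.sgn * ε * (m.side .minus).sgn) =
        m.outer .plus ε := rfl
      have g2 : G'.arcAt .minus (m.new ε) (Family.minus.sgn * ε * (m.side .plus).sgn) =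
        m.outer .minus ε := rfl
      simp only [Family.other] at e1 e2 ⊢
      rcases hi with rfl | rfl <;> rcases hj with rfl | rfl
      · rw [g1, g2, hfo, hfo, glued_arc]
        exact congrArg some (m.glued_arc .minus).symm
      · rw [e1, g2, hfo, hf1]; rfl
      · rw [e2, g1, hfo, hf1]; rfl
      · rw [e1, e2, hf2, hf2])
  have hH : ∀ t a k, H (G'.cycle t a k) = f t a k := by
    rintro (_ | _)
    exacts [hH, hH']
  let Φ : Option m.Glued → m.Glued' := fun o => match o with
    | none => Quot.mk _ (G'.cycle .plus (.inl (m.fst .plus)) (m.side .plus).opp)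
    | some q => Quot.lift F (by rintro _ _ ⟨rfl, rfl⟩; exact hFg) q
  let Ψ : m.Glued' → Option m.Glued := Quot.lift H (by
    rintro _ _ ⟨rfl, rfl⟩
    rw [hH, hH, hfo, hfo])
  have e : Option m.Glued ≃ m.Glued' := by
    refine ⟨Φ, Ψ, ?_, ?_⟩
    · rintro (_ | ⟨⟨z⟩⟩)
      · exact (hH _ _ _).trans (hf2 .plus)
      · have h : ∀ t a k, Ψ (F (G.cycle t a k)) = some (Quot.mk _ (G.cycle t a k)) := by
          intro t a k
          rw [hF]
          refine (hH _ _ _).trans ?_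
          rw [hf0 _ _ _ (m.lift_ne_fst t a), origin_lift]
        exact G.cycle_ind (P := fun z => Ψ (F z) = some (Quot.mk _ z)) h z
    · rintro ⟨z⟩
      have h : ∀ t a k, Φ (H (G'.cycle t a k)) = Quot.mk _ (G'.cycle t a k) := by
        intro t a k
        rw [hH]
        by_cases ha : a = .inl (m.fst t)
        · subst ha
          by_cases hk : k = m.side t
          · subst hk
            rw [hf1]
            refine (hF _ _ _).trans ?_
            rw [m.glued'_lift_arc _ 1, corner_far]
            cases t <;> rfl
          · rw [← ne_eq, Side.ne_iff] at hk
            subst hk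
            rw [hf2]
            cases t
            · rfl
            · rw [m.corner_middle .minus]; rfl
        · rw [hf0 _ _ _ ha]
          exact (hF _ _ _).trans (m.glued'_lift_origin t a ha k)
      exact G'.cycle_ind (P := fun z => Φ (H z) = Quot.mk _ z) h z
  rw [← Nat.card_congr e, Finite.card_option]

theorem card_chord (m : RMove G G') : Nat.card G'.Chord = Nat.card G.Chord + 2 := by
  rw [← Nat.card_congr (Equiv.ofBijective _ m.chords), Nat.card_sum,
    Nat.card_eq_fintype_card (α := ℤˣ)]
  rfl

-- If the chosen cycles agree, `card_glued'` leaves an increase of 1 or 2; otherwise it leaves 0 or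
-- 1. Two chords were added, so parity requires an even change.
open Classical in
theorem card_cycle : Nat.card G'.Cycle = Nat.card G.Cycle +
    if G.cycle .plus (m.arc .plus) (m.side .plus) = G.cycle .minus (m.arc .minus) (m.side .minus)
      then 2 else 0 := by
  have h1 := m.card_glued'
  simp only [Glued, Glued'] at h1
  have h2 := Glue.card (G.cycle .plus (m.arc .plus) (m.side .plus))
    (G.cycle .minus (m.arc .minus) (m.side .minus))
  have h3 := Glue.card (G'.cycle .plus (.inl (m.outer .plus 1)) (m.side .plus))
    (G'.cycle .plus (.inl (m.outer .plus (-1))) (m.side .plus))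
  have h4 := G.card_cycle_mod_two
  have h5 := G'.card_cycle_mod_two
  have h6 := m.card_chord
  split_ifs at h2 h3 ⊢ <;> omega

end RMove

end DecoratedGaussDiagram

/-! ### R-move: colors and components -/

namespace DecoratedGaussDiagram

namespace RMove

variable {G G' : DecoratedGaussDiagram} (m : RMove G G')

theorem exists_color_over (c : G.Color) : ∃ c', m.colorMap c' = some c := by
  have h : Nat.card {c' : G'.Color // m.colorMap c' = some c} ≠ 0 := by
    have h1 := m.color_count c
    by_cases h : G.cycle .plus (m.arc .plus) (m.side .plus) =
      G.cycle .minus (m.arc .minus) (m.side .minus) ∧ c = G.col .plus (m.arc .plus) (m.side .plus)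
    · rw [h1.1 h]; decide
    · rw [h1.2 h]; decide
  obtain ⟨⟨c', hc⟩⟩ := (Nat.card_ne_zero.1 h).1
  exact ⟨c', hc⟩

theorem eq_of_color_none {c' : G'.Color} (h : m.colorMap c' = none) (t : Family) :
    c' = G'.col t (.inl (m.fst t)) (m.side t).opp := by
  obtain ⟨z, rfl⟩ := G'.color_surjective c'
  rw [(m.color_new z).1 h]
  cases t
  · rfl
  · exact congrArg _ (m.corner_middle .plus)

theorem color_none (t : Family) :
    m.colorMap (G'.col t (.inl (m.fst t)) (m.side t).opp) = none := by
  have h : m.colorMap (G'.col .plus (.inl (m.fst .plus)) (m.side .plus).opp) = none :=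
    (m.color_new _).2 rfl
  cases t
  · exact h
  · rw [← h]
    exact congrArg (fun z => m.colorMap (G'.color z)) (m.corner_middle .minus)

theorem color_middle (t : Family) :
    m.colorMap (G'.col t (.inl (m.fst t)) (m.side t)) =
      some (G.col t.other (m.arc t.other) (m.side t.other).opp) := by
  have h := m.color_origin t.other (.inl (m.outer t.other 1))
    (fun h => m.outer_ne_fst t.other 1 (Sum.inl_injective h)) (m.side t.other).opp
  rw [origin_outer] at h
  rw [← h]
  refine congrArg (fun z => m.colorMap (G'.color z)) ?_
  rw [corner_far]
  cases t <;> rfl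

open Classical in
theorem card_color : Nat.card G'.Color = Nat.card G.Color + 1 +
    if G.cycle .plus (m.arc .plus) (m.side .plus) = G.cycle .minus (m.arc .minus) (m.side .minus)
      then 1 else 0 := by
  have := Fintype.ofFinite G.Color
  have h0 : Nat.card {c' // m.colorMap c' = none} = 1 := by
    rw [Nat.card_eq_one_iff_unique]
    refine ⟨⟨fun a b => Subtype.ext ?_⟩, ⟨⟨_, m.color_none .plus⟩⟩⟩
    rw [m.eq_of_color_none a.2 .plus, m.eq_of_color_none b.2 .plus]
  have h1 : ∀ c, Nat.card {c' : G'.Color // m.colorMap c' = some c} =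
      1 + if c = G.col .plus (m.arc .plus) (m.side .plus) then
        (if G.cycle .plus (m.arc .plus) (m.side .plus) =
          G.cycle .minus (m.arc .minus) (m.side .minus) then 1 else 0) else 0 := by
    intro c
    have := m.color_count c
    split_ifs with h1 h2
    · exact this.1 ⟨h2, h1⟩
    · exact this.2 fun h => h2 h.1
    · exact this.2 fun h => h1 h.2
  rw [Nat.card_eq_sum_card_fiber m.colorMap, Fintype.sum_option, h0]
  simp only [h1, Finset.sum_add_distrib, Finset.sum_ite_eq', Finset.sum_const, Finset.mem_univ,
    if_true, Finset.card_univ, Nat.card_eq_fintype_card, smul_eq_mul, mul_one]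
  ring

/-- Only a split color needs an argument: its two parts lie along the two outer parts of e⁺ and are
joined by the capping disc of this circle, or, for the other surgery, around e⁺. -/
theorem class_eq_of_colorMap_eq (s : Family) {c : G.Color} {a b : G'.Color}
    (ha : m.colorMap a = some c) (hb : m.colorMap b = some c) :
    (Quot.mk _ a : G'.ColorClass s) = Quot.mk _ b := by
  by_cases h : G.cycle .plus (m.arc .plus) (m.side .plus) =
      G.cycle .minus (m.arc .minus) (m.side .minus) ∧ c = G.col .plus (m.arc .plus) (m.side .plus)
  · have h2 := (m.color_count c).1 h
    obtain ⟨h, rfl⟩ := h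
    rcases hx : m.arc .plus with x | μ
    · have h3 := m.color_split h x hx
      have h4 := m.color_old .plus x (m.side .plus)
      have h5 := m.color_snd .plus (m.side .plus)
      have h6 : (Quot.mk _ (G'.col .plus (.inl (m.old x)) (m.side .plus)) : G'.ColorClass s) =
          Quot.mk _ (G'.col .plus (.inl (m.snd .plus)) (m.side .plus)) := by
        cases s
        · refine Quot.sound (.cap _ _ _ ?_)
          rw [m.arcCirc_origin, m.arcCirc_origin, origin_old, snd_eq', origin_new, hx]
        -- Beyond e⁺, both outer parts border the cycle along the middle edge of e⁻. The path
        -- crosses one outer part to this region and returns across the other.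
        · have h7 : G'.col .plus (.inl (m.old x)) (m.side .plus).opp =
              G'.col .plus (.inl (m.snd .plus)) (m.side .plus).opp := by
            rw [col, col, ← m.symm_fst_inl hx, ← outer_neg_sndSign, corner_far, ← outer_sndSign,
              corner_far]
          refine (Quot.sound (.arc .plus (by decide) _ _ (m.side .plus).opp)).trans ?_
          rw [h7]
          exact Quot.sound (.arc .plus (by decide) _ _ _)
      rw [← hx] at h4
      have h7 : ∀ d : G'.Color, m.colorMap d = some (G.col .plus (m.arc .plus) (m.side .plus)) →
          (Quot.mk _ d : G'.ColorClass s) =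
            Quot.mk _ (G'.col .plus (.inl (m.old x)) (m.side .plus)) := by
        intro d hd
        rcases eq_or_eq_of_card_subtype_eq_two h2 h4 h5 h3 hd with rfl | rfl
        · rfl
        · exact h6.symm
      rw [h7 a ha, h7 b hb]
    -- A side of a circle without chords is a whole cycle, so it cannot also contain a side of an
    -- arc of the other family.
    · rw [hx] at h
      have := G.dart_eq_of_cycle_free_eq h
      cases this
  · have h2 := (m.color_count c).2 h
    rw [eq_of_card_subtype_eq_one h2 ha hb]

/-- The bigon borders the middle edge of the other family, which is removed by the surgery, and is
thereby joined to the far side of the arc of the family `s`. All other colors correspond by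
`colorMap`. -/
theorem card_colorClass (m : RMove G G') (s : Family) :
    Nat.card (G.ColorClass s) = Nat.card (G'.ColorClass s) := by
  choose up hup using m.exists_color_over
  have hup' : ∀ t a k, (Quot.mk _ (up (G.col t a k)) : G'.ColorClass s) =
      Quot.mk _ (G'.col t (m.lift t a) k) := by
    intro t a k
    refine m.class_eq_of_colorMap_eq s (hup _) ?_
    rw [m.color_origin t _ (m.lift_ne_fst t a), origin_lift]
  let far : G.ColorClass s := Quot.mk _ (G.col s (m.arc s) (m.side s).opp)
  let g : G'.Color → G.ColorClass s := fun c' => (m.colorMap c').elim far (Quot.mk _)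
  have hg0 : ∀ t a, a ≠ .inl (m.fst t) → ∀ k,
      g (G'.col t a k) = Quot.mk _ (G.col t (m.origin t a) k) := by
    intro t a h k
    simp only [g, m.color_origin t a h k]
    rfl
  have hg1 : ∀ t, g (G'.col t (.inl (m.fst t)) (m.side t).opp) = far := by
    intro t
    simp only [g, m.color_none t]
    rfl
  have hg2 : ∀ t, g (G'.col t (.inl (m.fst t)) (m.side t)) =
      Quot.mk _ (G.col t.other (m.arc t.other) (m.side t.other).opp) := by
    intro t
    simp only [g, m.color_middle t]
    rfl
  have hg3 : ∀ (a : G'.Arc s) k, g (G'.col s a k) = Quot.mk _ (G.col s (m.origin s a) k) := by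
    intro a k
    by_cases ha : a = .inl (m.fst s)
    · subst ha
      by_cases hk : k = m.side s
      · subst hk
        -- From the far side of the other arc one crosses to its chosen side, which has the color of
        -- the chosen side of this arc.
        rw [hg2, fst_eq', origin_new]
        refine (Quot.sound (.arc s.other s.other_ne _ _ (m.side s.other))).trans ?_
        have := m.same_color
        cases s
        · exact congrArg _ this.symm
        · exact congrArg _ this
      · rw [← ne_eq, Side.ne_iff] at hk
        subst hk
        rw [hg1, fst_eq', origin_new]
    · exact hg0 s a ha k
  refine Nat.card_congr_of_quot g (fun c => Quot.mk _ (up c)) ?_ ?_ ?_ ?_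
  · rintro _ _ (⟨t, ht, a, k, l⟩ | ⟨a, b, k, h⟩)
    · by_cases ha : a = .inl (m.fst t)
      · subst ha
        -- The middle edge of the other family separates the bigon from the far side of the arc of
        -- the family `s`; both belong to the class `far`.
        have h : ∀ k, g (G'.col t (.inl (m.fst t)) k) = far := by
          intro k
          by_cases hk : k = m.side t
          · subst hk
            rw [hg2]
            obtain rfl := (s.ne_iff t).1 ht
            cases s <;> rfl
          · rw [← ne_eq, Side.ne_iff] at hk
            subst hk
            rw [hg1]
        rw [h k, h l]
      · rw [hg0 t a ha, hg0 t a ha]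
        exact Quot.sound (.arc t ht _ _ _)
    · rw [hg3, hg3]
      refine Quot.sound (.cap _ _ _ ?_)
      rw [m.arcCirc_origin, m.arcCirc_origin] at h
      exact (m.circle s).injective h
  · rintro _ _ (⟨t, ht, a, k, l⟩ | ⟨a, b, k, h⟩)
    · rw [hup', hup']
      exact Quot.sound (.arc t ht _ _ _)
    · rw [hup', hup']
      refine Quot.sound (.cap _ _ _ ?_)
      rw [m.arcCirc_origin, m.arcCirc_origin, origin_lift, origin_lift, h]
  · intro c
    change g (up c) = _
    simp only [g, hup]
    rfl
  · intro c'
    rcases h : m.colorMap c' with _ | c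
    · obtain rfl := m.eq_of_color_none h s
      rw [hg1]
      refine (hup' _ _ _).trans (Quot.sound (.cap _ _ _ ?_))
      rw [m.arcCirc_origin, m.arcCirc_origin, origin_lift, fst_eq', origin_new]
    · simp only [g, h]
      exact m.class_eq_of_colorMap_eq s (hup c) h

theorem boundaryGenus_eq (m : RMove G G') (s : Family) :
    G.boundaryGenus s = G'.boundaryGenus s := by
  classical
  rw [DecoratedGaussDiagram.boundaryGenus_eq, DecoratedGaussDiagram.boundaryGenus_eq,
    m.card_colorClass, m.card_color, m.card_cycle, m.card_chord, Nat.card_congr (m.circle s)]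
  split_ifs <;> push_cast <;> ring

end RMove

end DecoratedGaussDiagram

/-! ### Extensions of diagrams by further components of the ribbon graph -/

/-- Move data are given separately for a variable family and for its opposite; this assembles them
into one family-indexed function. -/
theorem Family.exists_pi (s : Family) {β : Family → Type*} (a : β s) (b : β s.other) :
    ∃ f : ∀ t, β t, f s = a ∧ f s.other = b := by
  cases s
  · exact ⟨fun t => match t with | .plus => a | .minus => b, rfl, rfl⟩
  · exact ⟨fun t => match t with | .plus => b | .minus => a, rfl, rfl⟩

/-- An embedding of a Gauss diagram onto a union of components of the ribbon graph of another
one. -/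
structure GaussDiagram.Extension (G G' : GaussDiagram) where
  /-- the map of the circles -/
  circle : ∀ t, G.Circ t → G'.Circ t
  circle_injective : ∀ t, Function.Injective (circle t)
  /-- the map of the chords -/
  chord : G.Chord → G'.Chord
  chord_injective : Function.Injective chord
  sign_chord : ∀ x, G'.sign (chord x) = G.sign x
  circ_chord : ∀ t x, G'.circ t (chord x) = circle t (G.circ t x)
  next_chord : ∀ t x, G'.next t (chord x) = chord (G.next t x)
  exists_chord : ∀ t q μ, G'.circ t q = circle t μ → ∃ x, q = chord x

namespace GaussDiagram.Extension

variable {G G' : GaussDiagram} (e : Extension G G')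

/-- The map of the arcs. -/
def arc (t : Family) : G.Arc t → G'.Arc t
  | .inl x => .inl (e.chord x)
  | .inr μ => .inr ⟨e.circle t μ.1, fun q hq => by
      obtain ⟨x, rfl⟩ := e.exists_chord t q _ hq
      rw [e.circ_chord] at hq
      exact μ.2 x (e.circle_injective t hq)⟩

theorem arcCirc_arc (t : Family) (a : G.Arc t) :
    G'.arcCirc t (e.arc t a) = e.circle t (G.arcCirc t a) := by
  rcases a with x | μ
  · exact e.circ_chord t x
  · rfl

theorem arc_injective (t : Family) : Function.Injective (e.arc t) := by
  rintro (x | μ) (y | ν) h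
  · exact congrArg _ (e.chord_injective (Sum.inl_injective h))
  · cases h
  · cases h
  · have := congrArg Subtype.val (Sum.inr_injective h)
    exact congrArg _ (Subtype.ext (e.circle_injective t this))

theorem exists_arc (t : Family) (a : G'.Arc t) (μ : G.Circ t)
    (h : G'.arcCirc t a = e.circle t μ) : ∃ b, a = e.arc t b := by
  rcases a with q | ν
  · obtain ⟨x, rfl⟩ := e.exists_chord t q μ h
    exact ⟨.inl x, rfl⟩
  · refine ⟨.inr ⟨μ, fun x hx => ν.2 (e.chord x) ?_⟩, congrArg _ (Subtype.ext h)⟩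
    rw [e.circ_chord, hx]
    exact h.symm

theorem arcAt_chord (t : Family) (p : G.Chord) (ε : ℤˣ) :
    G'.arcAt t (e.chord p) ε = e.chord (G.arcAt t p ε) := by
  unfold GaussDiagram.arcAt
  split_ifs
  · rfl
  · rw [Equiv.symm_apply_eq, e.next_chord, Equiv.apply_symm_apply]

/-- The cycles of the larger diagram are those of the smaller one, and those that are indexed by
`X`: these are the cycles of the additional arcs. -/
theorem card_cycle {X : Type*} [Finite X] (ξ : ∀ t (a : G'.Arc t), (∀ b, a ≠ e.arc t b) → Side → X)
    (hξ : ∀ p, (∀ x, p ≠ e.chord x) → ∀ t t' q q' h h' k k',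
      ξ t (.inl q) h k = ξ t' (.inl q') h' k')
    (x : X → G'.Cycle)
    (hx : ∀ t a k h, G'.cycle t a k = x (ξ t a h k))
    (hx' : ∀ y, ∃ t a k h, ξ t a h k = y) :
    Nat.card G'.Cycle = Nat.card G.Cycle + Nat.card X := by
  classical
  obtain ⟨F, hF, hF'⟩ := G.exists_cycle_lift .plus
    (fun a k => G'.cycle .plus (e.arc .plus a) k)
    (fun a k => G'.cycle .minus (e.arc .minus a) k) (by
      intro p i j
      have := G'.cycle_corner .plus (e.chord p) i j
      rw [e.sign_chord, e.arcAt_chord, e.arcAt_chord] at this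
      exact this)
  have hF : ∀ t a k, F (G.cycle t a k) = G'.cycle t (e.arc t a) k := by
    rintro (_ | _)
    exacts [hF, hF']
  let f : ∀ t, G'.Arc t → Side → G.Cycle ⊕ X := fun t a k =>
    if h : ∃ b, a = e.arc t b then .inl (G.cycle t h.choose k) else
      .inr (ξ t a (not_exists.1 h) k)
  have hf1 : ∀ t b k, f t (e.arc t b) k = .inl (G.cycle t b k) := by
    intro t b k
    have h : ∃ b', e.arc t b = e.arc t b' := ⟨b, rfl⟩
    simp only [f, dif_pos h]
    rw [← e.arc_injective t h.choose_spec]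
  have hf2 : ∀ t a k h, f t a k = .inr (ξ t a h k) := by
    intro t a k h
    exact dif_neg (not_exists.2 h)
  -- Arcs at an additional chord are additional, since the image of the old chords is closed under
  -- `next` and its inverse. Hence no corner mixes old and additional arcs.
  have hf3 : ∀ p, (∀ x, p ≠ e.chord x) → ∀ t ε b, .inl (G'.arcAt t p ε) ≠ e.arc t b := by
    rintro p hp t ε (y | μ) h
    · have h := Sum.inl_injective h
      unfold GaussDiagram.arcAt at h
      split_ifs at h
      · exact hp y h
      · rw [Equiv.symm_apply_eq, e.next_chord] at h
        exact hp _ h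
    · cases h
  obtain ⟨H, hH, hH'⟩ := G'.exists_cycle_lift .plus (f .plus) (f .minus) (by
    intro q i j
    by_cases hq : ∃ p, q = e.chord p
    · obtain ⟨p, rfl⟩ := hq
      rw [e.sign_chord, e.arcAt_chord, e.arcAt_chord]
      exact (hf1 .plus (.inl _) i).trans (.trans (congrArg _ (G.cycle_corner .plus p i j))
        (hf1 .minus (.inl _) j).symm)
    · push Not at hq
      exact (hf2 _ _ _ (hf3 q hq .plus _)).trans
        ((congrArg _ (hξ q hq _ _ _ _ _ _ _ _)).trans (hf2 _ _ _ (hf3 q hq .minus _)).symm))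
  have hH : ∀ t a k, H (G'.cycle t a k) = f t a k := by
    rintro (_ | _)
    exacts [hH, hH']
  have equiv : G.Cycle ⊕ X ≃ G'.Cycle := by
    refine ⟨Sum.elim F x, H, ?_, ?_⟩
    · rintro (z | y)
      · refine G.cycle_ind (P := fun z => H (F z) = .inl z) (fun t a k => ?_) z
        rw [hF, hH, hf1]
      · obtain ⟨t, a, k, ha, rfl⟩ := hx' y
        change H (x _) = _
        rw [← hx t a k ha, hH, hf2 _ _ _ ha]
    · intro z
      refine G'.cycle_ind (P := fun z => Sum.elim F x (H z) = z) (fun t a k => ?_) z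
      rw [hH]
      by_cases ha : ∃ b, a = e.arc t b
      · obtain ⟨b, rfl⟩ := ha
        rw [hf1]
        exact hF _ _ _
      · push Not at ha
        rw [hf2 _ _ _ ha]
        exact (hx _ _ _ ha).symm
  rw [← Nat.card_congr equiv, Nat.card_sum]

end GaussDiagram.Extension

/-! ### S-move -/

namespace DecoratedGaussDiagram

namespace SMove

variable {G G' : DecoratedGaussDiagram} (m : SMove G G')

/-- The old part of the diagram. -/
def extension : GaussDiagram.Extension G.toGaussDiagram G'.toGaussDiagram where
  circle t μ := m.circle t (some μ)
  circle_injective t := (m.circle t).injective.comp (Option.some_injective _)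
  chord x := m.chord (some x)
  chord_injective := m.chord.injective.comp (Option.some_injective _)
  sign_chord := m.sign_old
  circ_chord := m.circ_old
  next_chord := m.next_old
  exists_chord t q μ h := by
    obtain ⟨o | x, rfl⟩ := m.chord.surjective q
    · rw [m.circ_new] at h
      exact absurd ((m.circle t).injective h) (by simp)
    · exact ⟨x, rfl⟩

theorem arc_cases (t : Family) (a : G'.Arc t) :
    (∃ b, a = m.extension.arc t b) ∨ a = .inl (m.chord none) := by
  obtain ⟨o | μ, h⟩ := (m.circle t).surjective (G'.arcCirc t a)
  · rcases a with q | ν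
    · obtain ⟨_ | x, rfl⟩ := m.chord.surjective q
      · exact .inr rfl
      · exact .inl ⟨.inl x, rfl⟩
    · exact absurd ((m.circ_new t).trans h) (ν.2 _)
  · exact .inl (m.extension.exists_arc t a μ h.symm)

theorem col_arc (t : Family) (a : G.Arc t) (k : Side) :
    G'.col t (m.extension.arc t a) k = m.colors (G.col t a k) := by
  rcases a with x | μ
  · exact m.color_old t x k
  · exact m.color_free t μ _ k rfl

theorem next_new (t : Family) : G'.next t (m.chord none) = m.chord none := by
  obtain ⟨o | x, h⟩ := m.chord.surjective (G'.next t (m.chord none))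
  · exact h.symm
  · have := G'.circ_next t (m.chord none)
    rw [← h, m.circ_old, m.circ_new] at this
    exact absurd ((m.circle t).injective this) (by simp)

/-- Each new circle has a single edge, both of whose ends are at the new chord, so the corners of
this chord connect all sides of the two edges. -/
theorem cycle_new (t t' : Family) (k k' : Side) :
    G'.cycle t (.inl (m.chord none)) k = G'.cycle t' (.inl (m.chord none)) k' := by
  have h : ∀ t ε, G'.arcAt t (m.chord none) ε = m.chord none := by
    intro t ε
    unfold GaussDiagram.arcAt
    split_ifs
    · rfl
    · rw [Equiv.symm_apply_eq, next_new]
  have h1 : ∀ i j, G'.cycle .plus (.inl (m.chord none)) i =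
      G'.cycle .minus (.inl (m.chord none)) j := by
    intro i j
    have := G'.cycle_corner .plus (m.chord none) i j
    rwa [h, h] at this
  cases t <;> cases t'
  · exact (h1 k .left).trans (h1 k' .left).symm
  · exact h1 k k'
  · exact (h1 k' k).symm
  · exact (h1 .left k).symm.trans (h1 .left k')

theorem card_cycle (m : SMove G G') : Nat.card G'.Cycle = Nat.card G.Cycle + 1 := by
  have hne : ∀ t b, .inl (m.chord none) ≠ m.extension.arc t b := by
    intro t b h
    have := congrArg (G'.arcCirc t) h
    rw [m.extension.arcCirc_arc] at this
    exact absurd ((m.circle t).injective ((m.circ_new t).symm.trans this)) (by simp)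
  rw [m.extension.card_cycle (X := Unit) (fun _ _ _ _ => ())
    (fun _ _ _ _ _ _ _ _ _ _ => rfl)
    (fun _ => G'.cycle .plus (.inl (m.chord none)) .right) ?_ ?_, Nat.card_unique (α := Unit)]
  · intro t a k ha
    obtain ⟨b, hb⟩ | rfl := m.arc_cases t a
    · exact absurd hb (ha b)
    · exact m.cycle_new _ _ _ _
  · exact fun _ => ⟨.plus, _, .right, hne .plus, rfl⟩

/-- All sides of the new edges have the same color, so the new circles impose no relation and the
bijection of colors suffices. -/
theorem card_colorClass (m : SMove G G') (s : Family) :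
    Nat.card (G.ColorClass s) = Nat.card (G'.ColorClass s) := by
  refine Nat.card_congr_of_quot (r := G.ColorRel s) (r' := G'.ColorRel s)
    (fun c => Quot.mk _ (m.colors.symm c)) (fun c => Quot.mk _ (m.colors c)) ?_ ?_ ?_ ?_
  · rintro _ _ (⟨t, ht, a, k, l⟩ | ⟨a, b, k, h⟩)
    · obtain ⟨b, rfl⟩ | rfl := m.arc_cases t a
      · simp only [col_arc, Equiv.symm_apply_apply]
        exact Quot.sound (.arc t ht _ _ _)
      · rw [m.color_new, m.color_new]
    · obtain ⟨a, rfl⟩ | rfl := m.arc_cases s a <;> obtain ⟨b, rfl⟩ | rfl := m.arc_cases s b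
      · simp only [col_arc, Equiv.symm_apply_apply]
        rw [m.extension.arcCirc_arc, m.extension.arcCirc_arc] at h
        exact Quot.sound (.cap _ _ _ (m.extension.circle_injective s h))
      · rw [m.extension.arcCirc_arc] at h
        exact absurd ((m.circle s).injective (h.trans (m.circ_new s))) (by simp)
      · rw [m.extension.arcCirc_arc] at h
        exact absurd ((m.circle s).injective (h.symm.trans (m.circ_new s))) (by simp)
      · rfl
  · rintro _ _ (⟨t, ht, a, k, l⟩ | ⟨a, b, k, h⟩)
    · rw [← m.col_arc, ← m.col_arc]
      exact Quot.sound (.arc t ht _ _ _)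
    · rw [← m.col_arc, ← m.col_arc]
      refine Quot.sound (.cap _ _ _ ?_)
      rw [m.extension.arcCirc_arc, m.extension.arcCirc_arc, h]
  · intro c
    exact congrArg _ (m.colors.symm_apply_apply c)
  · intro c
    exact congrArg _ (m.colors.apply_symm_apply c)

theorem boundaryGenus_eq (m : SMove G G') (s : Family) :
    G.boundaryGenus s = G'.boundaryGenus s := by
  rw [DecoratedGaussDiagram.boundaryGenus_eq, DecoratedGaussDiagram.boundaryGenus_eq,
    m.card_colorClass, m.card_cycle, ← Nat.card_congr m.chord, ← Nat.card_congr m.colors,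
    ← Nat.card_congr (m.circle s), Finite.card_option, Finite.card_option]
  push_cast
  ring

end SMove

end DecoratedGaussDiagram

/-! ### B-move -/

namespace DecoratedGaussDiagram

namespace BMove

variable {G G' : DecoratedGaussDiagram} (m : BMove G G')

theorem exists_circle_pi : ∃ κ : ∀ t, G.Circ t → G'.Circ t,
    κ m.s = (fun μ => m.circle (some μ)) ∧ κ m.s.other = m.circleOther :=
  m.s.exists_pi (β := fun t => G.Circ t → G'.Circ t) _ _

/-- The old part of the diagram. -/
noncomputable def extension : GaussDiagram.Extension G.toGaussDiagram G'.toGaussDiagram where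
  circle := m.exists_circle_pi.choose
  circle_injective t := by
    rcases m.s.eq_or_eq_other t with rfl | rfl
    · rw [m.exists_circle_pi.choose_spec.1]
      exact m.circle.injective.comp (Option.some_injective _)
    · rw [m.exists_circle_pi.choose_spec.2]
      exact m.circleOther.injective
  chord := m.chord
  chord_injective := m.chord.injective
  sign_chord := m.sign_old
  circ_chord t x := by
    rcases m.s.eq_or_eq_other t with rfl | rfl
    · rw [m.exists_circle_pi.choose_spec.1]
      exact m.circ_old x
    · rw [m.exists_circle_pi.choose_spec.2]
      exact m.circ_old_other x
  next_chord := m.next_old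
  exists_chord t q μ h := ⟨m.chord.symm q, (m.chord.apply_symm_apply q).symm⟩

theorem extension_circle (μ : G.Circ m.s) : m.extension.circle m.s μ = m.circle (some μ) :=
  congrFun m.exists_circle_pi.choose_spec.1 μ

theorem extension_circle_other (μ : G.Circ m.s.other) :
    m.extension.circle m.s.other μ = m.circleOther μ :=
  congrFun m.exists_circle_pi.choose_spec.2 μ

theorem circ_ne_bubble (q : G'.Chord) : G'.circ m.s q ≠ m.circle none := by
  obtain ⟨x, rfl⟩ := m.chord.surjective q
  rw [m.circ_old]
  exact fun h => by simpa using m.circle.injective h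

/-- The new circle. -/
def bubble : G'.Arc m.s := .inr ⟨m.circle none, m.circ_ne_bubble⟩

theorem col_bubble_side : G'.col m.s m.bubble m.side = m.colors none :=
  m.color_bubble_new _ rfl

theorem col_bubble_opp : G'.col m.s m.bubble m.side.opp = m.colors (some m.c) :=
  m.color_bubble_old _ rfl

theorem arc_cases (a : G'.Arc m.s) : (∃ b, a = m.extension.arc m.s b) ∨ a = m.bubble := by
  obtain ⟨_ | μ, h⟩ := m.circle.surjective (G'.arcCirc m.s a)
  · rcases a with q | ν
    · exact absurd h.symm (m.circ_ne_bubble q)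
    · exact .inr (congrArg _ (Subtype.ext h.symm))
  · exact .inl (m.extension.exists_arc m.s a μ (by rw [extension_circle, h]))

theorem exists_arc_other (t : Family) (ht : t ≠ m.s) (a : G'.Arc t) :
    ∃ b, a = m.extension.arc t b := by
  obtain rfl := (m.s.ne_iff t).1 ht
  obtain ⟨μ, h⟩ := m.circleOther.surjective (G'.arcCirc _ a)
  exact m.extension.exists_arc _ a μ (by rw [extension_circle_other, h])

theorem arcCirc_arc_ne (a : G.Arc m.s) :
    G'.arcCirc m.s (m.extension.arc m.s a) ≠ G'.arcCirc m.s m.bubble := by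
  rw [m.extension.arcCirc_arc, extension_circle]
  exact fun h => by simpa using m.circle.injective h

theorem col_arc (t : Family) (a : G.Arc t) (k : Side) :
    G'.col t (m.extension.arc t a) k = m.colors (some (G.col t a k)) := by
  rcases a with x | μ
  · exact m.color_old t x k
  · rcases m.s.eq_or_eq_other t with rfl | rfl
    · exact m.color_free μ _ k (m.extension_circle _)
    · exact m.color_free_other μ _ k (m.extension_circle_other _)

theorem card_cycle (m : BMove G G') : Nat.card G'.Cycle = Nat.card G.Cycle + 2 := by
  have h := m.extension.card_cycle (X := Side) (fun _ _ _ k => k)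
    (fun p hp => absurd (m.chord.apply_symm_apply p).symm (hp _))
    (fun k => G'.cycle m.s m.bubble k) ?_ ?_
  · rw [h, Nat.card_eq_fintype_card (α := Side)]
    rfl
  · intro t a k ha
    by_cases ht : t = m.s
    · subst ht
      obtain ⟨b, hb⟩ | rfl := m.arc_cases a
      · exact absurd hb (ha b)
      · rfl
    · obtain ⟨b, hb⟩ := m.exists_arc_other t ht a
      exact absurd hb (ha b)
  · exact fun k => ⟨m.s, m.bubble, k, fun b h => m.arcCirc_arc_ne b (congrArg _ h).symm, rfl⟩

theorem colorRel_arc {s : Family} {c d : G.Color} (h : G.ColorRel s c d) :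
    G'.ColorRel s (m.colors (some c)) (m.colors (some d)) := by
  rcases h with ⟨t, ht, a, k, l⟩ | ⟨a, b, k, h⟩
  · rw [← m.col_arc, ← m.col_arc]
    exact .arc t ht _ _ _
  · rw [← m.col_arc, ← m.col_arc]
    refine .cap _ _ _ ?_
    rw [m.extension.arcCirc_arc, m.extension.arcCirc_arc, h]

/-- For this surgery the bubble is crossed rather than capped, so the new region joins the region of
the color `m.c`. -/
theorem card_colorClass_other (m : BMove G G') (s : Family) (hs : s ≠ m.s) :
    Nat.card (G.ColorClass s) = Nat.card (G'.ColorClass s) := by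
  let g : G'.Color → G.ColorClass s := fun c' =>
    (m.colors.symm c').elim (Quot.mk _ m.c) (Quot.mk _)
  have hg : ∀ t a k, g (G'.col t (m.extension.arc t a) k) = Quot.mk _ (G.col t a k) := by
    intro t a k
    simp only [g, col_arc, Equiv.symm_apply_apply]
    rfl
  have hgb : ∀ k, g (G'.col m.s m.bubble k) = Quot.mk _ m.c := by
    intro k
    by_cases hk : k = m.side
    · subst hk
      simp only [g, col_bubble_side, Equiv.symm_apply_apply]
      rfl
    · rw [← ne_eq, Side.ne_iff] at hk
      subst hk
      simp only [g, col_bubble_opp, Equiv.symm_apply_apply]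
      rfl
  refine Nat.card_congr_of_quot g (fun c => Quot.mk _ (m.colors (some c))) ?_
    (fun c d h => Quot.sound (m.colorRel_arc h)) ?_ ?_
  · rintro _ _ (⟨t, ht, a, k, l⟩ | ⟨a, b, k, h⟩)
    · by_cases ht' : t = m.s
      · subst ht'
        obtain ⟨a, rfl⟩ | rfl := m.arc_cases a
        · rw [hg, hg]
          exact Quot.sound (.arc _ ht _ _ _)
        · rw [hgb, hgb]
      · obtain ⟨a, rfl⟩ := m.exists_arc_other t ht' a
        rw [hg, hg]
        exact Quot.sound (.arc t ht _ _ _)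
    · obtain ⟨a, rfl⟩ := m.exists_arc_other s hs a
      obtain ⟨b, rfl⟩ := m.exists_arc_other s hs b
      rw [hg, hg]
      rw [m.extension.arcCirc_arc, m.extension.arcCirc_arc] at h
      exact Quot.sound (.cap _ _ _ (m.extension.circle_injective s h))
  · intro c
    simp only [g, Equiv.symm_apply_apply]
    rfl
  · intro c'
    obtain ⟨_ | c, rfl⟩ := m.colors.surjective c'
    · simp only [g, Equiv.symm_apply_apply]
      rw [← m.col_bubble_side]
      refine .trans ?_ (Quot.sound (.arc m.s hs.symm _ m.side.opp _))
      rw [m.col_bubble_opp]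
      rfl
    · simp only [g, Equiv.symm_apply_apply]
      rfl

/-- The new color occurs only on one side of the bubble. Surgery caps it there, which splits off a
sphere: the additional class `none`. -/
theorem card_colorClass (m : BMove G G') :
    Nat.card (G'.ColorClass m.s) = Nat.card (G.ColorClass m.s) + 1 := by
  let g : G'.Color → Option (G.ColorClass m.s) := fun c' =>
    (m.colors.symm c').map (Quot.mk _)
  have hg : ∀ t a k, g (G'.col t (m.extension.arc t a) k) = some (Quot.mk _ (G.col t a k)) := by
    intro t a k
    simp only [g, col_arc, Equiv.symm_apply_apply]
    rfl
  have hgr : ∀ c d, G'.ColorRel m.s c d → g c = g d := by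
    rintro _ _ (⟨t, ht, a, k, l⟩ | ⟨a, b, k, h⟩)
    · obtain ⟨a, rfl⟩ := m.exists_arc_other t ht a
      rw [hg, hg]
      exact congrArg _ (Quot.sound (.arc t ht _ _ _))
    · obtain ⟨a, rfl⟩ | rfl := m.arc_cases a <;> obtain ⟨b, rfl⟩ | rfl := m.arc_cases b
      · rw [hg, hg]
        rw [m.extension.arcCirc_arc, m.extension.arcCirc_arc] at h
        exact congrArg _ (Quot.sound (.cap _ _ _ (m.extension.circle_injective _ h)))
      · exact absurd h (m.arcCirc_arc_ne _)
      · exact absurd h.symm (m.arcCirc_arc_ne _)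
      · rfl
  have e : Option (G.ColorClass m.s) ≃ G'.ColorClass m.s := by
    refine ⟨fun o => o.elim (Quot.mk _ (m.colors none))
      (Quot.lift (fun c => Quot.mk _ (m.colors (some c)))
        (fun c d h => Quot.sound (m.colorRel_arc h))), Quot.lift g hgr, ?_, ?_⟩
    · rintro (_ | ⟨⟨c⟩⟩) <;> simp [g]
    · rintro ⟨c'⟩
      obtain ⟨_ | c, rfl⟩ := m.colors.surjective c' <;> simp [g]
  rw [← Nat.card_congr e, Finite.card_option]

theorem boundaryGenus_eq (m : BMove G G') (s : Family) :
    G.boundaryGenus s = G'.boundaryGenus s := by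
  rw [DecoratedGaussDiagram.boundaryGenus_eq, DecoratedGaussDiagram.boundaryGenus_eq,
    m.card_cycle, ← Nat.card_congr m.chord, ← Nat.card_congr m.colors, Finite.card_option]
  by_cases hs : s = m.s
  · subst hs
    rw [m.card_colorClass, ← Nat.card_congr m.circle, Finite.card_option]
    push_cast
    ring
  · rw [m.card_colorClass_other s hs]
    obtain rfl := (m.s.ne_iff s).1 hs
    rw [← Nat.card_congr m.circleOther]
    push_cast
    ring

end BMove

end DecoratedGaussDiagram

/-! ### H-move: chords and corners after the slide -/

theorem Side.exists_mul_sgn (ε η : ℤˣ) : ∃ k : Side, ε * k.sgn = η := by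
  rcases Int.units_eq_one_or ε with rfl | rfl <;> rcases Int.units_eq_one_or η with rfl | rfl
  exacts [⟨.right, by decide⟩, ⟨.left, by decide⟩, ⟨.left, by decide⟩, ⟨.right, by decide⟩]

theorem Side.eq_or_eq_opp (k l : Side) : k = l ∨ k = l.opp := by
  cases k <;> cases l <;> decide

namespace GaussDiagram

variable (G : GaussDiagram)

/-- The edge of the circle `μ` leaving or entering a chord on it. -/
def arcOn (s : Family) {μ : G.Circ s} (p : G.OnCircle s μ) (ε : ℤˣ) : G.OnCircle s μ :=
  ⟨G.arcAt s p.1 ε, (G.circ_arcAt s p.1 ε).trans p.2⟩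

end GaussDiagram

namespace DecoratedGaussDiagram

namespace HMove

variable {G G' : DecoratedGaussDiagram} (m : HMove G G')

/-- The chord at which the copy of the edge `x` starts, unless this edge is cut open. -/
abbrev last (x : G.OnCircle m.s m.μ) : G.OnCircle m.s m.μ :=
  G.slideLast m.s m.μ m.slidSide m.baseSide x

/-- The order of the chords on the copy. -/
abbrev step : Equiv.Perm (G.OnCircle m.s m.μ) :=
  G.slideStep m.s m.μ m.slidSide m.baseSide

/-- The first crossing on the other circle near the chord `x`. -/
noncomputable abbrev fstChord (x : G.Chord) : G'.Chord :=
  G.pairFst m.s m.μ m.baseSide m.old m.copy x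

/-- The second crossing on the other circle near the chord `x`. -/
noncomputable abbrev sndChord (x : G.Chord) : G'.Chord :=
  G.pairSnd m.s m.μ m.baseSide m.old m.copy x

theorem old_inj {x y : G.Chord} : m.old x = m.old y ↔ x = y :=
  ⟨fun h => Sum.inl_injective (m.chords.1 (a₁ := .inl x) (a₂ := .inl y) h), fun h => h ▸ rfl⟩

theorem copy_inj {x y} : m.copy x = m.copy y ↔ x = y :=
  ⟨fun h => Sum.inr_injective (m.chords.1 (a₁ := .inr x) (a₂ := .inr y) h), fun h => h ▸ rfl⟩

theorem old_ne_copy (x : G.Chord) (y) : m.old x ≠ m.copy y :=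
  fun h => Sum.inl_ne_inr (m.chords.1 (a₁ := .inl x) (a₂ := .inr y) h)

theorem last_bijective : Function.Bijective m.last := by
  unfold last slideLast
  split_ifs
  · exact Function.bijective_id
  · exact (G.nextOn m.s m.μ).bijective

theorem exists_old_or_copy (q : G'.Chord) : (∃ x, q = m.old x) ∨ ∃ x, q = m.copy x := by
  obtain ⟨x | x, rfl⟩ := m.chords.2 q
  exacts [.inl ⟨x, rfl⟩, .inr ⟨x, rfl⟩]

theorem exists_old_or_copy_last (q : G'.Chord) :
    (∃ x, q = m.old x) ∨ ∃ x, q = m.copy (m.last x) := by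
  obtain h | ⟨y, rfl⟩ := m.exists_old_or_copy q
  · exact .inl h
  · obtain ⟨x, rfl⟩ := m.last_bijective.2 y
    exact .inr ⟨x, rfl⟩

theorem circ_of_slid {z : G.Chord} (h : m.slid = .inl z) : G.circ m.s z ≠ m.μ := by
  have := m.slid_circ
  rw [h] at this
  exact this

theorem symm_old (x : G.Chord) :
    (G'.next m.s).symm (m.old (G.next m.s x)) = m.old x ∨
    ∃ u : G.OnCircle m.s m.μ, m.base = .inl u.1 ∧ m.slid = .inl x ∧
      (G'.next m.s).symm (m.old (G.next m.s x)) = m.copy (m.last u) := by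
  simp only [Equiv.symm_apply_eq]
  by_cases h : ∃ u : G.OnCircle m.s m.μ, m.base = .inl u.1 ∧ m.slid = .inl x
  · obtain ⟨u, hu, hx⟩ := h
    exact .inr ⟨u, hu, hx, (m.next_last u x hu hx).symm⟩
  · left
    rw [m.next_old]
    exact fun u hu hx => h ⟨u, hu, hx⟩

/-- The copy of the edge `x` is a whole edge, unless `x` is the base edge and the slid arc is
bounded by chords; then the inserted run is entered from the slid arc. -/
theorem symm_copy (x : G.OnCircle m.s m.μ) :
    (G'.next m.s).symm (m.copy (m.step (m.last x))) = m.copy (m.last x) ∨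
    ∃ z, m.base = .inl x.1 ∧ m.slid = .inl z ∧
      (G'.next m.s).symm (m.copy (m.step (m.last x))) = m.old z := by
  simp only [Equiv.symm_apply_eq]
  by_cases h : ∃ z, m.base = .inl x.1 ∧ m.slid = .inl z
  · obtain ⟨z, hx, hz⟩ := h
    exact .inr ⟨z, hx, hz, (m.next_slid x z hx hz).symm⟩
  · left
    rw [m.next_copy]
    intro u z hu hz hxu
    obtain rfl := m.last_bijective.1 hxu
    exact h ⟨z, hu, hz⟩

theorem arcAt_old (p : G.Chord) (ε : ℤˣ) :
    G'.arcAt m.s (m.old p) ε = m.old (G.arcAt m.s p ε) ∨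
    ∃ u : G.OnCircle m.s m.μ, m.base = .inl u.1 ∧ m.slid = .inl (G.arcAt m.s p ε) ∧
      G'.arcAt m.s (m.old p) ε = m.copy (m.last u) := by
  unfold GaussDiagram.arcAt
  split_ifs
  · exact .inl rfl
  · obtain ⟨x, rfl⟩ := (G.next m.s).surjective p
    rw [Equiv.symm_apply_apply]
    exact m.symm_old x

/-- Reversing the copy changes both its sign and its side. Therefore `slidSide` is always the outer
side of the copy, away from `μ`, and corresponds to `baseSide`. -/
theorem sign_copy_mul (p : G.OnCircle m.s m.μ) :
    G'.sign (m.copy p) * m.slidSide.sgn = G.sign p.1 * m.baseSide.sgn := by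
  rw [m.sign_copy]
  split_ifs with h
  · rw [h]
  · rw [(Side.ne_iff _ _).1 h, Side.sgn_opp, neg_mul_neg]

/-- At a crossing with the other curve, the copy is parallel to `μ`: its half on the side `j` of
that curve copies the half of `μ` there. The exception is the entry into the cut-open copy of the
base edge. -/
theorem arcAt_copy (p : G.OnCircle m.s m.μ) (j : Side) :
    G'.arcAt m.s (m.copy p) (m.s.sgn * G'.sign (m.copy p) * j.sgn) =
      m.copy (m.last (G.arcOn m.s p (m.s.sgn * G.sign p.1 * j.sgn))) ∨
    ∃ z, m.base = .inl (G.arcAt m.s p.1 (m.s.sgn * G.sign p.1 * j.sgn)) ∧ m.slid = .inl z ∧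
      G'.arcAt m.s (m.copy p) (m.s.sgn * G'.sign (m.copy p) * j.sgn) = m.old z := by
  rw [m.sign_copy]
  by_cases h : m.slidSide = m.baseSide
  · rw [if_pos h]
    have h1 : ∀ x, m.last x = x := fun x => if_pos h
    have h2 : m.step = G.nextOn m.s m.μ := if_pos h
    rcases Int.units_eq_one_or (m.s.sgn * G.sign p.1 * j.sgn) with h3 | h3
    · rw [h3, h1]
      exact .inl rfl
    · rw [h3]
      obtain ⟨x, rfl⟩ := (G.nextOn m.s m.μ).surjective p
      have h4 : G.arcOn m.s (G.nextOn m.s m.μ x) (-1) = x :=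
        Subtype.ext ((G.next m.s).symm_apply_apply x.1)
      have h5 : G.arcAt m.s (G.nextOn m.s m.μ x).1 (-1) = x.1 := congrArg Subtype.val h4
      rw [h4, h5]
      have := m.symm_copy x
      rw [h2, h1] at this
      rw [h1]
      exact this
  · rw [if_neg h, mul_neg, neg_mul]
    have h1 : ∀ x, m.last x = G.nextOn m.s m.μ x := fun x => if_neg h
    have h2 : m.step = (G.nextOn m.s m.μ)⁻¹ := if_neg h
    rcases Int.units_eq_one_or (m.s.sgn * G.sign p.1 * j.sgn) with h3 | h3
    · rw [h3, GaussDiagram.arcAt_neg_one]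
      have := m.symm_copy p
      rw [h2, h1, show (G.nextOn m.s m.μ)⁻¹ (G.nextOn m.s m.μ p) = p from
        (G.nextOn m.s m.μ).symm_apply_apply p] at this
      rw [show G.arcOn m.s p 1 = p from rfl, h1]
      exact this
    · rw [h3, neg_neg, GaussDiagram.arcAt_one, h1]
      left
      congr 1
      exact Subtype.ext ((G.next m.s).apply_symm_apply p.1).symm

theorem fst_of_not {x : G.Chord} (h : G.circ m.s x ≠ m.μ) : m.fstChord x = m.old x :=
  dif_neg fun h' => h h'.1

theorem snd_of_not {x : G.Chord} (h : G.circ m.s x ≠ m.μ) : m.sndChord x = m.old x :=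
  dif_neg fun h' => h h'.1

/-- The order of the two crossings that replace the crossing at `p`. -/
theorem pair_cases (p : G.OnCircle m.s m.μ) :
    (m.s.sgn * G.sign p.1 * m.baseSide.sgn = 1 ∧
      m.fstChord p.1 = m.copy p ∧ m.sndChord p.1 = m.old p.1) ∨
    (m.s.sgn * G.sign p.1 * m.baseSide.sgn = -1 ∧
      m.fstChord p.1 = m.old p.1 ∧ m.sndChord p.1 = m.copy p) := by
  rcases Int.units_eq_one_or (m.s.sgn * G.sign p.1 * m.baseSide.sgn) with h | h
  · refine .inl ⟨h, dif_pos ⟨p.2, h⟩, dif_neg ?_⟩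
    rw [h]
    exact fun h' => absurd h'.2 (by decide)
  · refine .inr ⟨h, dif_neg ?_, dif_pos ⟨p.2, h⟩⟩
    rw [h]
    exact fun h' => absurd h'.2 (by decide)

theorem symm_fst (x : G.Chord) :
    (G'.next m.s.other).symm (m.fstChord (G.next m.s.other x)) = m.sndChord x := by
  rw [Equiv.symm_apply_eq]
  exact (m.next_link x).symm

theorem symm_snd (p : G.OnCircle m.s m.μ) :
    (G'.next m.s.other).symm (m.sndChord p.1) = m.fstChord p.1 := by
  rw [Equiv.symm_apply_eq]
  exact (m.next_pair p).symm

theorem arcAt_fst_neg_one (p : G.Chord) :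
    G'.arcAt m.s.other (m.fstChord p) (-1) = m.sndChord (G.arcAt m.s.other p (-1)) := by
  rw [GaussDiagram.arcAt_neg_one, GaussDiagram.arcAt_neg_one]
  obtain ⟨x, rfl⟩ := (G.next m.s.other).surjective p
  rw [symm_fst, Equiv.symm_apply_apply]

theorem arcAt_snd_neg_one (p : G.OnCircle m.s m.μ) :
    G'.arcAt m.s.other (m.sndChord p.1) (-1) = m.fstChord p.1 := by
  rw [GaussDiagram.arcAt_neg_one, symm_snd]

/-- Away from the strip, the other curve continues along an old arc; such an arc of `G'` starts at
the second crossing of a pair. -/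
theorem arcAt_other_old {p : G.Chord} {i : Side} (h : ¬(G.circ m.s p = m.μ ∧ i = m.baseSide)) :
    G'.arcAt m.s.other (m.old p) (m.s.other.sgn * G.sign p * i.sgn) =
      m.sndChord (G.arcAt m.s.other p (m.s.other.sgn * G.sign p * i.sgn)) := by
  by_cases hp : G.circ m.s p = m.μ
  · have hi : i = m.baseSide.opp := (Side.ne_iff _ _).1 fun hi => h ⟨hp, hi⟩
    subst hi
    rw [Family.sgn_other, Side.sgn_opp, neg_mul, neg_mul_neg]
    obtain ⟨h1, h2, h3⟩ | ⟨h1, h2, h3⟩ := m.pair_cases ⟨p, hp⟩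
    · rw [h1, GaussDiagram.arcAt_one, GaussDiagram.arcAt_one, h3]
    · rw [h1, ← arcAt_fst_neg_one, h2]
  · rcases Int.units_eq_one_or (m.s.other.sgn * G.sign p * i.sgn) with h1 | h1
    · rw [h1, GaussDiagram.arcAt_one, GaussDiagram.arcAt_one, m.snd_of_not hp]
    · rw [h1, ← arcAt_fst_neg_one, m.fst_of_not hp]

/-- On the side of the push-off, the other curve runs through the short edge across the strip, which
starts at the first crossing of the pair. -/
theorem arcAt_other_old_base (p : G.OnCircle m.s m.μ) :
    G'.arcAt m.s.other (m.old p.1) (m.s.other.sgn * G.sign p.1 * m.baseSide.sgn) =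
      m.fstChord p.1 := by
  rw [Family.sgn_other, neg_mul, neg_mul]
  obtain ⟨h1, h2, h3⟩ | ⟨h1, h2, h3⟩ := m.pair_cases p
  · rw [h1, ← h3, arcAt_snd_neg_one]
  · rw [h1, neg_neg, GaussDiagram.arcAt_one, h2]

theorem arcAt_other_copy (p : G.OnCircle m.s m.μ) :
    G'.arcAt m.s.other (m.copy p) (m.s.other.sgn * G'.sign (m.copy p) * m.slidSide.sgn) =
      m.sndChord (G.arcAt m.s.other p.1 (m.s.other.sgn * G.sign p.1 * m.baseSide.sgn)) := by
  rw [mul_assoc, sign_copy_mul, ← mul_assoc, Family.sgn_other, neg_mul, neg_mul]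
  obtain ⟨h1, h2, h3⟩ | ⟨h1, h2, h3⟩ := m.pair_cases p
  · rw [h1, ← h2, arcAt_fst_neg_one]
  · rw [h1, neg_neg, GaussDiagram.arcAt_one, GaussDiagram.arcAt_one, h3]

theorem arcAt_other_copy_opp (p : G.OnCircle m.s m.μ) :
    G'.arcAt m.s.other (m.copy p) (m.s.other.sgn * G'.sign (m.copy p) * m.slidSide.opp.sgn) =
      m.fstChord p.1 := by
  rw [Side.sgn_opp, mul_neg, mul_assoc, sign_copy_mul, ← mul_assoc, Family.sgn_other, neg_mul,
    neg_mul, neg_neg]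
  obtain ⟨h1, h2, h3⟩ | ⟨h1, h2, h3⟩ := m.pair_cases p
  · rw [h1, GaussDiagram.arcAt_one, h2]
  · rw [h1, ← h3, arcAt_snd_neg_one]

/-! ### The strip between the circle and its copy -/

/-- The short edge across the strip separates the small cycles over the two edges of `μ` that meet
at `p`. -/
theorem cycle_strip (p : G.OnCircle m.s m.μ) (j : Side) :
    G'.cycle m.s.other (.inl (m.fstChord p.1)) j =
      G'.cycle m.s (.inl (m.old (G.arcAt m.s p.1 (m.s.sgn * G.sign p.1 * j.sgn)))) m.baseSide := by
  have h := G'.cycle_corner m.s (m.old p.1) m.baseSide j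
  rw [m.sign_old, arcAt_other_old_base] at h
  obtain h1 | ⟨u, hu, hz, h1⟩ := m.arcAt_old p.1 (m.s.sgn * G.sign p.1 * j.sgn)
  · rw [← h, h1]
  · exact absurd ((G.circ_arcAt _ _ _).trans p.2) (m.circ_of_slid hz)

theorem cycle_strip_copy (p : G.OnCircle m.s m.μ) (j : Side) :
    G'.cycle m.s (.inl (G'.arcAt m.s (m.copy p) (m.s.sgn * G'.sign (m.copy p) * j.sgn)))
      m.slidSide.opp =
      G'.cycle m.s (.inl (m.old (G.arcAt m.s p.1 (m.s.sgn * G.sign p.1 * j.sgn)))) m.baseSide := by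
  rw [G'.cycle_corner, arcAt_other_copy_opp, cycle_strip]

theorem cycle_copy_opp (x : G.OnCircle m.s m.μ) :
    G'.cycle m.s (.inl (m.copy (m.last x))) m.slidSide.opp =
      G'.cycle m.s (.inl (m.old x.1)) m.baseSide := by
  -- Here `j` is the side of the other curve on which the copy leaves this crossing.
  obtain ⟨j, hj⟩ := Side.exists_mul_sgn (m.s.sgn * G'.sign (m.copy (m.last x))) 1
  have h := m.cycle_strip_copy (m.last x) j
  have h1 := m.arcAt_copy (m.last x) j
  rw [hj, GaussDiagram.arcAt_one] at h h1
  obtain h1 | ⟨z, -, -, h1⟩ := h1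
  · have h2 := congrArg Subtype.val (m.last_bijective.1 (m.copy_inj.1 h1))
    rw [h, h2]
    rfl
  · exact absurd h1.symm (m.old_ne_copy _ _)

/-- Over the base edge the strip is opened by the band, so its boundary continues along the far side
of the slid arc. -/
theorem cycle_slid_opp {u : G.OnCircle m.s m.μ} {z : G.Chord} (hu : m.base = .inl u.1)
    (hz : m.slid = .inl z) :
    G'.cycle m.s (.inl (m.old z)) m.slidSide.opp =
      G'.cycle m.s (.inl (m.old u.1)) m.baseSide := by
  have h0 : (G'.next m.s).symm (m.copy (m.step (m.last u))) = m.old z := by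
    rw [Equiv.symm_apply_eq, m.next_slid u z hu hz]
  obtain ⟨j, hj⟩ := Side.exists_mul_sgn (m.s.sgn * G'.sign (m.copy (m.step (m.last u)))) (-1)
  have h := m.cycle_strip_copy (m.step (m.last u)) j
  have h1 := m.arcAt_copy (m.step (m.last u)) j
  rw [hj, GaussDiagram.arcAt_neg_one, h0] at h h1
  obtain h1 | ⟨z', hu', -, h1⟩ := h1
  · exact absurd h1 (m.old_ne_copy _ _)
  · rw [h]
    rw [hu] at hu'
    rw [Sum.inl_injective hu']

end HMove

end DecoratedGaussDiagram

/-! ### H-move along a circle with chords: the number of cycles -/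

namespace DecoratedGaussDiagram

namespace HMove

variable {G G' : DecoratedGaussDiagram} (m : HMove G G')

theorem snd_eq_old_or_copy (x : G.Chord) :
    m.sndChord x = m.old x ∨ ∃ p : G.OnCircle m.s m.μ, p.1 = x ∧ m.sndChord x = m.copy p := by
  by_cases hx : G.circ m.s x = m.μ
  · obtain ⟨-, -, h⟩ | ⟨-, -, h⟩ := m.pair_cases ⟨x, hx⟩
    · exact .inl h
    · exact .inr ⟨_, rfl, h⟩
  · exact .inl (m.snd_of_not hx)

theorem snd_inj {x y : G.Chord} : m.sndChord x = m.sndChord y ↔ x = y := by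
  refine ⟨fun h => ?_, fun h => h ▸ rfl⟩
  obtain hx | ⟨p, rfl, hx⟩ := m.snd_eq_old_or_copy x <;>
    obtain hy | ⟨q, rfl, hy⟩ := m.snd_eq_old_or_copy y <;> rw [hx, hy] at h
  · exact m.old_inj.1 h
  · exact absurd h (m.old_ne_copy _ _)
  · exact absurd h.symm (m.old_ne_copy _ _)
  · exact congrArg _ (m.copy_inj.1 h)

theorem fst_inj {p q : G.OnCircle m.s m.μ} : m.fstChord p.1 = m.fstChord q.1 ↔ p = q := by
  refine ⟨fun h => ?_, fun h => h ▸ rfl⟩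
  obtain ⟨-, hx, -⟩ | ⟨-, hx, -⟩ := m.pair_cases p <;>
    obtain ⟨-, hy, -⟩ | ⟨-, hy, -⟩ := m.pair_cases q <;> rw [hx, hy] at h
  · exact m.copy_inj.1 h
  · exact absurd h.symm (m.old_ne_copy _ _)
  · exact absurd h (m.old_ne_copy _ _)
  · exact Subtype.ext (m.old_inj.1 h)

theorem fst_ne_snd (p : G.OnCircle m.s m.μ) (y : G.Chord) : m.fstChord p.1 ≠ m.sndChord y := by
  intro h
  obtain ⟨-, hx, hx'⟩ | ⟨-, hx, hx'⟩ := m.pair_cases p <;>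
    obtain hy | ⟨q, rfl, hy⟩ := m.snd_eq_old_or_copy y <;> rw [hx, hy] at h
  · exact m.old_ne_copy _ _ h.symm
  · obtain rfl := m.copy_inj.1 h
    exact m.old_ne_copy _ _ (hx'.symm.trans hy)
  · obtain rfl := m.old_inj.1 h
    exact m.old_ne_copy _ _ (hy.symm.trans hx')
  · exact m.old_ne_copy _ _ h

/-- On the other family this is the natural labeling of arcs: `sndChord x` starts the old arc `x`,
and `fstChord p` starts a short edge across the strip. -/
theorem exists_snd_or_fst (q : G'.Chord) :
    (∃ x, q = m.sndChord x) ∨ ∃ p : G.OnCircle m.s m.μ, q = m.fstChord p.1 := by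
  obtain ⟨x, rfl⟩ | ⟨p, rfl⟩ := m.exists_old_or_copy q
  · by_cases hx : G.circ m.s x = m.μ
    · obtain ⟨-, h1, h2⟩ | ⟨-, h1, h2⟩ := m.pair_cases ⟨x, hx⟩
      · exact .inl ⟨x, h2.symm⟩
      · exact .inr ⟨_, h1.symm⟩
    · exact .inl ⟨x, (m.snd_of_not hx).symm⟩
  · obtain ⟨-, h1, h2⟩ | ⟨-, h1, h2⟩ := m.pair_cases p
    · exact .inr ⟨_, h1.symm⟩
    · exact .inl ⟨_, h2.symm⟩

theorem circ_other_snd (x : G.Chord) :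
    G'.circ m.s.other (m.sndChord x) = m.circle m.s.other (G.circ m.s.other x) := by
  obtain h | ⟨p, rfl, h⟩ := m.snd_eq_old_or_copy x
  · rw [h, m.circ_old]
  · rw [h, m.circ_copy_other]

theorem circ_other_fst (p : G.OnCircle m.s m.μ) :
    G'.circ m.s.other (m.fstChord p.1) = m.circle m.s.other (G.circ m.s.other p.1) := by
  obtain ⟨-, h, -⟩ | ⟨-, h, -⟩ := m.pair_cases p
  · rw [h, m.circ_copy_other]
  · rw [h, m.circ_old]

theorem circle_free {ν : G.FreeCircle m.s}
    (h : m.slid ≠ .inr ν) (q : G'.Chord) :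
    G'.circ m.s q ≠ m.circle m.s ν.1 := by
  intro hq
  obtain ⟨x, rfl⟩ | ⟨x, rfl⟩ := m.exists_old_or_copy q
  · rw [m.circ_old] at hq
    exact ν.2 x ((m.circle m.s).injective hq)
  · rw [m.circ_copy] at hq
    have hq := (m.circle m.s).injective hq
    rcases h' : m.slid with z | ρ
    · rw [h'] at hq
      exact ν.2 z hq
    · rw [h'] at hq
      exact h (h'.trans (congrArg _ (Subtype.ext hq)))

open Classical in
/-- The side of an arc of `G'` on which a side of an arc of the family of the slide lies. -/
noncomputable def lift (u : G.OnCircle m.s m.μ) : G.Arc m.s → Side → G'.Arc m.s × Side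
  | .inl x, k => if h : G.circ m.s x = m.μ ∧ k = m.baseSide then
      (.inl (m.copy (m.last ⟨x, h.1⟩)), m.slidSide) else (.inl (m.old x), k)
  | .inr ν, k => if h : m.slid = .inr ν then (.inl (m.copy (m.last u)), k) else
      (.inr ⟨m.circle m.s ν.1, m.circle_free h⟩, k)

/-- The arc of `G'` that lies on an arc of the other family. -/
noncomputable def liftOther : G.Arc m.s.other → G'.Arc m.s.other
  | .inl x => .inl (m.sndChord x)
  | .inr ν => .inr ⟨m.circle m.s.other ν.1, fun q h => by
      obtain ⟨x, rfl⟩ | ⟨p, rfl⟩ := m.exists_snd_or_fst q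
      · rw [circ_other_snd] at h
        exact ν.2 _ ((m.circle _).injective h)
      · rw [circ_other_fst] at h
        exact ν.2 _ ((m.circle _).injective h)⟩

/-- The free circle of `G` from which a free circle of `G'` comes. -/
def originFree (t : Family) (ν : G'.FreeCircle t) : G.FreeCircle t :=
  ⟨(m.circle t).symm ν.1, fun x h => ν.2 (m.old x) (by
      rw [m.circ_old, h, Equiv.apply_symm_apply])⟩

theorem circle_originFree (t : Family) (ν : G'.FreeCircle t) :
    ν.1 = m.circle t (m.originFree t ν).1 := ((m.circle t).apply_symm_apply _).symm

variable (u : G.OnCircle m.s m.μ)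

theorem lift_on (x : G.OnCircle m.s m.μ) :
    m.lift u (.inl x.1) m.baseSide = (.inl (m.copy (m.last x)), m.slidSide) :=
  dif_pos ⟨x.2, rfl⟩

theorem lift_off {x : G.Chord} {k : Side} (h : ¬(G.circ m.s x = m.μ ∧ k = m.baseSide)) :
    m.lift u (.inl x) k = (.inl (m.old x), k) := dif_neg h

theorem lift_slid {ν : G.FreeCircle m.s} (h : m.slid = .inr ν) (k : Side) :
    m.lift u (.inr ν) k = (.inl (m.copy (m.last u)), k) := dif_pos h

theorem slid_ne_originFree (u : G.OnCircle m.s m.μ) (ν : G'.FreeCircle m.s) :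
    m.slid ≠ .inr (m.originFree m.s ν) := by
  intro h
  refine ν.2 (m.copy u) ?_
  rw [m.circ_copy, h, m.circle_originFree m.s ν]
  rfl

theorem lift_originFree (ν : G'.FreeCircle m.s) (k : Side) :
    m.lift u (.inr (m.originFree m.s ν)) k = (.inr ν, k) := by
  rw [lift, dif_neg (m.slid_ne_originFree u ν)]
  exact congrArg (fun ρ => (Sum.inr ρ, k)) (Subtype.ext (m.circle_originFree _ _).symm)

theorem liftOther_originFree (ν : G'.FreeCircle m.s.other) :
    m.liftOther (.inr (m.originFree m.s.other ν)) = .inr ν :=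
  congrArg _ (Subtype.ext (m.circle_originFree _ _).symm)

theorem lift_free {ν : G.FreeCircle m.s} (h : m.slid ≠ .inr ν) :
    ∃ ρ : G'.FreeCircle m.s, m.originFree m.s ρ = ν ∧ ∀ k, m.lift u (.inr ν) k = (.inr ρ, k) :=
  ⟨⟨m.circle m.s ν.1, m.circle_free h⟩,
    Subtype.ext ((m.circle m.s).symm_apply_apply _), fun _ => dif_neg h⟩

/-- The cycle of `G'` on a side of an arc of `G`. -/
noncomputable def liftCycle (a : G.Arc m.s) (k : Side) : G'.Cycle :=
  G'.cycle m.s (m.lift u a k).1 (m.lift u a k).2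

theorem liftCycle_slid_opp (hu : m.base = .inl u.1) :
    m.liftCycle u m.slid m.slidSide.opp = G'.cycle m.s (.inl (m.old u.1)) m.baseSide := by
  unfold liftCycle
  rcases h : m.slid with z | ν
  · rw [m.lift_off u fun h' => m.circ_of_slid h h'.1]
    exact m.cycle_slid_opp hu h
  · rw [m.lift_slid u h]
    exact m.cycle_copy_opp u

/-- The cycles of `G`, with the two cycles joined by the band identified. -/
abbrev Glued : Type :=
  Glue (G.cycle m.s m.slid m.slidSide) (G.cycle m.s m.base m.baseSide)

/-- The cycles of `G'`, with the two cycles along the band identified. -/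
abbrev Glued' : Type :=
  Glue (m.liftCycle u m.slid m.slidSide) (m.liftCycle u m.base m.baseSide)

/-- The two parts of the slid arc are identified on the chosen side by definition; on the far side
both already border the opened strip. -/
theorem glued'_last (hu : m.base = .inl u.1) {z : G.Chord} (hz : m.slid = .inl z) (k : Side) :
    (Quot.mk _ (G'.cycle m.s (.inl (m.copy (m.last u))) k) : m.Glued' u) =
      Quot.mk _ (G'.cycle m.s (.inl (m.old z)) k) := by
  obtain rfl | rfl := k.eq_or_eq_opp m.slidSide
  · refine (Quot.sound ⟨?_, ?_⟩).symm
    · rw [hz, liftCycle, m.lift_off u fun h' => m.circ_of_slid hz h'.1]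
    · rw [hu, liftCycle, lift_on]
  · rw [m.cycle_copy_opp, m.cycle_slid_opp hu hz]

theorem glued'_arcAt_old (hu : m.base = .inl u.1) (p : G.Chord) (ε : ℤˣ) (k : Side) :
    (Quot.mk _ (G'.cycle m.s (.inl (G'.arcAt m.s (m.old p) ε)) k) : m.Glued' u) =
      Quot.mk _ (G'.cycle m.s (.inl (m.old (G.arcAt m.s p ε))) k) := by
  obtain h | ⟨u', hu', hz, h⟩ := m.arcAt_old p ε
  · rw [h]
  · obtain rfl : u' = u := Subtype.ext (Sum.inl_injective (hu'.symm.trans hu))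
    rw [h, m.glued'_last u' hu hz]

theorem glued'_arcAt_copy (hu : m.base = .inl u.1) (p : G.OnCircle m.s m.μ) (j k : Side) :
    (Quot.mk _ (G'.cycle m.s
      (.inl (G'.arcAt m.s (m.copy p) (m.s.sgn * G'.sign (m.copy p) * j.sgn))) k) : m.Glued' u) =
      Quot.mk _ (G'.cycle m.s
        (.inl (m.copy (m.last (G.arcOn m.s p (m.s.sgn * G.sign p.1 * j.sgn))))) k) := by
  obtain h | ⟨z, hu', hz, h⟩ := m.arcAt_copy p j
  · rw [h]
  · have : G.arcOn m.s p (m.s.sgn * G.sign p.1 * j.sgn) = u :=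
      Subtype.ext (Sum.inl_injective (hu'.symm.trans hu))
    rw [h, this, m.glued'_last u hu hz]

/-- The former cycle on the chosen side of an edge of `μ` now runs along the outer side of its copy;
all other sides stay in place. The identification absorbs the exceptional corners at the cut. -/
theorem exists_glued'_lift (hu : m.base = .inl u.1) : ∃ F : G.Cycle → m.Glued' u,
    (∀ a k, F (G.cycle m.s a k) = Quot.mk _ (m.liftCycle u a k)) ∧
    ∀ a k, F (G.cycle m.s.other a k) = Quot.mk _ (G'.cycle m.s.other (m.liftOther a) k) := by
  refine G.exists_cycle_lift m.s (fun a k => (Quot.mk _ (m.liftCycle u a k) : m.Glued' u))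
    (fun a k => Quot.mk _ (G'.cycle m.s.other (m.liftOther a) k)) ?_
  intro p i j
  by_cases h : G.circ m.s p = m.μ ∧ i = m.baseSide
  · obtain ⟨hp, rfl⟩ := h
    have h1 := m.lift_on u (G.arcOn m.s ⟨p, hp⟩ (m.s.sgn * G.sign p * j.sgn))
    refine (congrArg (fun d : G'.Arc m.s × Side =>
      (Quot.mk _ (G'.cycle m.s d.1 d.2) : m.Glued' u)) h1).trans ?_
    refine (m.glued'_arcAt_copy u hu ⟨p, hp⟩ j _).symm.trans ?_
    rw [G'.cycle_corner, arcAt_other_copy]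
    rfl
  · have h' : ¬(G.circ m.s (G.arcAt m.s p (m.s.sgn * G.sign p * j.sgn)) = m.μ ∧
        i = m.baseSide) := by rwa [G.circ_arcAt]
    refine (congrArg (fun d : G'.Arc m.s × Side =>
      (Quot.mk _ (G'.cycle m.s d.1 d.2) : m.Glued' u)) (m.lift_off u h')).trans ?_
    refine (m.glued'_arcAt_old u hu _ _ _).symm.trans ?_
    rw [← m.sign_old, G'.cycle_corner, m.sign_old,
      m.arcAt_other_old h]
    rfl

open Classical in
/-- The cycle of the strip between an edge of the circle and its copy. -/
noncomputable def strip (x : G.OnCircle m.s m.μ) :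
    m.Glued ⊕ {x : G.OnCircle m.s m.μ // x ≠ u} :=
  if h : x = u then .inl (Quot.mk _ (G.cycle m.s m.slid m.slidSide.opp)) else .inr ⟨x, h⟩

/-- This is the map back: outer sides of copies return to `μ`, and the strips go to their edges,
except that the strip over the base edge goes to the far side of the slid arc. -/
theorem exists_descent (hu : m.base = .inl u.1) :
    ∃ H : G'.Cycle → m.Glued ⊕ {x : G.OnCircle m.s m.μ // x ≠ u},
      (∀ x k, ¬(G.circ m.s x = m.μ ∧ k = m.baseSide) →
        H (G'.cycle m.s (.inl (m.old x)) k) = .inl (Quot.mk _ (G.cycle m.s (.inl x) k))) ∧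
      (∀ x : G.OnCircle m.s m.μ,
        H (G'.cycle m.s (.inl (m.old x.1)) m.baseSide) = m.strip u x) ∧
      (∀ x : G.OnCircle m.s m.μ, H (G'.cycle m.s (.inl (m.copy (m.last x))) m.slidSide) =
        .inl (Quot.mk _ (G.cycle m.s (.inl x.1) m.baseSide))) ∧
      (∀ ν k, H (G'.cycle m.s (.inr ν) k) =
        .inl (Quot.mk _ (G.cycle m.s (.inr (m.originFree m.s ν)) k))) ∧
      (∀ x k, H (G'.cycle m.s.other (.inl (m.sndChord x)) k) =
        .inl (Quot.mk _ (G.cycle m.s.other (.inl x) k))) ∧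
      (∀ ν k, H (G'.cycle m.s.other (.inr ν) k) =
        .inl (Quot.mk _ (G.cycle m.s.other (.inr (m.originFree m.s.other ν)) k))) := by
  classical
  let f : G'.Arc m.s → Side → m.Glued ⊕ {x : G.OnCircle m.s m.μ // x ≠ u} := fun a k =>
    match a with
    | .inl q => match (Equiv.ofBijective _ m.chords).symm q with
      | .inl x => if h : G.circ m.s x = m.μ ∧ k = m.baseSide then m.strip u ⟨x, h.1⟩ else
        .inl (Quot.mk _ (G.cycle m.s (.inl x) k))
      | .inr y => if k = m.slidSide then .inl (Quot.mk _ (G.cycle m.s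
          (.inl ((Equiv.ofBijective _ m.last_bijective).symm y).1) m.baseSide))
        else m.strip u ((Equiv.ofBijective _ m.last_bijective).symm y)
    | .inr ν => .inl (Quot.mk _ (G.cycle m.s (.inr (m.originFree m.s ν)) k))
  have e1 : ∀ x, (Equiv.ofBijective _ m.chords).symm (m.old x) = .inl x :=
    fun x => (Equiv.symm_apply_eq _).2 rfl
  have e2 : ∀ x, (Equiv.ofBijective _ m.chords).symm (m.copy x) = .inr x :=
    fun x => (Equiv.symm_apply_eq _).2 rfl
  have e3 : ∀ x, (Equiv.ofBijective _ m.last_bijective).symm (m.last x) = x :=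
    fun x => (Equiv.symm_apply_eq _).2 rfl
  have f1 : ∀ x k, ¬(G.circ m.s x = m.μ ∧ k = m.baseSide) →
      f (.inl (m.old x)) k = .inl (Quot.mk _ (G.cycle m.s (.inl x) k)) := by
    intro x k h
    simp only [f, e1]
    exact dif_neg h
  have f2 : ∀ x : G.OnCircle m.s m.μ, f (.inl (m.old x.1)) m.baseSide = m.strip u x := by
    intro x
    simp only [f, e1]
    exact dif_pos ⟨x.2, trivial⟩
  have f3 : ∀ x : G.OnCircle m.s m.μ, f (.inl (m.copy (m.last x))) m.slidSide =
      .inl (Quot.mk _ (G.cycle m.s (.inl x.1) m.baseSide)) := by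
    intro x
    simp only [f, e2, e3]
    exact if_pos trivial
  have f4 : ∀ x : G.OnCircle m.s m.μ, f (.inl (m.copy (m.last x))) m.slidSide.opp =
      m.strip u x := by
    intro x
    simp only [f, e2, e3]
    exact if_neg (Side.opp_ne _)
  -- The two parts of the slid arc must receive equal values. On the near side this uses the
  -- identification in `Glued`, on the far side the value of `strip` at `u`.
  have f5 : ∀ z, m.slid = .inl z → ∀ k, f (.inl (m.copy (m.last u))) k =
      f (.inl (m.old z)) k := by
    intro z hz k
    rw [f1 z k fun h => m.circ_of_slid hz h.1]
    obtain rfl | rfl := k.eq_or_eq_opp m.slidSide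
    · rw [f3]
      refine (congrArg Sum.inl (Quot.sound ⟨?_, ?_⟩)).symm
      · rw [hz]
      · rw [hu]
    · rw [f4, strip, dif_pos rfl]
      exact congrArg (fun a => Sum.inl (Quot.mk _ (G.cycle m.s a _))) hz
  have f6 : ∀ p ε k, f (.inl (G'.arcAt m.s (m.old p) ε)) k =
      f (.inl (m.old (G.arcAt m.s p ε))) k := by
    intro p ε k
    obtain h | ⟨u', hu', hz, h⟩ := m.arcAt_old p ε
    · rw [h]
    · obtain rfl : u' = u := Subtype.ext (Sum.inl_injective (hu'.symm.trans hu))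
      rw [h, f5 _ hz]
  have f7 : ∀ (p : G.OnCircle m.s m.μ) (j k : Side),
      f (.inl (G'.arcAt m.s (m.copy p) (m.s.sgn * G'.sign (m.copy p) * j.sgn))) k =
        f (.inl (m.copy (m.last (G.arcOn m.s p (m.s.sgn * G.sign p.1 * j.sgn))))) k := by
    intro p j k
    obtain h | ⟨z, hu', hz, h⟩ := m.arcAt_copy p j
    · rw [h]
    · have : G.arcOn m.s p (m.s.sgn * G.sign p.1 * j.sgn) = u :=
        Subtype.ext (Sum.inl_injective (hu'.symm.trans hu))
      rw [h, this, f5 _ hz]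
  let g : G'.Arc m.s.other → Side → m.Glued ⊕ {x : G.OnCircle m.s m.μ // x ≠ u} := fun a k =>
    match a with
    | .inl q => if h : ∃ x, q = m.sndChord x then
        .inl (Quot.mk _ (G.cycle m.s.other (.inl h.choose) k))
      else if h : ∃ p : G.OnCircle m.s m.μ, q = m.fstChord p.1 then
        m.strip u (G.arcOn m.s h.choose (m.s.sgn * G.sign h.choose.1 * k.sgn))
      -- This value is never used, by `exists_snd_or_fst`.
      else m.strip u u
    | .inr ν => .inl (Quot.mk _ (G.cycle m.s.other (.inr (m.originFree m.s.other ν)) k))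
  have g1 : ∀ x k, g (.inl (m.sndChord x)) k =
      .inl (Quot.mk _ (G.cycle m.s.other (.inl x) k)) := by
    intro x k
    have h : ∃ y, m.sndChord x = m.sndChord y := ⟨x, rfl⟩
    simp only [g, dif_pos h]
    rw [← m.snd_inj.1 h.choose_spec]
  have g2 : ∀ (p : G.OnCircle m.s m.μ) k, g (.inl (m.fstChord p.1)) k =
      m.strip u (G.arcOn m.s p (m.s.sgn * G.sign p.1 * k.sgn)) := by
    intro p k
    have h : ¬∃ y, m.fstChord p.1 = m.sndChord y := fun ⟨y, hy⟩ => m.fst_ne_snd p y hy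
    have h' : ∃ q : G.OnCircle m.s m.μ, m.fstChord p.1 = m.fstChord q.1 := ⟨p, rfl⟩
    simp only [g, dif_neg h, dif_pos h']
    rw [← m.fst_inj.1 h'.choose_spec]
  obtain ⟨H, hH, hH'⟩ := G'.exists_cycle_lift m.s f g (by
    intro q i j
    obtain ⟨p, rfl⟩ | ⟨p, rfl⟩ := m.exists_old_or_copy q
    · rw [f6, m.sign_old]
      by_cases h : G.circ m.s p = m.μ ∧ i = m.baseSide
      · obtain ⟨hp, rfl⟩ := h
        have h1 := m.arcAt_other_old_base ⟨p, hp⟩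
        have h2 := f2 (G.arcOn m.s ⟨p, hp⟩ (m.s.sgn * G.sign p * j.sgn))
        have h3 := g2 ⟨p, hp⟩ j
        simp only at h1 h3
        rw [h1, h3]
        exact h2
      · rw [m.arcAt_other_old h, g1, f1 _ _ (by rwa [G.circ_arcAt]), G.cycle_corner]
    · rw [f7]
      obtain rfl | rfl := i.eq_or_eq_opp m.slidSide
      · rw [f3, arcAt_other_copy, g1, ← G.cycle_corner]
        rfl
      · rw [f4, arcAt_other_copy_opp, g2])
  exact ⟨H, fun x k h => (hH _ _).trans (f1 x k h), fun x => (hH _ _).trans (f2 x),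
    fun x => (hH _ _).trans (f3 x), fun ν k => hH _ _, fun x k => (hH' _ _).trans (g1 x k),
    fun ν k => hH' _ _⟩

/-- The cycles of `G'`, up to the identification along the band, are the cycles of `G`, up to the
identification at the ends of the band, and the small cycles between the edges and their copies. -/
theorem exists_glued_equiv (hu : m.base = .inl u.1) :
    ∃ e : m.Glued ⊕ {x : G.OnCircle m.s m.μ // x ≠ u} ≃ m.Glued' u,
      ∀ x, e (.inr x) = Quot.mk _ (G'.cycle m.s (.inl (m.old x.1.1)) m.baseSide) := by
  obtain ⟨F, hF, hF'⟩ := m.exists_glued'_lift u hu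
  obtain ⟨H, h1, h2, h3, h4, h5, h6⟩ := m.exists_descent u hu
  have hs : m.strip u u = .inl (Quot.mk _ (G.cycle m.s m.slid m.slidSide.opp)) := dif_pos rfl
  have hl : ∀ a k, H (m.liftCycle u a k) = .inl (Quot.mk _ (G.cycle m.s a k)) := by
    intro a k
    unfold liftCycle
    rcases a with x | ν
    · by_cases h : G.circ m.s x = m.μ ∧ k = m.baseSide
      · obtain ⟨hx, rfl⟩ := h
        rw [m.lift_on u ⟨x, hx⟩]
        exact h3 ⟨x, hx⟩
      · rw [m.lift_off u h]
        exact h1 x k h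
    · by_cases h : m.slid = .inr ν
      · rw [m.lift_slid u h]
        obtain rfl | rfl := k.eq_or_eq_opp m.slidSide
        · refine (h3 u).trans (congrArg Sum.inl (Quot.sound ⟨?_, ?_⟩)).symm
          · rw [h]
          · rw [hu]
        · simp only [m.cycle_copy_opp]
          rw [h2, hs]
          exact congrArg (fun a => Sum.inl (Quot.mk _ (G.cycle m.s a _))) h
      · obtain ⟨ρ, rfl, hρ⟩ := m.lift_free u h
        rw [hρ]
        exact h4 ρ k
  let Φ : m.Glued ⊕ {x : G.OnCircle m.s m.μ // x ≠ u} → m.Glued' u := Sum.elim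
    (Quot.lift F (by
      rintro _ _ ⟨rfl, rfl⟩
      rw [hF, hF]
      exact Quot.sound ⟨rfl, rfl⟩))
    (fun x => Quot.mk _ (G'.cycle m.s (.inl (m.old x.1.1)) m.baseSide))
  -- For `x = u` the strip is not a new cycle but the lift of the far side of the slid arc.
  have hstrip : ∀ x, Φ (m.strip u x) =
      Quot.mk _ (G'.cycle m.s (.inl (m.old x.1)) m.baseSide) := by
    intro x
    by_cases hx : x = u
    · subst hx
      rw [hs, ← m.liftCycle_slid_opp x hu]
      exact hF _ _
    · rw [strip, dif_neg hx]
      rfl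
  refine ⟨⟨Φ, Quot.lift H ?_, ?_, ?_⟩, fun x => rfl⟩
  · rintro _ _ ⟨rfl, rfl⟩
    rw [hl, hl]
    exact congrArg _ (Quot.sound ⟨rfl, rfl⟩)
  · rintro (⟨⟨z⟩⟩ | x)
    · refine G.cycle_ind (P := fun z => Quot.lift H _ (F z) = .inl (Quot.mk _ z))
        (fun t a k => ?_) z
      rcases m.s.eq_or_eq_other t with rfl | rfl
      · rw [hF]
        exact hl a k
      · rw [hF']
        rcases a with x | ν
        · exact h5 x k
        · refine (h6 _ k).trans ?_
          exact congrArg (fun ρ => Sum.inl (Quot.mk _ (G.cycle m.s.other (.inr ρ) k)))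
            (Subtype.ext ((m.circle m.s.other).symm_apply_apply _))
    · refine (h2 x.1).trans ?_
      rw [strip, dif_neg x.2]
  · rintro ⟨z⟩
    refine G'.cycle_ind (P := fun z => Φ (H z) = Quot.mk _ z) (fun t a k => ?_) z
    rcases m.s.eq_or_eq_other t with rfl | rfl
    · rcases a with q | ν
      · obtain ⟨x, rfl⟩ | ⟨x, rfl⟩ := m.exists_old_or_copy_last q
        · by_cases h : G.circ m.s x = m.μ ∧ k = m.baseSide
          · obtain ⟨hx, rfl⟩ := h
            exact (congrArg Φ (h2 ⟨x, hx⟩)).trans (hstrip ⟨x, hx⟩)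
          · rw [h1 x k h]
            refine (hF _ _).trans ?_
            exact congrArg (fun d : G'.Arc m.s × Side =>
              (Quot.mk _ (G'.cycle m.s d.1 d.2) : m.Glued' u)) (m.lift_off u h)
        · obtain rfl | rfl := k.eq_or_eq_opp m.slidSide
          · rw [h3]
            refine (hF _ _).trans ?_
            exact congrArg (fun d : G'.Arc m.s × Side =>
              (Quot.mk _ (G'.cycle m.s d.1 d.2) : m.Glued' u)) (m.lift_on u _)
          · rw [cycle_copy_opp, h2, hstrip]
      · rw [h4]
        refine (hF _ _).trans ?_
        exact congrArg (fun d : G'.Arc m.s × Side =>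
          (Quot.mk _ (G'.cycle m.s d.1 d.2) : m.Glued' u)) (m.lift_originFree u _ _)
    · rcases a with q | ν
      · obtain ⟨x, rfl⟩ | ⟨p, rfl⟩ := m.exists_snd_or_fst q
        · rw [h5]
          exact hF' _ _
        · rw [cycle_strip]
          have := h2 (G.arcOn m.s p (m.s.sgn * G.sign p.1 * k.sgn))
          exact (congrArg Φ this).trans (hstrip _)
      · rw [h6]
        refine (hF' _ _).trans ?_
        rw [liftOther_originFree]

end HMove

end DecoratedGaussDiagram

/-! ### H-move: the number of colors -/

namespace DecoratedGaussDiagram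

/-- The class of the colors on a side of a circle, after surgery along its family. -/
theorem exists_capClass (G : DecoratedGaussDiagram) (s : Family) :
    ∃ K : G.Circ s → Side → G.ColorClass s,
      ∀ a k, K (G.arcCirc s a) k = Quot.mk _ (G.col s a k) := by
  choose A hA using G.toGaussDiagram.exists_arc s
  exact ⟨fun μ k => Quot.mk _ (G.col s (A μ) k), fun a k => Quot.sound (.cap _ _ _ (hA _))⟩

namespace HMove

variable {G G' : DecoratedGaussDiagram} (m : HMove G G') (u : G.OnCircle m.s m.μ)

theorem exists_color_over (c : G.Color) : ∃ c', m.colorMap c' = some c := by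
  have h : Nat.card {c' : G'.Color // m.colorMap c' = some c} ≠ 0 := by
    have h1 := m.color_count c
    by_cases h : G.cycle m.s m.slid m.slidSide = G.cycle m.s m.base m.baseSide ∧
      c = G.col m.s m.slid m.slidSide
    · rw [h1.1 h]; decide
    · rw [h1.2 h]; decide
  obtain ⟨⟨c', hc⟩⟩ := (Nat.card_ne_zero.1 h).1
  exact ⟨c', hc⟩

theorem card_chord (m : HMove G G') :
    Nat.card G'.Chord = Nat.card G.Chord + Nat.card (G.OnCircle m.s m.μ) := by
  rw [← Nat.card_congr (Equiv.ofBijective _ m.chords), Nat.card_sum]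

theorem card_ne_add_one :
    Nat.card {x : G.OnCircle m.s m.μ // x ≠ u} + 1 = Nat.card (G.OnCircle m.s m.μ) := by
  classical
  rw [← Finite.card_option, Nat.card_congr (Equiv.optionSubtypeNe u)]

theorem strip_color_none (hu : m.base = .inl u.1) {x : G.OnCircle m.s m.μ} (hx : x ≠ u) :
    m.colorMap (G'.col m.s (.inl (m.old x.1)) m.baseSide) = none :=
  (m.color_new _).2 ⟨x, fun h => hx (Subtype.ext (Sum.inl_injective (h.symm.trans hu))), rfl⟩

theorem exists_strip_of_color_none (hu : m.base = .inl u.1) {c' : G'.Color}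
    (h : m.colorMap c' = none) :
    ∃ x ≠ u, c' = G'.col m.s (.inl (m.old x.1)) m.baseSide := by
  obtain ⟨z, rfl⟩ := G'.color_surjective c'
  obtain ⟨x, hx, rfl⟩ := (m.color_new z).1 h
  exact ⟨x, fun h => hx (h ▸ hu), rfl⟩

/-- Equal new colors force equal cycles, and the equivalence `exists_glued_equiv` keeps the small
cycles over different edges apart. -/
theorem strip_color_inj (hu : m.base = .inl u.1) {x y : G.OnCircle m.s m.μ} (hx : x ≠ u)
    (hy : y ≠ u) (h : G'.col m.s (.inl (m.old x.1)) m.baseSide =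
      G'.col m.s (.inl (m.old y.1)) m.baseSide) : x = y := by
  have h1 := m.color_new_inj _ _ (m.strip_color_none u hu hx) h
  obtain ⟨e, he⟩ := m.exists_glued_equiv u hu
  have h2 : e (.inr ⟨x, hx⟩) = e (.inr ⟨y, hy⟩) := by
    rw [he, he]
    exact congrArg _ h1
  exact congrArg Subtype.val (Sum.inr_injective (e.injective h2))

-- With n chords on `μ`, the glued counts differ by n - 1. This leaves two consecutive values for
-- the change, and parity selects the one congruent to n.
open Classical in
theorem card_cycle (hu : m.base = .inl u.1) :
    Nat.card G'.Cycle + 2 = Nat.card G.Cycle + Nat.card (G.OnCircle m.s m.μ) +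
      if G.cycle m.s m.slid m.slidSide = G.cycle m.s m.base m.baseSide then 2 else 0 := by
  obtain ⟨e, -⟩ := m.exists_glued_equiv u hu
  have h1 := Nat.card_congr e
  rw [Nat.card_sum] at h1
  have h2 := Glue.card (G.cycle m.s m.slid m.slidSide) (G.cycle m.s m.base m.baseSide)
  have h3 := Glue.card (m.liftCycle u m.slid m.slidSide) (m.liftCycle u m.base m.baseSide)
  have h4 := G.card_cycle_mod_two
  have h5 := G'.card_cycle_mod_two
  have h6 := m.card_chord
  have h7 := m.card_ne_add_one u
  simp only [Glued, Glued'] at h1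
  split_ifs at h2 h3 ⊢ <;> omega

open Classical in
theorem sum_card_color_over (m : HMove G G') :
    Nat.card G'.Color = Nat.card {c' // m.colorMap c' = none} + (Nat.card G.Color +
      if G.cycle m.s m.slid m.slidSide = G.cycle m.s m.base m.baseSide then 1 else 0) := by
  have := Fintype.ofFinite G.Color
  have h1 : ∀ c, Nat.card {c' : G'.Color // m.colorMap c' = some c} =
      1 + if c = G.col m.s m.slid m.slidSide then
        (if G.cycle m.s m.slid m.slidSide = G.cycle m.s m.base m.baseSide then 1 else 0)
          else 0 := by
    intro c
    have := m.color_count c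
    split_ifs with h1 h2
    · exact this.1 ⟨h2, h1⟩
    · exact this.2 fun h => h2 h.1
    · exact this.2 fun h => h1 h.2
  rw [Nat.card_eq_sum_card_fiber m.colorMap, Fintype.sum_option]
  simp only [h1, Finset.sum_add_distrib, Finset.sum_ite_eq', Finset.sum_const, Finset.mem_univ,
    if_true, Finset.card_univ, Nat.card_eq_fintype_card, smul_eq_mul, mul_one]

open Classical in
theorem card_color (hu : m.base = .inl u.1) :
    Nat.card G'.Color + 1 = Nat.card G.Color + Nat.card (G.OnCircle m.s m.μ) +
      if G.cycle m.s m.slid m.slidSide = G.cycle m.s m.base m.baseSide then 1 else 0 := by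
  have h : Nat.card {c' // m.colorMap c' = none} =
      Nat.card {x : G.OnCircle m.s m.μ // x ≠ u} := by
    refine (Nat.card_congr (Equiv.ofBijective
      (fun x => ⟨G'.col m.s (.inl (m.old x.1.1)) m.baseSide, m.strip_color_none u hu x.2⟩)
      ⟨fun x y h => ?_, fun c => ?_⟩)).symm
    · exact Subtype.ext (m.strip_color_inj u hu x.2 y.2 (congrArg Subtype.val h))
    · obtain ⟨x, hx, h⟩ := m.exists_strip_of_color_none u hu c.2
      exact ⟨⟨x, hx⟩, Subtype.ext h.symm⟩
  have := m.sum_card_color_over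
  have := m.card_ne_add_one u
  omega

theorem color_lift (hu : m.base = .inl u.1) (a : G.Arc m.s) (k : Side) :
    m.colorMap (G'.col m.s (m.lift u a k).1 (m.lift u a k).2) = some (G.col m.s a k) := by
  rcases a with x | ν
  · by_cases h : G.circ m.s x = m.μ ∧ k = m.baseSide
    · obtain ⟨hx, rfl⟩ := h
      rw [m.lift_on u ⟨x, hx⟩]
      exact m.color_copy ⟨x, hx⟩
    · rw [m.lift_off u h]
      exact m.color_old x k h
  · by_cases h : m.slid = .inr ν
    · rw [m.lift_slid u h]
      obtain rfl | rfl := k.eq_or_eq_opp m.slidSide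
      · refine (m.color_copy u).trans ?_
        rw [← h, m.same_color, hu]
      · rw [← h]
        exact m.color_slid_far u hu
    · obtain ⟨ρ, rfl, hρ⟩ := m.lift_free u h
      rw [hρ]
      refine m.color_free _ ρ k (m.circle_originFree _ _) fun h' => ?_
      exact (m.originFree m.s ρ).2 u.1 (u.2.trans h'.1.symm)

theorem color_liftOther (a : G.Arc m.s.other) (k : Side) :
    m.colorMap (G'.col m.s.other (m.liftOther a) k) = some (G.col m.s.other a k) := by
  rcases a with x | ν
  · exact m.color_old_other x k
  · exact m.color_free_other ν _ k rfl

theorem col_copy_opp (x : G.OnCircle m.s m.μ) :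
    G'.col m.s (.inl (m.copy (m.last x))) m.slidSide.opp =
      G'.col m.s (.inl (m.old x.1)) m.baseSide := congrArg G'.color (m.cycle_copy_opp x)

theorem col_lift_slid_opp (hu : m.base = .inl u.1) :
    G'.col m.s (m.lift u m.slid m.slidSide.opp).1 (m.lift u m.slid m.slidSide.opp).2 =
      G'.col m.s (.inl (m.old u.1)) m.baseSide := congrArg G'.color (m.liftCycle_slid_opp u hu)

/-- The two parts of a split color lie along the two parts of the slid arc. They are joined by a
capping disc of the slid circle, or, if this arc can be crossed, through the region on its far side.
-/
theorem class_eq_of_colorMap_eq (t : Family) {c : G.Color} {a b : G'.Color}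
    (ha : m.colorMap a = some c) (hb : m.colorMap b = some c) :
    (Quot.mk _ a : G'.ColorClass t) = Quot.mk _ b := by
  by_cases h : G.cycle m.s m.slid m.slidSide = G.cycle m.s m.base m.baseSide ∧
      c = G.col m.s m.slid m.slidSide
  · have h2 := (m.color_count c).1 h
    obtain ⟨h, rfl⟩ := h
    rcases hz : m.slid with z | ν
    · rcases hu : m.base with x | ν
      · have hx : G.circ m.s x = m.μ := by
          have := m.base_circ
          rw [hu] at this
          exact this
        obtain ⟨u, rfl⟩ : ∃ u : G.OnCircle m.s m.μ, x = u.1 := ⟨⟨x, hx⟩, rfl⟩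
        have h3 := m.color_split h u z hu hz
        have h4 := m.color_old z m.slidSide fun h' => m.circ_of_slid hz h'.1
        have h5 := m.color_copy u
        rw [← hz] at h4
        rw [← hu, ← m.same_color] at h5
        have h6 : (Quot.mk _ (G'.col m.s (.inl (m.old z)) m.slidSide) : G'.ColorClass t) =
            Quot.mk _ (G'.col m.s (.inl (m.copy (m.last u))) m.slidSide) := by
          by_cases ht : m.s = t
          · subst ht
            refine Quot.sound (.cap _ _ _ ?_)
            refine (m.circ_old _ _).trans (.trans ?_ (m.circ_copy _).symm)
            rw [hz]
            rfl
          · have h7 : G'.col m.s (.inl (m.old z)) m.slidSide.opp =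
                G'.col m.s (.inl (m.copy (m.last u))) m.slidSide.opp := by
              rw [col_copy_opp]
              exact congrArg G'.color (m.cycle_slid_opp hu hz)
            refine (Quot.sound (.arc m.s ht _ _ m.slidSide.opp)).trans ?_
            rw [h7]
            exact Quot.sound (.arc m.s ht _ _ _)
        have h7 : ∀ d : G'.Color, m.colorMap d = some (G.col m.s m.slid m.slidSide) →
            (Quot.mk _ d : G'.ColorClass t) =
              Quot.mk _ (G'.col m.s (.inl (m.old z)) m.slidSide) := by
          intro d hd
          rcases eq_or_eq_of_card_subtype_eq_two h2 h4 h5 h3 hd with rfl | rfl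
          · rfl
          · exact h6.symm
        rw [h7 a ha, h7 b hb]
      · rw [hz, hu] at h
        have := G.dart_eq_of_cycle_free_eq h.symm
        cases this
    · rw [hz] at h
      have h' := G.dart_eq_of_cycle_free_eq h
      have h1 := m.slid_circ
      rw [← m.base_circ, hz] at h1
      have h2 := (eq_of_heq (Sigma.mk.inj h').2)
      exact absurd (congrArg (G.arcCirc m.s) (congrArg Prod.fst h2)).symm h1
  · rw [eq_of_card_subtype_eq_one ((m.color_count c).2 h) ha hb]

open Classical in
/-- The map from the colors of `G'` to the classes of colors of `G` that sends the new color
between an edge and its copy to a given class. -/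
theorem exists_colorClass_map (hu : m.base = .inl u.1) (t : Family)
    (σ : G.OnCircle m.s m.μ → G.ColorClass t)
    (hσ : σ u = Quot.mk _ (G.col m.s m.slid m.slidSide.opp)) :
    ∃ g : G'.Color → G.ColorClass t,
      (∀ c' c, m.colorMap c' = some c → g c' = Quot.mk _ c) ∧
      ∀ x : G.OnCircle m.s m.μ, g (G'.col m.s (.inl (m.old x.1)) m.baseSide) = σ x := by
  refine ⟨fun c' => (m.colorMap c').elim
    -- By `exists_strip_of_color_none` every color over `none` is of this form; the alternative `σ
    -- u` is only a default.
    (if h : ∃ x ≠ u, c' = G'.col m.s (.inl (m.old x.1)) m.baseSide then σ h.choose else σ u)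
    (Quot.mk _), fun c' c h => by beta_reduce; rw [h]; rfl, fun x => ?_⟩
  by_cases hx : x = u
  · subst hx
    beta_reduce
    rw [m.color_base x hu]
    exact hσ.symm
  · beta_reduce
    rw [m.strip_color_none u hu hx]
    have h : ∃ y ≠ u, G'.col m.s (.inl (m.old x.1)) m.baseSide =
      G'.col m.s (.inl (m.old y.1)) m.baseSide := ⟨x, hx, rfl⟩
    refine (dif_pos h).trans ?_
    rw [← m.strip_color_inj u hu hx h.choose_spec.1 h.choose_spec.2]

end HMove

end DecoratedGaussDiagram

/-! ### H-move along a circle with chords: components -/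

namespace DecoratedGaussDiagram

namespace HMove

variable {G G' : DecoratedGaussDiagram} (m : HMove G G') (u : G.OnCircle m.s m.μ)

theorem arcCirc_liftOther (a : G.Arc m.s.other) :
    G'.arcCirc m.s.other (m.liftOther a) = m.circle m.s.other (G.arcCirc m.s.other a) := by
  rcases a with x | ν
  · exact m.circ_other_snd x
  · rfl

/-- The circle and the side on which the lift of a side of an arc lies. -/
theorem lift_congr {a b : G.Arc m.s} (h : G.arcCirc m.s a = G.arcCirc m.s b) (k : Side) :
    G'.arcCirc m.s (m.lift u a k).1 = G'.arcCirc m.s (m.lift u b k).1 ∧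
      (m.lift u a k).2 = (m.lift u b k).2 := by
  have hfree : ∀ ν : G.FreeCircle m.s, ∀ b, G.arcCirc m.s b = ν.1 → b = .inr ν := by
    rintro ν (x | ρ) hb
    · exact absurd hb (ν.2 x)
    · exact congrArg _ (Subtype.ext hb)
  rcases a with x | ν
  · rcases b with y | ν
    · change G.circ m.s x = G.circ m.s y at h
      by_cases hx : G.circ m.s x = m.μ ∧ k = m.baseSide
      · obtain ⟨hx, rfl⟩ := hx
        rw [m.lift_on u ⟨x, hx⟩, m.lift_on u ⟨y, h ▸ hx⟩]
        exact ⟨(m.circ_copy _).trans (m.circ_copy _).symm, rfl⟩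
      · rw [m.lift_off u hx, m.lift_off u (h ▸ hx)]
        refine ⟨(m.circ_old _ _).trans (.trans ?_ (m.circ_old _ _).symm), rfl⟩
        rw [h]
    · rw [hfree ν _ h]
      exact ⟨rfl, rfl⟩
  · rw [hfree ν b h.symm]
    exact ⟨rfl, rfl⟩

/-- All strips lie on one side of `μ`, so one capping disc joins them to the opened strip over the
base edge. They therefore represent the region on the far side of the slid arc. -/
theorem card_colorClass (hu : m.base = .inl u.1) :
    Nat.card (G.ColorClass m.s) = Nat.card (G'.ColorClass m.s) := by
  classical
  choose up hup using m.exists_color_over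
  have hup1 : ∀ a k, (Quot.mk _ (up (G.col m.s a k)) : G'.ColorClass m.s) =
      Quot.mk _ (G'.col m.s (m.lift u a k).1 (m.lift u a k).2) :=
    fun a k => m.class_eq_of_colorMap_eq m.s (hup _) (m.color_lift u hu a k)
  have hup2 : ∀ a k, (Quot.mk _ (up (G.col m.s.other a k)) : G'.ColorClass m.s) =
      Quot.mk _ (G'.col m.s.other (m.liftOther a) k) :=
    fun a k => m.class_eq_of_colorMap_eq m.s (hup _) (m.color_liftOther a k)
  obtain ⟨g, hg, hgs⟩ := m.exists_colorClass_map u hu m.s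
    (fun _ => Quot.mk _ (G.col m.s m.slid m.slidSide.opp)) rfl
  obtain ⟨K, hK⟩ := G.exists_capClass m.s
  have hbase : ∀ x : G.OnCircle m.s m.μ, (Quot.mk _ (G.col m.s (.inl x.1) m.baseSide) :
      G.ColorClass m.s) = Quot.mk _ (G.col m.s m.slid m.slidSide) := by
    intro x
    rw [m.same_color]
    exact Quot.sound (.cap _ _ _ (x.2.trans m.base_circ.symm))
  -- The chosen side of `μ` now belongs to the far region of the slid arc. Every other side of a
  -- circle keeps its class: the copy has the color of `μ` outside, which equals that of the slid
  -- arc, and strips inside.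
  have hcap : ∀ a k, g (G'.col m.s a k) =
      if G'.arcCirc m.s a = m.circle m.s m.μ ∧ k = m.baseSide then
        Quot.mk _ (G.col m.s m.slid m.slidSide.opp)
      else K ((m.circle m.s).symm (G'.arcCirc m.s a)) k := by
    intro a k
    rcases a with q | ν
    · obtain ⟨x, rfl⟩ | ⟨x, rfl⟩ := m.exists_old_or_copy_last q
      · have e : G'.arcCirc m.s (.inl (m.old x)) = m.circle m.s (G.circ m.s x) := m.circ_old _ _
        rw [e, Equiv.apply_eq_iff_eq, Equiv.symm_apply_apply]
        split_ifs with h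
        · obtain ⟨hx, rfl⟩ := h
          exact hgs ⟨x, hx⟩
        · rw [hg _ _ (m.color_old x k h)]
          exact (hK (.inl x) k).symm
      · have e : G'.arcCirc m.s (.inl (m.copy (m.last x))) =
          m.circle m.s (G.arcCirc m.s m.slid) := m.circ_copy _
        rw [e, Equiv.apply_eq_iff_eq, Equiv.symm_apply_apply, if_neg fun h => m.slid_circ h.1, hK]
        obtain rfl | rfl := k.eq_or_eq_opp m.slidSide
        · rw [hg _ _ (m.color_copy x), hbase]
        · rw [m.col_copy_opp, hgs]
    · have h := m.color_lift u hu (.inr (m.originFree m.s ν)) k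
      rw [m.lift_originFree] at h
      rw [hg _ _ h, if_neg]
      · exact (hK (.inr (m.originFree m.s ν)) k).symm
      · rintro ⟨h, -⟩
        exact ν.2 (m.old u.1) ((m.circ_old _ _).trans (.trans (congrArg _ u.2) h.symm))
  refine Nat.card_congr_of_quot g (fun c => Quot.mk _ (up c)) ?_ ?_ ?_ ?_
  · rintro _ _ (⟨t, ht, a, k, l⟩ | ⟨a, b, k, h⟩)
    · obtain rfl := (m.s.ne_iff t).1 ht
      rcases a with q | ν
      · obtain ⟨x, rfl⟩ | ⟨p, rfl⟩ := m.exists_snd_or_fst q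
        · rw [hg _ _ (m.color_old_other x k), hg _ _ (m.color_old_other x l)]
          exact Quot.sound (.arc _ ht _ _ _)
        · have h : ∀ k, g (G'.col m.s.other (.inl (m.fstChord p.1)) k) =
              Quot.mk _ (G.col m.s m.slid m.slidSide.opp) := by
            intro k
            rw [← hgs (G.arcOn m.s p (m.s.sgn * G.sign p.1 * k.sgn))]
            exact congrArg (fun z => g (G'.color z)) (m.cycle_strip p k)
          rw [h, h]
      · have h := m.color_liftOther (.inr (m.originFree m.s.other ν))
        rw [liftOther_originFree] at h
        rw [hg _ _ (h k), hg _ _ (h l)]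
        exact Quot.sound (.arc _ ht _ _ _)
    · rw [hcap, hcap, h]
  · rintro _ _ (⟨t, ht, a, k, l⟩ | ⟨a, b, k, h⟩)
    · obtain rfl := (m.s.ne_iff t).1 ht
      rw [hup2, hup2]
      exact Quot.sound (.arc _ ht _ _ _)
    · rw [hup1, hup1]
      obtain ⟨h1, h2⟩ := m.lift_congr u h k
      rw [h2]
      exact Quot.sound (.cap _ _ _ h1)
  · intro c
    exact hg _ _ (hup c)
  · intro c'
    rcases h : m.colorMap c' with _ | c
    · obtain ⟨x, hx, rfl⟩ := m.exists_strip_of_color_none u hu h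
      rw [hgs]
      refine (hup1 _ _).trans ?_
      rw [m.col_lift_slid_opp u hu]
      refine Quot.sound (.cap _ _ _ ((m.circ_old _ _).trans (.trans ?_ (m.circ_old _ _).symm)))
      rw [u.2, x.2]
    · rw [hg _ _ h]
      exact m.class_eq_of_colorMap_eq m.s (hup c) h

/-- Arcs of the sliding family can be crossed here, so the strip over an edge of `μ` is joined to
the region on the far side of this edge. -/
theorem card_colorClass_other (hu : m.base = .inl u.1) :
    Nat.card (G.ColorClass m.s.other) = Nat.card (G'.ColorClass m.s.other) := by
  classical
  have hs : m.s ≠ m.s.other := m.s.other_ne.symm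
  choose up hup using m.exists_color_over
  have hup1 : ∀ a k, (Quot.mk _ (up (G.col m.s a k)) : G'.ColorClass m.s.other) =
      Quot.mk _ (G'.col m.s (m.lift u a k).1 (m.lift u a k).2) :=
    fun a k => m.class_eq_of_colorMap_eq m.s.other (hup _) (m.color_lift u hu a k)
  have hup2 : ∀ a k, (Quot.mk _ (up (G.col m.s.other a k)) : G'.ColorClass m.s.other) =
      Quot.mk _ (G'.col m.s.other (m.liftOther a) k) :=
    fun a k => m.class_eq_of_colorMap_eq m.s.other (hup _) (m.color_liftOther a k)
  have hup3 : ∀ x k, (Quot.mk _ (up (G.col m.s (.inl x) k)) : G'.ColorClass m.s.other) =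
      Quot.mk _ (G'.col m.s (.inl (m.old x)) m.baseSide) := by
    intro x k
    rw [hup1]
    by_cases h : G.circ m.s x = m.μ ∧ k = m.baseSide
    · obtain ⟨hx, rfl⟩ := h
      rw [m.lift_on u ⟨x, hx⟩]
      refine (Quot.sound (.arc m.s hs _ _ m.slidSide.opp)).trans ?_
      rw [m.col_copy_opp]
    · rw [m.lift_off u h]
      exact Quot.sound (.arc m.s hs _ _ _)
  have harc : ∀ a k l, (Quot.mk _ (G.col m.s a k) : G.ColorClass m.s.other) =
      Quot.mk _ (G.col m.s a l) := fun a k l => Quot.sound (.arc m.s hs _ _ _)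
  obtain ⟨g, hg, hgs⟩ := m.exists_colorClass_map u hu m.s.other
    -- For the base edge the prescribed class agrees with the far side of the slid arc: cross
    -- `base`, use the common color of the chosen sides, and cross `slid`.
    (fun x => Quot.mk _ (G.col m.s (.inl x.1) m.baseSide.opp)) (by
      rw [harc _ _ m.baseSide, harc _ m.slidSide.opp m.slidSide, m.same_color, hu])
  obtain ⟨K, hK⟩ := G.exists_capClass m.s.other
  have hcap : ∀ a k, g (G'.col m.s.other a k) =
      K ((m.circle m.s.other).symm (G'.arcCirc m.s.other a)) k := by
    intro a k
    rcases a with q | ν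
    · obtain ⟨x, rfl⟩ | ⟨p, rfl⟩ := m.exists_snd_or_fst q
      · have e : G'.arcCirc m.s.other (.inl (m.sndChord x)) =
          m.circle m.s.other (G.circ m.s.other x) := m.circ_other_snd x
        rw [e, Equiv.symm_apply_apply, hg _ _ (m.color_old_other x k)]
        exact (hK (.inl x) k).symm
      · have e : G'.arcCirc m.s.other (.inl (m.fstChord p.1)) =
          m.circle m.s.other (G.circ m.s.other p.1) := m.circ_other_fst p
        rw [e, Equiv.symm_apply_apply]
        have h1 := congrArg (fun z => g (G'.color z)) (m.cycle_strip p k)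
        refine h1.trans ((hgs (G.arcOn m.s p (m.s.sgn * G.sign p.1 * k.sgn))).trans ?_)
        -- The corner at `p` in `G` on the far side of `μ` shows that this region also lies on the
        -- side `k` of the other circle, as the short edge requires.
        have h2 := congrArg (fun z => (Quot.mk _ (G.color z) : G.ColorClass m.s.other))
          (G.cycle_corner m.s p.1 m.baseSide.opp k)
        refine h2.trans ?_
        refine (hK (.inl _) k).symm.trans ?_
        change K (G.circ m.s.other _) k = _
        rw [G.circ_arcAt]
    · have h := m.color_liftOther (.inr (m.originFree m.s.other ν)) k
      rw [liftOther_originFree] at h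
      rw [hg _ _ h]
      exact (hK (.inr (m.originFree m.s.other ν)) k).symm
  have hstrip : ∀ x k, g (G'.col m.s (.inl (m.old x)) k) =
      Quot.mk _ (G.col m.s (.inl x) m.baseSide.opp) := by
    intro x k
    by_cases h : G.circ m.s x = m.μ ∧ k = m.baseSide
    · obtain ⟨hx, rfl⟩ := h
      exact hgs ⟨x, hx⟩
    · rw [hg _ _ (m.color_old x k h)]
      exact harc _ _ _
  refine Nat.card_congr_of_quot g (fun c => Quot.mk _ (up c)) ?_ ?_ ?_ ?_
  · rintro _ _ (⟨t, ht, a, k, l⟩ | ⟨a, b, k, h⟩)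
    · obtain rfl | rfl := m.s.eq_or_eq_other t
      · rcases a with q | ν
        · obtain ⟨x, rfl⟩ | ⟨x, rfl⟩ := m.exists_old_or_copy_last q
          · rw [hstrip, hstrip]
          · have h : ∀ k, g (G'.col m.s (.inl (m.copy (m.last x))) k) =
                Quot.mk _ (G.col m.s (.inl x.1) m.baseSide.opp) := by
              intro k
              obtain rfl | rfl := k.eq_or_eq_opp m.slidSide
              · rw [hg _ _ (m.color_copy x)]
                exact harc _ _ _
              · rw [m.col_copy_opp, hgs]
            rw [h, h]
        · have h := m.color_lift u hu (.inr (m.originFree m.s ν))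
          simp only [m.lift_originFree] at h
          rw [hg _ _ (h k), hg _ _ (h l)]
          exact harc _ _ _
      · exact absurd rfl ht
    · rw [hcap, hcap, h]
  · rintro _ _ (⟨t, ht, a, k, l⟩ | ⟨a, b, k, h⟩)
    · obtain rfl | rfl := m.s.eq_or_eq_other t
      · rcases a with x | ν
        · rw [hup3, hup3]
        · rw [hup1, hup1]
          by_cases h : m.slid = .inr ν
          · rw [m.lift_slid u h, m.lift_slid u h]
            exact Quot.sound (.arc _ ht _ _ _)
          · obtain ⟨ρ, rfl, hρ⟩ := m.lift_free u h
            rw [hρ, hρ]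
            exact Quot.sound (.arc _ ht _ _ _)
      · exact absurd rfl ht
    · rw [hup2, hup2]
      refine Quot.sound (.cap _ _ _ ?_)
      rw [arcCirc_liftOther, arcCirc_liftOther, h]
  · intro c
    exact hg _ _ (hup c)
  · intro c'
    rcases h : m.colorMap c' with _ | c
    · obtain ⟨x, hx, rfl⟩ := m.exists_strip_of_color_none u hu h
      rw [hgs]
      exact hup3 _ _
    · rw [hg _ _ h]
      exact m.class_eq_of_colorMap_eq m.s.other (hup c) h

end HMove

end DecoratedGaussDiagram

/-! ### H-move along a circle without chords, and the conclusion -/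

namespace DecoratedGaussDiagram

namespace HMove

variable {G G' : DecoratedGaussDiagram} (m : HMove G G')

theorem exists_old (hb : ∀ x, G.circ m.s x ≠ m.μ) (q : G'.Chord) : ∃ x, q = m.old x := by
  obtain h | ⟨x, -⟩ := m.exists_old_or_copy q
  · exact h
  · exact absurd x.2 (hb _)

/-- If the circle along which one slides carries no chord, the ribbon graph does not change. -/
def extension (hb : ∀ x, G.circ m.s x ≠ m.μ) :
    GaussDiagram.Extension G.toGaussDiagram G'.toGaussDiagram where
  circle t := m.circle t
  circle_injective t := (m.circle t).injective
  chord := m.old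
  chord_injective _ _ h := m.old_inj.1 h
  sign_chord := m.sign_old
  circ_chord := m.circ_old
  next_chord t x := by
    rcases m.s.eq_or_eq_other t with rfl | rfl
    · exact m.next_old x fun u => absurd u.2 (hb _)
    · have := m.next_link x
      rw [← fstChord, ← sndChord, m.fst_of_not (hb _), m.snd_of_not (hb _)] at this
      exact this
  exists_chord _ q _ _ := m.exists_old hb q

theorem exists_arc (hb : ∀ x, G.circ m.s x ≠ m.μ) (t : Family) (a : G'.Arc t) :
    ∃ b, a = (m.extension hb).arc t b := by
  obtain ⟨μ, h⟩ := (m.circle t).surjective (G'.arcCirc t a)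
  exact (m.extension hb).exists_arc t a μ h.symm

theorem color_arc (hb : ∀ x, G.circ m.s x ≠ m.μ) (a : G.Arc m.s) (k : Side)
    (h : ¬(G.arcCirc m.s a = m.μ ∧ k = m.baseSide)) :
    m.colorMap (G'.col m.s ((m.extension hb).arc m.s a) k) = some (G.col m.s a k) := by
  rcases a with x | ν
  · exact m.color_old x k h
  · exact m.color_free ν _ k rfl h

theorem color_arc_base (hb : ∀ x, G.circ m.s x ≠ m.μ) (a : G.Arc m.s) (h : G.arcCirc m.s a = m.μ) :
    m.colorMap (G'.col m.s ((m.extension hb).arc m.s a) m.baseSide) =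
      some (G.col m.s m.slid m.slidSide.opp) := by
  rcases a with x | ν
  · exact absurd h (hb x)
  · exact m.color_base_free _ (congrArg _ h)

theorem color_arc_other (hb : ∀ x, G.circ m.s x ≠ m.μ) (a : G.Arc m.s.other) (k : Side) :
    m.colorMap (G'.col m.s.other ((m.extension hb).arc m.s.other a) k) =
      some (G.col m.s.other a k) := by
  rcases a with x | ν
  · have := m.color_old_other x k
    rw [← sndChord, m.snd_of_not (hb _)] at this
    exact this
  · exact m.color_free_other ν _ k rfl

theorem card_cycle_of_free (m : HMove G G') (hb : ∀ x, G.circ m.s x ≠ m.μ) :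
    Nat.card G'.Cycle = Nat.card G.Cycle := by
  have h : ∀ t (a : G'.Arc t), ¬∀ b, a ≠ (m.extension hb).arc t b := fun t a h =>
    (m.exists_arc hb t a).elim fun b => h b
  rw [(m.extension hb).card_cycle (X := Empty) (fun t a ha => absurd ha (h t a))
    (fun _ _ t _ q _ h' => absurd h' (h t _)) Empty.elim (fun t a _ ha => absurd ha (h t a))
    fun y => y.elim]
  simp

/-- A side of a circle without chords is a cycle by itself, so the band joins different cycles and
no color splits. -/
theorem cycle_ne_of_free (hb : ∀ x, G.circ m.s x ≠ m.μ) :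
    G.cycle m.s m.slid m.slidSide ≠ G.cycle m.s m.base m.baseSide := by
  intro h
  have h1 := m.base_circ
  rcases hv : m.base with x | ν
  · rw [hv] at h1
    exact hb x h1
  · rw [hv] at h h1
    have h2 := G.dart_eq_of_cycle_free_eq h.symm
    have h3 := congrArg Prod.fst (eq_of_heq (Sigma.mk.inj h2).2)
    exact m.slid_circ ((congrArg (G.arcCirc m.s) h3).trans h1)

theorem color_ne_none (hb : ∀ x, G.circ m.s x ≠ m.μ) (c' : G'.Color) : m.colorMap c' ≠ none := by
  obtain ⟨z, rfl⟩ := G'.color_surjective c'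
  intro h
  obtain ⟨x, -⟩ := (m.color_new z).1 h
  exact hb _ x.2

theorem card_color_of_free (m : HMove G G') (hb : ∀ x, G.circ m.s x ≠ m.μ) :
    Nat.card G'.Color = Nat.card G.Color := by
  classical
  have : IsEmpty {c' // m.colorMap c' = none} := ⟨fun c' => m.color_ne_none hb _ c'.2⟩
  have := m.sum_card_color_over
  rw [if_neg (m.cycle_ne_of_free hb), Nat.card_of_isEmpty (α := {c' // m.colorMap c' = none})]
    at this
  omega

theorem arc_eq_of_free (hb : ∀ x, G.circ m.s x ≠ m.μ) {a b : G.Arc m.s} (ha : G.arcCirc m.s a = m.μ)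
    (h : G.arcCirc m.s a = G.arcCirc m.s b) : a = b := by
  rcases a with x | ν
  · exact absurd ha (hb x)
  · rcases b with x | ρ
    · exact absurd (h.symm.trans ha) (hb x)
    · exact congrArg _ (Subtype.ext h)

/-- Only the color on the chosen side of `μ` changes. Capping gives no relation there, as `μ` is a
single arc; for the other surgery, `base` and `slid` can be crossed and their chosen sides have
equal color. -/
theorem card_colorClass_of_free (hb : ∀ x, G.circ m.s x ≠ m.μ) (t : Family) :
    Nat.card (G.ColorClass t) = Nat.card (G'.ColorClass t) := by
  set e := m.extension hb with he
  choose up hup using m.exists_color_over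
  have hdown : ∀ c', ∃ c, m.colorMap c' = some c := fun c' =>
    Option.ne_none_iff_exists'.1 (m.color_ne_none hb c')
  choose down hdown using hdown
  have hd : ∀ {c' c}, m.colorMap c' = some c → down c' = c := fun h =>
    Option.some_injective _ ((hdown _).symm.trans h)
  have hu : ∀ {c' c}, m.colorMap c' = some c →
      (Quot.mk _ (up c) : G'.ColorClass t) = Quot.mk _ c' := fun h =>
    m.class_eq_of_colorMap_eq t (hup _) h
  have hslid : ∀ k, m.colorMap (G'.col m.s (e.arc m.s m.slid) k) = some (G.col m.s m.slid k) :=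
    fun k => m.color_arc hb _ k fun h => m.slid_circ h.1
  have hbase : ∀ a, G.arcCirc m.s a = m.μ → a = m.base := fun a h =>
    m.arc_eq_of_free hb h (h.trans m.base_circ.symm)
  -- The two sides of the arcs, if surgery is made along the other family.
  have harc : ∀ (ht : m.s ≠ t) a k, (Quot.mk _ (down (G'.col m.s (e.arc m.s a) k)) :
      G.ColorClass t) = Quot.mk _ (G.col m.s a k) := by
    intro ht a k
    by_cases h : G.arcCirc m.s a = m.μ ∧ k = m.baseSide
    · obtain ⟨h, rfl⟩ := h
      rw [hd (m.color_arc_base hb a h), hbase a h, ← m.same_color]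
      exact Quot.sound (.arc m.s ht _ _ _)
    · rw [hd (m.color_arc hb a k h)]
  have harc' : ∀ (ht : m.s ≠ t) a k, (Quot.mk _ (up (G.col m.s a k)) : G'.ColorClass t) =
      Quot.mk _ (G'.col m.s (e.arc m.s a) k) := by
    intro ht a k
    by_cases h : G.arcCirc m.s a = m.μ ∧ k = m.baseSide
    · obtain ⟨h, rfl⟩ := h
      rw [← hu (m.color_arc_base hb a h), hbase a h, ← m.same_color, hu (hslid _), hu (hslid _)]
      exact Quot.sound (.arc m.s ht _ _ _)
    · exact hu (m.color_arc hb a k h)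
  refine Nat.card_congr_of_quot (fun c' => Quot.mk _ (down c')) (fun c => Quot.mk _ (up c))
    ?_ ?_ ?_ ?_
  · rintro _ _ (⟨t', ht, a, k, l⟩ | ⟨a, b, k, h⟩)
    · obtain ⟨a, rfl⟩ := m.exists_arc hb t' a
      obtain rfl | rfl := m.s.eq_or_eq_other t'
      · rw [harc ht, harc ht]
        exact Quot.sound (.arc _ ht _ _ _)
      · rw [hd (m.color_arc_other hb a k), hd (m.color_arc_other hb a l)]
        exact Quot.sound (.arc _ ht _ _ _)
    · obtain ⟨a, rfl⟩ := m.exists_arc hb t a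
      obtain ⟨b, rfl⟩ := m.exists_arc hb t b
      have h' := (m.extension hb).circle_injective t
        (((e.arcCirc_arc t a).symm.trans h).trans (e.arcCirc_arc t b))
      obtain rfl | rfl := m.s.eq_or_eq_other t
      · by_cases ha : G.arcCirc m.s a = m.μ
        · rw [m.arc_eq_of_free hb ha h']
        · rw [hd (m.color_arc hb a k fun h => ha h.1),
            hd (m.color_arc hb b k fun h => ha (h'.trans h.1))]
          exact Quot.sound (.cap _ _ _ h')
      · rw [hd (m.color_arc_other hb a k), hd (m.color_arc_other hb b k)]
        exact Quot.sound (.cap _ _ _ h')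
  · rintro _ _ (⟨t', ht, a, k, l⟩ | ⟨a, b, k, h⟩)
    · obtain rfl | rfl := m.s.eq_or_eq_other t'
      · rw [harc' ht, harc' ht]
        exact Quot.sound (.arc _ ht _ _ _)
      · rw [hu (m.color_arc_other hb a k), hu (m.color_arc_other hb a l)]
        exact Quot.sound (.arc _ ht _ _ _)
    · have h' : G'.arcCirc t (e.arc t a) = G'.arcCirc t (e.arc t b) := by
        rw [e.arcCirc_arc, e.arcCirc_arc, h]
      obtain rfl | rfl := m.s.eq_or_eq_other t
      · by_cases ha : G.arcCirc m.s a = m.μ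
        · rw [m.arc_eq_of_free hb ha h]
        · rw [hu (m.color_arc hb a k fun h => ha h.1),
            hu (m.color_arc hb b k fun h1 => ha (h.trans h1.1))]
          exact Quot.sound (.cap _ _ _ h')
      · rw [hu (m.color_arc_other hb a k), hu (m.color_arc_other hb b k)]
        exact Quot.sound (.cap _ _ _ h')
  · exact fun c => congrArg _ (hd (hup c))
  · exact fun c' => hu (hdown c')

theorem boundaryGenus_eq (m : HMove G G') (s : Family) :
    G.boundaryGenus s = G'.boundaryGenus s := by
  classical
  rw [DecoratedGaussDiagram.boundaryGenus_eq, DecoratedGaussDiagram.boundaryGenus_eq,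
    ← Nat.card_congr (m.circle s)]
  have h1 := m.card_chord
  rcases hu : m.base with x | ν
  · have hx := m.base_circ
    rw [hu] at hx
    obtain ⟨u, rfl⟩ : ∃ u : G.OnCircle m.s m.μ, x = u.1 := ⟨⟨x, hx⟩, rfl⟩
    have h2 : Nat.card (G.ColorClass s) = Nat.card (G'.ColorClass s) := by
      obtain rfl | rfl := m.s.eq_or_eq_other s
      exacts [m.card_colorClass u hu, m.card_colorClass_other u hu]
    have h3 := congrArg (Nat.cast : ℕ → ℚ) (m.card_cycle u hu)
    have h4 := congrArg (Nat.cast : ℕ → ℚ) (m.card_color u hu)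
    rw [h1, h2]
    push_cast at h3 h4 ⊢
    -- The color count enters with coefficient -1, the cycle and chord counts with 1/2; the two
    -- cases of the band cancel separately.
    split_ifs at h3 h4 <;> linarith
  · have hb : ∀ x, G.circ m.s x ≠ m.μ := by
      have := m.base_circ
      rw [hu] at this
      exact fun x hx => ν.2 x (hx.trans this.symm)
    have : IsEmpty (G.OnCircle m.s m.μ) := ⟨fun x => hb _ x.2⟩
    rw [h1, m.card_cycle_of_free hb, m.card_color_of_free hb, m.card_colorClass_of_free hb,
      Nat.card_of_isEmpty (α := G.OnCircle m.s m.μ), add_zero]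

end HMove

theorem Equivalent.boundaryGenus_eq {G G' : DecoratedGaussDiagram} (h : Equivalent G G')
    (s : Family) : G.boundaryGenus s = G'.boundaryGenus s := by
  induction h with
  | rel G G' h =>
    obtain ⟨⟨m⟩⟩ | ⟨⟨m⟩⟩ | ⟨⟨m⟩⟩ | ⟨⟨m⟩⟩ := h
    exacts [m.boundaryGenus_eq s, m.boundaryGenus_eq s, m.boundaryGenus_eq s,
      m.boundaryGenus_eq s]
  | refl => rfl
  | symm _ _ _ ih => exact ih.symm
  | trans _ _ _ _ _ ih ih' => exact ih.trans ih'

end DecoratedGaussDiagram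

/-- The numbers `∂g⁺` and `∂g⁻` are invariants of the equivalence classes of abstract Gauss
diagrams. -/
theorem mainTheorem5 (G G' : DecoratedGaussDiagram) (h : DecoratedGaussDiagram.Equivalent G G') :
    G.boundaryGenus Family.plus = G'.boundaryGenus Family.plus ∧
      G.boundaryGenus Family.minus = G'.boundaryGenus Family.minus :=
  ⟨h.boundaryGenus_eq .plus, h.boundaryGenus_eq .minus⟩
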